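/- **Setting.** Let $\mathsf{St}_{d,r}=\{X\in\mathbb{R}^{d\times r}: X^{\mathsf T}X=I_r\}$, and let $f=\frac1n\sum_{i=1}^n f_i$ with $n\ge 1$, where each $f_i$ is differentiable at the points of $\mathsf{St}_{d,r}$ and its Euclidean gradient satisfies $\|\nabla f_i(X)-\nabla f_i(Y)\|_{\mathsf F}\le L\|X-Y\|_{\mathsf F}$ for all $X,Y\in\mathsf{St}_{d,r}$, with $L>0$. Fix $\rho\ge 0$ and put $\mathbf D_\rho(X,Y)=(I_d-XX^{\mathsf T})Y+4\rho X\,\mathrm{skew}(X^{\mathsf T}Y)$ with $\mathrm{skew}(A)=(A-A^{\mathsf T})/2$. The tangent space $\mathbf T_X$ is $\{Z: X^{\mathsf T}Z+Z^{\mathsf T}X=0\}$ if $\rho>0$ (Stiefel manifold) and $\{Z:X^{\mathsf T}Z=0\}$ if $\rho=0$ (Grassmann manifold, points represented by orthonormal matrices). The Riemannian gradient is $\mathrm{grad}f(X)=\mathbf D_\rho(X,\nabla f(X))$, and $\nu=\min\{1,1/(4\rho)\}$ ($\nu=1$ if $\rho=0$). A retraction $\mathcal R$ is a smooth map from the tangent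 bundle to $\mathsf{St}_{d,r}$ with $\mathcal R(X,0)=X$ and $\frac{d}{dt}\mathcal R(X,tE)|_{t=0}=E$. **Algorithm (S-SVRG).** Given $X^{0,0}\in\mathsf{St}_{d,r}$, for $s=0,\dots,S-1$: compute $\nabla f(X^{s,0})$; for $k=0,\dots,K-1$ draw $|\mathsf B|$ indices independently and uniformly from $\{1,\dots,n\}$ (with replacement), set $\mathcal G=\nabla f(X^{s,0})+\frac1{|\mathsf B|}\sum_{i\in\mathsf B}(\nabla f_i(X^{s,k})-\nabla f_i(X^{s,0}))$ and $X^{s,k+1}=\mathcal R(X^{s,k},-\tau_s\mathbf D_\rho(X^{s,k},\mathcal G))$; then put $X^{s+1,0}=X^{s,K}$ and let $X_r^s$ be $X^{s,k}$ with probability $p_{s,k}$, $k=0,\dots,K$. Return $X_r$ drawn uniformly from $X_r^0,\dots,X_r^{S-1}$. IFO-calls are evaluations of a component gradient ($n$ per outer iteration and $2|\mathsf B|$ per inner iteration); RO-calls are evaluations of $\mathcal R$ (one per inner iteration). $X_r$ is a stochastic $\epsilon$-stationary point if $\mathbb E\|\mathrm{grad}f(X_r)\|_{\mathsf F}^2\le\epsilon$.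 **Theorem.** (a) There are constants $L_1\ge1$, $L_2>0$ with $\|\mathcal R(X,tE)-X\|_{\mathsf F}\le L_1t\|E\|_{\mathsf F}$ and $\|\mathcal R(X,tE)-X-tE\|_{\mathsf F}\le L_2t^2\|E\|_{\mathsf F}^2$ for all $X\in\mathsf{St}_{d,r}$, $E\in\mathbf T_X$, $t\ge0$, and a constant $C>0$ with $\|\nabla f(X)\|_{\mathsf F}\le C$ on $\mathsf{St}_{d,r}$. (b) For any such constants let $\hat L=2L_2C+L_1^2L$ and $\tilde L=L_1^2+4L_2\sqrt r$. Let $0\le\mu\le2/3$, $\kappa>0$, and let $c\in(0,1)$ satisfy $\frac{\hat L}{\sqrt{\tilde L}L}\exp(c^2+2c)\,c\le1$. Set $$K=\lceil(\kappa n)^{\frac1{3(1-\mu)}}\rceil,\quad |\mathsf B|=\lceil K^{2-3\mu}\rceil,\quad \beta=\frac{\sqrt{\tilde L}L}{\nu}K^{\mu-1},\quad \tau_s\equiv\tau=\frac{c\nu}{\sqrt{\tilde L}L}K^{-\mu},$$ and, for $0\le k<K$, with $\Gamma(z,i)=\frac{(1+z)^{i-1}-1}{z}$ and $q=\frac{\tilde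 LL^2\tau^2}{\nu^2|\mathsf B|}$, $$\Delta_k=\tau\Big(\nu-\frac{\hat L\tau}2\Big[1+\Big(1+\frac2{\tilde L\beta\tau}\Big)q\,\Gamma(2\beta\tau+q,K-k)\Big]\Big).$$ Then all $\Delta_k$ are positive, so that $p_{s,k}=\Delta_k/\sum_{j<K}\Delta_j$ $(k<K)$, $p_{s,K}=0$ are probabilities, and for every $\epsilon>0$ there is $S\ge1$ such that S-SVRG with these parameters and $S$ outer iterations returns a stochastic $\epsilon$-stationary point after $O(n^{2/3}/\epsilon+n)$ IFO-calls and $O(n^{\frac{\mu}{3(1-\mu)}}/\epsilon+n^{\frac1{3(1-\mu)}})$ RO-calls; for $\mu=0$ the number of RO-calls is $O(1/\epsilon+n^{1/3})$. The constants in $O(\cdot)$ depend only on $r,\rho,L,L_1,L_2,C,\mu,\kappa,c$ and an upper bound on $f(X^{0,0})-\min_{\mathsf{St}_{d,r}}f$. -/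

import Mathlib

open scoped Matrix Matrix.Norms.Frobenius ENNReal ContDiff

namespace SSVRG

noncomputable section

/-- Real `d × r` matrices. The norm in force on them is the Frobenius norm. -/
abbrev Mat (d r : ℕ) : Type := Matrix (Fin d) (Fin r) ℝ

/-- The Euclidean (Frobenius) inner product `tr (Aᵀ B)`. -/
def inn {d r : ℕ} (A B : Mat d r) : ℝ := (Aᵀ * B).trace

/-- The Stiefel manifold `{X : Xᵀ X = I}`. -/
def St (d r : ℕ) : Set (Mat d r) := {X | Xᵀ * X = 1}

/-- The tangent space at `X`. For `ρ > 0` it is the tangent space of the Stiefel manifold at `X`;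
for `ρ = 0` it is the tangent space of the Grassmann manifold at the class `[X] = {X Q}`,
represented by horizontal matrices. -/
def Tan {d r : ℕ} (ρ : ℝ) (X : Mat d r) : Set (Mat d r) :=
  if ρ = 0 then {Z | Xᵀ * Z = 0} else {Z | Xᵀ * Z + Zᵀ * X = 0}

/-- The tangent bundle as a subset of pairs of matrices. -/
def TanBundle (d r : ℕ) (ρ : ℝ) : Set (Mat d r × Mat d r) :=
  {q | q.1 ∈ St d r ∧ q.2 ∈ Tan ρ q.1}

/-- The Riemannian metric: `⟨E₁, (I - (1 - 1/(4ρ)) X Xᵀ) E₂⟩` for `ρ > 0` (Stiefel), and the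
Euclidean inner product for `ρ = 0` (Grassmann). -/
def metric {d r : ℕ} (ρ : ℝ) (X E₁ E₂ : Mat d r) : ℝ :=
  if ρ = 0 then inn E₁ E₂
  else inn E₁ (((1 : Mat d d) - (1 - 1 / (4 * ρ)) • (X * Xᵀ)) * E₂)

/-- The operator `D_ρ(X, Y) = (I - X Xᵀ) Y + 4 ρ X skew(Xᵀ Y)`. -/
def Dop {d r : ℕ} (ρ : ℝ) (X Y : Mat d r) : Mat d r :=
  ((1 : Mat d d) - X * Xᵀ) * Y + (4 * ρ) • (X * ((1 / 2 : ℝ) • (Xᵀ * Y - Yᵀ * X)))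

/-- The Euclidean gradient: the matrix of partial derivatives. -/
def euclGrad {d r : ℕ} (f : Mat d r → ℝ) (X : Mat d r) : Mat d r :=
  Matrix.of fun i j => fderiv ℝ f X (Matrix.single i j 1)

/-- The Riemannian gradient `D_ρ(X, ∇f(X))`; by `Dop_mem` and `Dop_spec` it is the tangent
vector at `X` that represents `⟨∇f(X), ·⟩` in the metric. -/
def riemGrad {d r : ℕ} (ρ : ℝ) (f : Mat d r → ℝ) (X : Mat d r) : Mat d r :=
  Dop ρ X (euclGrad f X)

/-- The constant `ν` with `ν ‖E‖² ≤ ⟨E, E⟩_X`: `min {1, 1/(4ρ)}`, which is `1` for `ρ = 0`. -/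
def nu (ρ : ℝ) : ℝ := if ρ = 0 then 1 else min 1 (1 / (4 * ρ))

/-- `f = (1/n) ∑ fᵢ`. -/
def avg {d r n : ℕ} (f : Fin n → Mat d r → ℝ) (X : Mat d r) : ℝ :=
  (1 / (n : ℝ)) * ∑ i, f i X

/-- Each `fᵢ` is differentiable at the points of the Stiefel manifold and its Euclidean gradient
is `L`-Lipschitz over the Stiefel manifold. -/
def LipschitzGradients {d r n : ℕ} (f : Fin n → Mat d r → ℝ) (L : ℝ) : Prop :=
  ∀ i, (∀ X ∈ St d r, DifferentiableAt ℝ (f i) X) ∧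
    ∀ X ∈ St d r, ∀ Y ∈ St d r,
      ‖euclGrad (f i) X - euclGrad (f i) Y‖ ≤ L * ‖X - Y‖

/-- A retraction: a smooth map from the tangent bundle to the manifold with `R(X, 0) = X` and
`d/dt R(X, tE) = E` at `t = 0`. -/
structure IsRetraction {d r : ℕ} (ρ : ℝ) (R : Mat d r → Mat d r → Mat d r) : Prop where
  smooth : ContDiffOn ℝ ∞ (fun q : Mat d r × Mat d r => R q.1 q.2) (TanBundle d r ρ)
  mem : ∀ X ∈ St d r, ∀ E ∈ Tan ρ X, R X E ∈ St d r
  zero : ∀ X ∈ St d r, R X 0 = X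
  deriv : ∀ X ∈ St d r, ∀ E ∈ Tan ρ X, HasDerivAt (fun t : ℝ => R X (t • E)) E 0

/-- `L₁ ≥ 1` and `L₂ > 0` are first and second order constants of the retraction. -/
structure RetractionConstants {d r : ℕ} (ρ : ℝ) (R : Mat d r → Mat d r → Mat d r)
    (L₁ L₂ : ℝ) : Prop where
  one_le : 1 ≤ L₁
  pos : 0 < L₂
  first : ∀ X ∈ St d r, ∀ E ∈ Tan ρ X, ∀ t : ℝ, 0 ≤ t →
    ‖R X (t • E) - X‖ ≤ L₁ * t * ‖E‖
  second : ∀ X ∈ St d r, ∀ E ∈ Tan ρ X, ∀ t : ℝ, 0 ≤ t →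
    ‖R X (t • E) - X - t • E‖ ≤ L₂ * t ^ 2 * ‖E‖ ^ 2

/-! ### The algorithm -/

/-- The input of the algorithm: the component functions, the retraction, the direction parameter
`ρ`, the inner iteration number `K`, the mini-batch size `b = |B|`, the step sizes `τ_s`, and the
laws `p_s` on `{0, …, K}` used to select `X_r^s` among the iterates of epoch `s`. -/
structure Input (d r n : ℕ) where
  f : Fin n → Mat d r → ℝ
  R : Mat d r → Mat d r → Mat d r
  ρ : ℝ
  K : ℕ
  b : ℕ
  τ : ℕ → ℝ
  p : ℕ → PMF (Fin (K + 1))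

/-- State inside an epoch: the iterates `X^{s,0}, X^{s,1}, …` computed so far (entries with an
index not yet reached are placeholders), the number of evaluations of component gradients
(IFO-calls) and the number of evaluations of the retraction (RO-calls) made so far. -/
structure EpochState (d r : ℕ) where
  iter : ℕ → Mat d r
  ifo : ℕ
  ro : ℕ

/-- State between epochs: the current starting point `X^{s,0}`, the points `X_r^0, X_r^1, …`
selected so far, and the two oracle counters. -/
structure OuterState (d r : ℕ) where
  X : Mat d r
  sel : ℕ → Mat d r
  ifo : ℕ
  ro : ℕ

/-- What a run returns: the point `X_r` and the two oracle counters. -/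
structure Output (d r : ℕ) where
  X : Mat d r
  ifo : ℕ
  ro : ℕ

/-- The stochastic Euclidean gradient at `X`, with reference point `X₀`, full gradient `g₀` at
`X₀`, and mini-batch `B` (a list of `b` indices, repetitions allowed). -/
def stochGrad {d r n b : ℕ} (f : Fin n → Mat d r → ℝ) (X₀ g₀ X : Mat d r)
    (B : Fin b → Fin n) : Mat d r :=
  g₀ + (1 / (b : ℝ)) • ∑ j, (euclGrad (f (B j)) X - euclGrad (f (B j)) X₀)

/-- Inner iteration `k` of epoch `s`: the mini-batch is drawn uniformly with replacement; it costs
`2 b` component gradients and one retraction. -/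
def innerStep {d r n : ℕ} [NeZero n] (A : Input d r n) (s : ℕ) (g₀ : Mat d r) (k : ℕ)
    (σ : EpochState d r) : PMF (EpochState d r) :=
  (PMF.uniformOfFintype (Fin A.b → Fin n)).bind fun B =>
    PMF.pure
      { iter := Function.update σ.iter (k + 1)
          (A.R (σ.iter k)
            (-(A.τ s • Dop A.ρ (σ.iter k) (stochGrad A.f (σ.iter 0) g₀ (σ.iter k) B))))
        ifo := σ.ifo + 2 * A.b
        ro := σ.ro + 1 }

/-- The first `k` inner iterations of epoch `s`. -/
def innerLoop {d r n : ℕ} [NeZero n] (A : Input d r n) (s : ℕ) (g₀ : Mat d r) :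
    ℕ → EpochState d r → PMF (EpochState d r)
  | 0, σ => PMF.pure σ
  | k + 1, σ => (innerLoop A s g₀ k σ).bind (innerStep A s g₀ k)

/-- Epoch `s`: the full gradient at `X^{s,0}` (cost: `n` component gradients), then `K` inner
iterations, then the selection of `X_r^s` and `X^{s+1,0} := X^{s,K}`. -/
def epoch {d r n : ℕ} [NeZero n] (A : Input d r n) (s : ℕ) (σ : OuterState d r) :
    PMF (OuterState d r) :=
  (innerLoop A s (euclGrad (avg A.f) σ.X) A.K
      { iter := fun _ => σ.X, ifo := σ.ifo + n, ro := σ.ro }).bind fun e =>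
    (A.p s).bind fun k =>
      PMF.pure
        { X := e.iter A.K
          sel := Function.update σ.sel s (e.iter k)
          ifo := e.ifo
          ro := e.ro }

/-- The first `S` epochs. -/
def outerLoop {d r n : ℕ} [NeZero n] (A : Input d r n) (X₀ : Mat d r) :
    ℕ → PMF (OuterState d r)
  | 0 => PMF.pure { X := X₀, sel := fun _ => X₀, ifo := 0, ro := 0 }
  | S + 1 => (outerLoop A X₀ S).bind (epoch A S)

/-- The law of the output of the S-SVRG method with `S` epochs started at `X₀`: `X_r` is drawn
uniformly from `X_r^0, …, X_r^{S-1}`. -/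
def run {d r n : ℕ} [NeZero n] (A : Input d r n) (X₀ : Mat d r) (S : ℕ) [NeZero S] :
    PMF (Output d r) :=
  (outerLoop A X₀ S).bind fun σ =>
    (PMF.uniformOfFintype (Fin S)).bind fun s =>
      PMF.pure { X := σ.sel s, ifo := σ.ifo, ro := σ.ro }

/-- Expectation of a nonnegative random variable. -/
def expect {α : Type} (P : PMF α) (g : α → ℝ≥0∞) : ℝ≥0∞ := ∑' a, P a * g a

/-- The random point `X_r` with output law `P` is a stochastic `ε`-stationary point of
`min {f X : X ∈ St}`. -/
def IsStochStationary {d r : ℕ} (ρ : ℝ) (f : Mat d r → ℝ) (ε : ℝ) (P : PMF (Output d r)) : Prop :=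
  (∀ o ∈ P.support, o.X ∈ St d r) ∧
    expect P (fun o => ENNReal.ofReal (‖riemGrad ρ f o.X‖ ^ 2)) ≤ ENNReal.ofReal ε

/-! ### The parameters -/

/-- `L̂ = 2 L₂ C + L₁² L`. -/
def Lhat (L L₁ L₂ C : ℝ) : ℝ := 2 * L₂ * C + L₁ ^ 2 * L

/-- `L̃ = L₁² + 4 L₂ √r`. -/
def Ltil (r : ℕ) (L₁ L₂ : ℝ) : ℝ := L₁ ^ 2 + 4 * L₂ * √(r : ℝ)

/-- `K = ⌈(κ n)^{1/(3(1-μ))}⌉`. -/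
def Kpar (μ κ : ℝ) (n : ℕ) : ℕ := ⌈(κ * n) ^ (1 / (3 * (1 - μ)))⌉₊

/-- `|B| = ⌈K^{2-3μ}⌉`. -/
def Bpar (μ : ℝ) (K : ℕ) : ℕ := ⌈(K : ℝ) ^ (2 - 3 * μ)⌉₊

/-- `β = (√L̃ L / ν) K^{μ-1}`. -/
def betaPar (r : ℕ) (ρ L L₁ L₂ μ : ℝ) (K : ℕ) : ℝ :=
  √(Ltil r L₁ L₂) * L / nu ρ * (K : ℝ) ^ (μ - 1)

/-- `τ = (c ν / (√L̃ L)) K^{-μ}`. -/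
def tauPar (r : ℕ) (ρ L L₁ L₂ μ c : ℝ) (K : ℕ) : ℝ :=
  c * nu ρ / (√(Ltil r L₁ L₂) * L) * (K : ℝ) ^ (-μ)

/-- `Γ(z, i) = ((1 + z)^{i-1} - 1) / z`, used for `z > 0` and `i ≥ 1`. -/
def Gam (z : ℝ) (i : ℕ) : ℝ := ((1 + z) ^ (i - 1) - 1) / z

/-- The weights `Δ_k`, `0 ≤ k < K`, for constants `ν, L̂, L̃, L`, free parameter `β`, step size
`τ` and mini-batch size `b`. -/
def Delta (ν Lh Lt L β τ : ℝ) (b K k : ℕ) : ℝ :=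
  τ * (ν - Lh * τ / 2 * (1 + (1 + 2 / (Lt * β * τ)) * (Lt * L ^ 2 * τ ^ 2 / (ν ^ 2 * b)) *
    Gam (2 * β * τ + Lt * L ^ 2 * τ ^ 2 / (ν ^ 2 * b)) (K - k)))

/-- `Δ_k` for the above choice of `K`, `|B|`, `β` and `τ`. -/
def DeltaPar (r : ℕ) (ρ L L₁ L₂ C μ κ c : ℝ) (n k : ℕ) : ℝ :=
  Delta (nu ρ) (Lhat L L₁ L₂ C) (Ltil r L₁ L₂) L
    (betaPar r ρ L L₁ L₂ μ (Kpar μ κ n)) (tauPar r ρ L L₁ L₂ μ c (Kpar μ κ n))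
    (Bpar μ (Kpar μ κ n)) (Kpar μ κ n) k

/-- The law on `{0, …, K}` with `p_k = Δ_k / ∑_{j<K} Δ_j` for `k < K` and `p_K = 0`, where all
`Δ_k` are positive. -/
def IsSelectionLaw {K : ℕ} (Δ : ℕ → ℝ) (p : PMF (Fin (K + 1))) : Prop :=
  (∀ k < K, 0 < Δ k) ∧
    (∀ k : Fin K, p k.castSucc = ENNReal.ofReal (Δ k / ∑ j ∈ Finset.range K, Δ j)) ∧
    p (Fin.last K) = 0

/-- The input of S-SVRG with the above choice of parameters. -/
def inputPar {d r n : ℕ} (f : Fin n → Mat d r → ℝ) (R : Mat d r → Mat d r → Mat d r)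
    (ρ L L₁ L₂ μ κ c : ℝ) (p : PMF (Fin (Kpar μ κ n + 1))) : Input d r n where
  f := f
  R := R
  ρ := ρ
  K := Kpar μ κ n
  b := Bpar μ (Kpar μ κ n)
  τ := fun _ => tauPar r ρ L L₁ L₂ μ c (Kpar μ κ n)
  p := fun _ => p

/-! ### `D_ρ(X, Y)` is the tangent vector that represents `⟨Y, ·⟩` in the metric -/

theorem Dop_mem {d r : ℕ} {ρ : ℝ} {X : Mat d r} (hX : X ∈ St d r) (Y : Mat d r) :
    Dop ρ X Y ∈ Tan ρ X := by
  have hX' : Xᵀ * X = 1 := hX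
  have h1 : Xᵀ * Dop ρ X Y = (2 * ρ) • (Xᵀ * Y - Yᵀ * X) := by
    have h2 : Xᵀ * (((1 : Mat d d) - X * Xᵀ) * Y) = 0 := by
      rw [← Matrix.mul_assoc, Matrix.mul_sub, ← Matrix.mul_assoc, hX']
      simp
    rw [Dop, Matrix.mul_add, h2, Matrix.mul_smul, ← Matrix.mul_assoc, hX', Matrix.one_mul,
      smul_smul, zero_add]
    congr 1
    ring
  unfold Tan
  split_ifs with h
  · show Xᵀ * Dop ρ X Y = 0
    rw [h1, h]; simp
  · show Xᵀ * Dop ρ X Y + (Dop ρ X Y)ᵀ * X = 0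
    have h3 : (Dop ρ X Y)ᵀ * X = (Xᵀ * Dop ρ X Y)ᵀ := by simp
    rw [h3, h1]
    simp [Matrix.transpose_smul, Matrix.transpose_sub, Matrix.transpose_mul, ← smul_add]

theorem Dop_spec {d r : ℕ} {ρ : ℝ} {X : Mat d r} (hX : X ∈ St d r) (Y : Mat d r)
    {E : Mat d r} (hE : E ∈ Tan ρ X) : metric ρ X (Dop ρ X Y) E = inn Y E := by
  have hX' : Xᵀ * X = 1 := hX
  unfold Tan at hE
  unfold metric
  split_ifs with h
  · rw [if_pos h] at hE
    have hE' : Xᵀ * E = 0 := hE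
    simp [inn, Dop, h, Matrix.transpose_mul, Matrix.mul_sub, Matrix.sub_mul, Matrix.mul_assoc, hE']
  · rw [if_neg h] at hE
    have hE' : Xᵀ * E = -(Eᵀ * X) := eq_neg_of_add_eq_zero_left hE
    have hD : (Dop ρ X Y)ᵀ * X = (-(2 * ρ)) • (Xᵀ * Y - Yᵀ * X) := by
      have h2 : (((1 : Mat d d) - X * Xᵀ) * Y)ᵀ * X = 0 := by
        simp [Matrix.transpose_mul, Matrix.mul_assoc, Matrix.sub_mul, hX']
      rw [Dop, Matrix.transpose_add, Matrix.add_mul, h2, zero_add]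
      simp only [Matrix.transpose_smul, Matrix.transpose_mul, Matrix.transpose_sub,
        Matrix.transpose_transpose, Matrix.smul_mul, Matrix.mul_assoc, hX', Matrix.mul_one,
        smul_smul]
      rw [← neg_sub (Xᵀ * Y) (Yᵀ * X), smul_neg, ← neg_smul]
      congr 1
      ring
    have hDE : (Dop ρ X Y)ᵀ * E = Yᵀ * E - Yᵀ * X * (Xᵀ * E)
        + (-(2 * ρ)) • ((Xᵀ * Y - Yᵀ * X) * (Xᵀ * E)) := by
      rw [Dop]
      simp only [Matrix.transpose_add, Matrix.transpose_smul, Matrix.transpose_mul,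
        Matrix.transpose_sub, Matrix.transpose_transpose, Matrix.transpose_one,
        Matrix.add_mul, Matrix.smul_mul, Matrix.sub_mul, Matrix.mul_one,
        Matrix.mul_assoc, smul_smul]
      module
    have htr : (Xᵀ * Y * (Xᵀ * E)).trace = -(Yᵀ * X * (Xᵀ * E)).trace := by
      rw [← Matrix.trace_transpose (Xᵀ * Y * (Xᵀ * E))]
      have : (Xᵀ * Y * (Xᵀ * E))ᵀ = (Eᵀ * X) * (Yᵀ * X) := by
        simp [Matrix.transpose_mul, Matrix.mul_assoc]
      rw [this, Matrix.trace_mul_comm, hE', Matrix.mul_neg, Matrix.trace_neg, neg_neg]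
    have : (Dop ρ X Y)ᵀ * (((1 : Mat d d) - (1 - 1 / (4 * ρ)) • (X * Xᵀ)) * E)
        = (Dop ρ X Y)ᵀ * E - (1 - 1 / (4 * ρ)) • ((Dop ρ X Y)ᵀ * X * (Xᵀ * E)) := by
      simp [Matrix.mul_sub, Matrix.sub_mul, Matrix.mul_assoc]
    unfold inn
    rw [this, hDE, hD]
    simp only [Matrix.trace_sub, Matrix.trace_add, Matrix.trace_smul, Matrix.smul_mul,
      Matrix.sub_mul, smul_eq_mul, htr]
    field_simp
    ring

end

end SSVRG

/-! The method decreases a Lyapunov function. In an epoch started at `X₀` consider `V_k = f - m +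
λ_k ‖X - X₀‖²`, with `m` a lower bound of `f`. The stochastic direction is unbiased, and its
variance is at most `L² ‖X - X₀‖² / (ν² |B|)`. Hence the mean of `V_{k+1}` after a step is at most
`V_k` minus a multiple of `‖grad f‖²`, provided that `λ` solves the backward recursion `λ_k = (1 +
2βτ + q) λ_{k+1} + ω`, `λ_K = 0`; the solution is a multiple of `Γ(2βτ + q, K + 1 - k)`. The
parameters give `K (2βτ + q) ≤ c² + 2c`, so the weights grow at most by `exp (c² + 2c)`, and the
condition on `c` leaves a gain of `stepGain` per step (`sum_innerStep_le`, `Admissible.stepGain_le`,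
`isPotential_inputPar`).

Since `λ_K = 0` and `X = X₀` at the start, `V_0` and `V_K` both reduce to `f - m` there, and the
epochs telescope. All `Δ_k` lie between `τν/4` and `τν`, so `p_k ≤ 4/K`: the selected point costs
only a factor 4 against the uniform average. This bounds the mean of `‖grad f(X_r)‖²` by a constant
over `S K^{1-μ}` (`Admissible.expect_run_inputPar_le`). The counts follow from `K^{1-μ} ≥ (κ
n)^{1/3}` and from `n + 2 K |B| = O(n)`.

The delicate point is the descent inequality. The gradient is controlled on the Stiefel manifold
only, so it cannot be integrated along a segment. If `X + Y` is injective, `Y` is a Cayley transform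
of `X` by a skew matrix, and rotating through the half-angles whose sines are `s` times the final
ones gives a curve at distance exactly `s ‖Y - X‖` from `X` with speed at most `‖Y - X‖ / √(1 -
s²)`. Integration yields the quadratic bound with constant `L` (`le_quadratic_of_injective`). Such
`Y` are dense in the component of `X` (`exists_near_injective`), and a retraction does not leave
this component. The constant is `L` and not `L/2`, so the analysis runs with `L₂ C + L₁² L`, which
exceeds `L̂/2` but not `L̂`; the slack in the condition on `c` absorbs this. -/

namespace SSVRG

/-! ### The Frobenius inner product -/

theorem inn_eq_sum {d r : ℕ} (A B : Mat d r) : inn A B = ∑ i, ∑ j, A i j * B i j := by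
  rw [inn, Matrix.trace, Finset.sum_comm]
  simp [Matrix.mul_apply]

theorem inn_self {d r : ℕ} (A : Mat d r) : inn A A = ‖A‖ ^ 2 := by
  rw [inn_eq_sum, Matrix.frobenius_norm_def, ← Real.sqrt_eq_rpow, Real.sq_sqrt (by positivity)]
  simp [sq]

theorem inn_comm {d r : ℕ} (A B : Mat d r) : inn A B = inn B A := by
  simp [inn_eq_sum, mul_comm]

theorem inn_add_right {d r : ℕ} (A B C : Mat d r) : inn A (B + C) = inn A B + inn A C := by
  simp [inn, Matrix.mul_add]

theorem inn_sub_right {d r : ℕ} (A B C : Mat d r) : inn A (B - C) = inn A B - inn A C := by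
  simp [inn, Matrix.mul_sub]

theorem inn_smul_right {d r : ℕ} (A B : Mat d r) (t : ℝ) : inn A (t • B) = t * inn A B := by
  simp [inn]

theorem inn_neg_right {d r : ℕ} (A B : Mat d r) : inn A (-B) = -inn A B := by
  simp [inn]

theorem inn_add_left {d r : ℕ} (A B C : Mat d r) : inn (A + B) C = inn A C + inn B C := by
  simp [inn, Matrix.add_mul]

theorem inn_sub_left {d r : ℕ} (A B C : Mat d r) : inn (A - B) C = inn A C - inn B C := by
  simp [inn, Matrix.sub_mul]

theorem inn_smul_left {d r : ℕ} (A B : Mat d r) (t : ℝ) : inn (t • A) B = t * inn A B := by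
  simp [inn]

theorem inn_sum_right {d r : ℕ} {ι : Type*} (s : Finset ι) (A : Mat d r) (B : ι → Mat d r) :
    inn A (∑ i ∈ s, B i) = ∑ i ∈ s, inn A (B i) := by
  simp [inn, Matrix.mul_sum, Matrix.trace_sum]

theorem norm_add_sq_mat {d r : ℕ} (A B : Mat d r) :
    ‖A + B‖ ^ 2 = ‖A‖ ^ 2 + 2 * inn A B + ‖B‖ ^ 2 := by
  rw [← inn_self, ← inn_self, ← inn_self, inn_add_right, inn_add_left, inn_add_left, inn_comm B A]
  ring

theorem inn_le_norm {d r : ℕ} (A B : Mat d r) : inn A B ≤ ‖A‖ * ‖B‖ := by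
  refine le_of_sq_le_sq ?_ (by positivity)
  rw [mul_pow, ← inn_self, ← inn_self]
  simp only [inn_eq_sum, ← Fintype.sum_prod_type', ← sq]
  exact Finset.sum_mul_sq_le_sq_mul_sq _ _ _

theorem abs_inn_le_norm {d r : ℕ} (A B : Mat d r) : |inn A B| ≤ ‖A‖ * ‖B‖ := by
  refine abs_le.2 ⟨?_, inn_le_norm A B⟩
  have := inn_le_norm A (-B)
  rw [inn_neg_right, norm_neg] at this
  linarith

/-- If the columns of `M` are orthogonal, the rows of `Z` contribute independently. Displacement and
speed of a curve of such products can then be compared one eigenvalue at a time. -/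
theorem norm_sq_mul_of_diagonal {d m r : ℕ} (M : Mat m d) (Z : Mat d r) (e : Fin d → ℝ)
    (h : Mᵀ * M = Matrix.diagonal e) : ‖M * Z‖ ^ 2 = ∑ i, e i * ∑ j, Z i j ^ 2 := by
  rw [← inn_self, inn, Matrix.transpose_mul, Matrix.mul_assoc, ← Matrix.mul_assoc Mᵀ, h]
  change inn Z _ = _
  rw [inn_eq_sum]
  simp only [Matrix.diagonal_mul, Finset.mul_sum]
  exact Finset.sum_congr rfl fun i _ => Finset.sum_congr rfl fun j _ => by ring

theorem norm_mul_of_orthonormal {d m r : ℕ} {M : Mat m d} (h : Mᵀ * M = 1) (Z : Mat d r) :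
    ‖M * Z‖ = ‖Z‖ := by
  have h1 := norm_sq_mul_of_diagonal M Z (fun _ => 1) (by rw [h, Matrix.diagonal_one])
  have h2 := norm_sq_mul_of_diagonal (1 : Mat d d) Z (fun _ => 1) (by simp)
  rw [Matrix.one_mul] at h2
  exact (pow_left_inj₀ (norm_nonneg _) (norm_nonneg _) two_ne_zero).1 (h1.trans h2.symm)

/-! ### The Stiefel manifold -/

theorem norm_sq_of_mem_St {d r : ℕ} {X : Mat d r} (hX : X ∈ St d r) : ‖X‖ ^ 2 = r := by
  rw [← inn_self, inn, show Xᵀ * X = 1 from hX]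
  simp

theorem norm_of_mem_St {d r : ℕ} {X : Mat d r} (hX : X ∈ St d r) : ‖X‖ = √(r : ℝ) := by
  rw [← norm_sq_of_mem_St hX, Real.sqrt_sq (norm_nonneg _)]

theorem norm_sub_le_of_mem_St {d r : ℕ} {X Y : Mat d r} (hX : X ∈ St d r) (hY : Y ∈ St d r) :
    ‖X - Y‖ ≤ 2 * √(r : ℝ) := by
  refine (norm_sub_le _ _).trans ?_
  rw [norm_of_mem_St hX, norm_of_mem_St hY, two_mul]

theorem isCompact_St (d r : ℕ) : IsCompact (St d r) := by
  refine Metric.isCompact_of_isClosed_isBounded ?_ ?_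
  · exact isClosed_eq (by fun_prop) continuous_const
  · refine (Metric.isBounded_closedBall (x := (0 : Mat d r)) (r := √(r : ℝ))).subset fun X hX => ?_
    rw [mem_closedBall_zero_iff, norm_of_mem_St hX]

/-! ### Tangent spaces, the metric and the operator `D_ρ` -/

theorem smul_mem_Tan {d r : ℕ} {ρ : ℝ} {X E : Mat d r} (hE : E ∈ Tan ρ X) (t : ℝ) :
    t • E ∈ Tan ρ X := by
  unfold Tan at *
  split_ifs with h
  · rw [if_pos h] at hE
    have hE' : Xᵀ * E = 0 := hE
    simp [hE']
  · rw [if_neg h] at hE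
    have hE' : Xᵀ * E + Eᵀ * X = 0 := hE
    show Xᵀ * (t • E) + (t • E)ᵀ * X = 0
    rw [Matrix.transpose_smul, Matrix.mul_smul, Matrix.smul_mul, ← smul_add, hE', smul_zero]

theorem zero_mem_Tan {d r : ℕ} {ρ : ℝ} {X : Mat d r} : (0 : Mat d r) ∈ Tan ρ X := by
  unfold Tan
  split_ifs <;> simp

theorem nu_pos {ρ : ℝ} (hρ : 0 ≤ ρ) : 0 < nu ρ := by
  unfold nu
  split_ifs with h
  · exact one_pos
  · have : 0 < ρ := lt_of_le_of_ne hρ (Ne.symm h)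
    exact lt_min one_pos (by positivity)

/-- Expand `0 ≤ ‖E - X Xᵀ E‖²`. -/
theorem inn_transpose_mul_le {d r : ℕ} {X : Mat d r} (hX : X ∈ St d r) (E : Mat d r) :
    ‖Xᵀ * E‖ ^ 2 ≤ ‖E‖ ^ 2 := by
  have hX' : Xᵀ * X = 1 := hX
  have h0 : (0 : ℝ) ≤ ‖E + (-(X * (Xᵀ * E)))‖ ^ 2 := by positivity
  rw [norm_add_sq_mat, norm_neg, norm_mul_of_orthonormal hX', inn_neg_right] at h0
  have h1 : inn E (X * (Xᵀ * E)) = ‖Xᵀ * E‖ ^ 2 := by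
    rw [← inn_self, inn, inn, Matrix.transpose_mul, Matrix.transpose_transpose, Matrix.mul_assoc]
  rw [h1] at h0
  linarith

theorem nu_mul_norm_sq_le_metric {d r : ℕ} {ρ : ℝ} (hρ : 0 ≤ ρ) {X : Mat d r} (hX : X ∈ St d r)
    (E : Mat d r) : nu ρ * ‖E‖ ^ 2 ≤ metric ρ X E E := by
  unfold nu metric
  split_ifs with h
  · rw [inn_self, one_mul]
  · have hp : 0 < ρ := lt_of_le_of_ne hρ (Ne.symm h)
    have h1 : inn E (((1 : Mat d d) - (1 - 1 / (4 * ρ)) • (X * Xᵀ)) * E)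
        = ‖E‖ ^ 2 - (1 - 1 / (4 * ρ)) * ‖Xᵀ * E‖ ^ 2 := by
      rw [← inn_self, ← inn_self, Matrix.sub_mul, Matrix.one_mul, inn_sub_right, Matrix.smul_mul,
        inn_smul_right]
      simp [inn, Matrix.transpose_mul, Matrix.mul_assoc]
    rw [h1]
    have h2 := inn_transpose_mul_le hX E
    have h3 : (0 : ℝ) ≤ ‖Xᵀ * E‖ ^ 2 := by positivity
    have h4 : (0 : ℝ) ≤ ‖E‖ ^ 2 := by positivity
    -- For `1/(4ρ) ≥ 1` the term in `‖Xᵀ E‖²` only helps; otherwise its coefficient is negative and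
    -- `‖Xᵀ E‖ ≤ ‖E‖` applies.
    rcases le_total 1 (1 / (4 * ρ)) with h5 | h5
    · rw [min_eq_left h5]; nlinarith
    · rw [min_eq_right h5]; nlinarith

/-- Test the representation `Dop_spec` with the tangent vector `Dop ρ X Y` itself. -/
theorem nu_mul_norm_Dop_sq_le {d r : ℕ} {ρ : ℝ} (hρ : 0 ≤ ρ) {X : Mat d r} (hX : X ∈ St d r)
    (Y : Mat d r) : nu ρ * ‖Dop ρ X Y‖ ^ 2 ≤ inn Y (Dop ρ X Y) := by
  rw [← Dop_spec hX Y (Dop_mem hX Y)]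
  exact nu_mul_norm_sq_le_metric hρ hX _

theorem norm_Dop_le {d r : ℕ} {ρ : ℝ} (hρ : 0 ≤ ρ) {X : Mat d r} (hX : X ∈ St d r)
    (Y : Mat d r) : nu ρ * ‖Dop ρ X Y‖ ≤ ‖Y‖ := by
  have h1 := (nu_mul_norm_Dop_sq_le hρ hX Y).trans (inn_le_norm _ _)
  rcases (norm_nonneg (Dop ρ X Y)).eq_or_lt with h | h
  · rw [← h, mul_zero]; exact norm_nonneg _
  · refine le_of_mul_le_mul_right ?_ h
    linarith

theorem Dop_add {d r : ℕ} (ρ : ℝ) (X Y Z : Mat d r) : Dop ρ X (Y + Z) = Dop ρ X Y + Dop ρ X Z := by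
  simp only [Dop, Matrix.mul_add, Matrix.transpose_add, Matrix.add_mul, Matrix.mul_smul,
    Matrix.mul_sub]
  module

theorem Dop_smul {d r : ℕ} (ρ : ℝ) (X Y : Mat d r) (t : ℝ) : Dop ρ X (t • Y) = t • Dop ρ X Y := by
  simp only [Dop, Matrix.mul_smul, Matrix.transpose_smul, Matrix.smul_mul, Matrix.mul_sub]
  module

theorem Dop_sum {d r : ℕ} {ι : Type*} (ρ : ℝ) (X : Mat d r) (s : Finset ι) (Y : ι → Mat d r) :
    Dop ρ X (∑ i ∈ s, Y i) = ∑ i ∈ s, Dop ρ X (Y i) := by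
  classical
  induction s using Finset.induction_on with
  | empty => simp [Dop]
  | insert i s hi ih => rw [Finset.sum_insert hi, Finset.sum_insert hi, Dop_add, ih]

/-! ### Gradients -/

theorem fderiv_apply_eq_inn {d r : ℕ} (f : Mat d r → ℝ) (X Z : Mat d r) :
    fderiv ℝ f X Z = inn (euclGrad f X) Z := by
  rw [inn_eq_sum]
  conv_lhs => rw [Matrix.matrix_eq_sum_single Z]
  rw [map_sum]
  refine Finset.sum_congr rfl fun i _ => ?_
  rw [map_sum]
  refine Finset.sum_congr rfl fun j _ => ?_
  have : Matrix.single i j (Z i j) = Z i j • Matrix.single i j (1 : ℝ) := by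
    simp [Matrix.smul_single]
  rw [this, map_smul, euclGrad, Matrix.of_apply, smul_eq_mul, mul_comm]

theorem differentiableAt_avg {d r n : ℕ} {f : Fin n → Mat d r → ℝ} {X : Mat d r}
    (h : ∀ i, DifferentiableAt ℝ (f i) X) : DifferentiableAt ℝ (avg f) X := by
  unfold avg
  fun_prop

theorem euclGrad_avg {d r n : ℕ} {f : Fin n → Mat d r → ℝ} {X : Mat d r}
    (h : ∀ i, DifferentiableAt ℝ (f i) X) :
    euclGrad (avg f) X = (1 / (n : ℝ)) • ∑ i, euclGrad (f i) X := by
  have h1 : HasFDerivAt (avg f) ((1 / (n : ℝ)) • ∑ i, fderiv ℝ (f i) X) X := by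
    unfold avg
    exact (HasFDerivAt.fun_sum fun i _ => (h i).hasFDerivAt).const_mul _
  ext a b
  rw [euclGrad, Matrix.of_apply, h1.fderiv]
  simp [Matrix.sum_apply, euclGrad]

theorem norm_euclGrad_avg_sub_le {d r n : ℕ} {f : Fin n → Mat d r → ℝ} {L : ℝ} (hL : 0 ≤ L)
    (hf : LipschitzGradients f L) {X Y : Mat d r} (hX : X ∈ St d r) (hY : Y ∈ St d r) :
    ‖euclGrad (avg f) X - euclGrad (avg f) Y‖ ≤ L * ‖X - Y‖ := by
  rw [euclGrad_avg fun i => (hf i).1 X hX, euclGrad_avg fun i => (hf i).1 Y hY, ← smul_sub,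
    ← Finset.sum_sub_distrib, norm_smul, Real.norm_of_nonneg (by positivity)]
  have h1 : ‖∑ i, (euclGrad (f i) X - euclGrad (f i) Y)‖ ≤ n * (L * ‖X - Y‖) := by
    refine (norm_sum_le_of_le _ fun i _ => (hf i).2 X hX Y hY).trans ?_
    simp
  rcases Nat.eq_zero_or_pos n with rfl | hn
  · simp; positivity
  · have : (0 : ℝ) < n := by exact_mod_cast hn
    calc _ ≤ 1 / (n : ℝ) * (n * (L * ‖X - Y‖)) := by gcongr
      _ = _ := by field_simp

theorem LipschitzGradients.mono {d r n : ℕ} {f : Fin n → Mat d r → ℝ} {L L' : ℝ} (h : L ≤ L')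
    (hf : LipschitzGradients f L) : LipschitzGradients f L' := fun i =>
  ⟨(hf i).1, fun X hX Y hY => ((hf i).2 X hX Y hY).trans (by gcongr)⟩

theorem exists_gradient_bound {d r n : ℕ} {f : Fin n → Mat d r → ℝ} {L : ℝ}
    (hf : LipschitzGradients f L) : ∃ C : ℝ, 0 < C ∧ ∀ X ∈ St d r, ‖euclGrad (avg f) X‖ ≤ C := by
  rcases (St d r).eq_empty_or_nonempty with h | ⟨X₀, hX₀⟩
  · exact ⟨1, one_pos, by simp [h]⟩
  · refine ⟨‖euclGrad (avg f) X₀‖ + |L| * (2 * √(r : ℝ)) + 1, by positivity, fun X hX => ?_⟩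
    have h1 := norm_euclGrad_avg_sub_le (abs_nonneg L) (hf.mono (le_abs_self L)) hX hX₀
    have h2 := mul_le_mul_of_nonneg_left (norm_sub_le_of_mem_St hX hX₀) (abs_nonneg L)
    have h3 := norm_le_norm_add_norm_sub' (euclGrad (avg f) X) (euclGrad (avg f) X₀)
    linarith

/-! ### Constants of a retraction -/

/-- The tangent bundle is not a set of unique differentiability in the ambient space, so derivatives
within it are chosen by hand near a point instead of being taken from `fderivWithin`. Continuity of
the second one bounds it. -/
theorem exists_second_derivative_bound {V W : Type*} [NormedAddCommGroup V] [NormedSpace ℝ V]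
    [NormedAddCommGroup W] [NormedSpace ℝ W] {F : V → W} {s : Set V} {x : V} (hx : x ∈ s)
    (hF : ContDiffWithinAt ℝ 2 F s x) :
    ∃ (ε M : ℝ) (F' : V → V →L[ℝ] W) (F'' : V → V →L[ℝ] V →L[ℝ] W), 0 < ε ∧
      ∀ y ∈ s, dist y x < ε → HasFDerivWithinAt F (F' y) s y ∧
        HasFDerivWithinAt F' (F'' y) s y ∧ ‖F'' y‖ ≤ M := by
  have h2 : ContDiffWithinAt ℝ (1 + 1) F s x := by
    rw [show (1 + 1 : WithTop ℕ∞) = 2 from one_add_one_eq_two]; exact hF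
  obtain ⟨u, hu, -, -, F', hF', h1⟩ :=
    (contDiffWithinAt_succ_iff_hasFDerivWithinAt' (by simp)).1 h2
  have h1' : ContDiffWithinAt ℝ (0 + 1) F' s x := by rw [zero_add]; exact h1
  obtain ⟨u', hu', -, -, F'', hF'', h0⟩ :=
    (contDiffWithinAt_succ_iff_hasFDerivWithinAt' (by simp)).1 h1'
  rw [Set.insert_eq_of_mem hx] at hu hu'
  have hb : ∀ᶠ y in nhdsWithin x s, ‖F'' y‖ < ‖F'' x‖ + 1 :=
    h0.continuousWithinAt.norm.eventually_lt_const (lt_add_one _)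
  have hall := (Filter.inter_mem hu hu')
  obtain ⟨ε, hε, hsub⟩ := Metric.mem_nhdsWithin_iff.1 (Filter.inter_mem hall hb)
  refine ⟨ε, ‖F'' x‖ + 1, F', F'', hε, fun y hy hd => ?_⟩
  obtain ⟨⟨hy1, hy2⟩, hy3⟩ := hsub ⟨hd, hy⟩
  exact ⟨hF' y hy1, hF'' y hy2, le_of_lt hy3⟩

theorem IsRetraction.exists_local_bound {d r : ℕ} {ρ : ℝ} {R : Mat d r → Mat d r → Mat d r}
    (hR : IsRetraction ρ R) {X₀ : Mat d r} (hX₀ : X₀ ∈ St d r) :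
    ∃ ε M : ℝ, 0 < ε ∧ ∀ X ∈ St d r, dist X X₀ < ε → ∀ E ∈ Tan ρ X, ‖E‖ < ε →
      ‖R X E - X - E‖ ≤ M * ‖E‖ ^ 2 := by
  have hmem : ((X₀, 0) : Mat d r × Mat d r) ∈ TanBundle d r ρ := ⟨hX₀, zero_mem_Tan⟩
  obtain ⟨ε, M, F', F'', hε, h⟩ := exists_second_derivative_bound hmem
    ((hR.smooth _ hmem).of_le (WithTop.coe_le_coe.2 le_top))
  refine ⟨ε, M, hε, fun X hX hXd E hE hEε => ?_⟩
  -- The ray stays in the bundle, so derivatives within the bundle may be composed with it.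
  set c : ℝ → Mat d r × Mat d r := fun t => (X, t • E) with hc
  have hcs : ∀ t : ℝ, c t ∈ TanBundle d r ρ := fun t => ⟨hX, smul_mem_Tan hE t⟩
  have hcd : ∀ t ∈ Set.Icc (0 : ℝ) 1, dist (c t) (X₀, 0) < ε := by
    intro t ht
    rw [Prod.dist_eq, max_lt_iff]
    refine ⟨hXd, ?_⟩
    rw [dist_zero_right, norm_smul, Real.norm_of_nonneg ht.1]
    exact (mul_le_of_le_one_left (norm_nonneg _) ht.2).trans_lt hEε
  have hc' : ∀ t : ℝ, HasDerivAt c (0, E) t := fun t => by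
    refine (hasDerivAt_const t X).prodMk ?_
    simpa using (hasDerivAt_id t).smul_const E
  set v : Mat d r × Mat d r := (0, E) with hv
  have hvn : ‖v‖ = ‖E‖ := by simp [hv, Prod.norm_def]
  have hφ : ∀ t ∈ Set.Icc (0 : ℝ) 1,
      HasDerivWithinAt (fun t => R X (t • E)) (F' (c t) v) (Set.Icc 0 1) t := fun t ht =>
    (h _ (hcs t) (hcd t ht)).1.comp_hasDerivWithinAt t (hc' t).hasDerivWithinAt (fun s _ => hcs s)
  have hψ : ∀ t ∈ Set.Icc (0 : ℝ) 1,
      HasDerivWithinAt (fun t => F' (c t) v) (F'' (c t) v v) (Set.Icc 0 1) t := fun t ht => by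
    have h3 := (h _ (hcs t) (hcd t ht)).2.1.comp_hasDerivWithinAt t (hc' t).hasDerivWithinAt
      (fun s (_ : s ∈ Set.Icc (0 : ℝ) 1) => hcs s)
    have h4 := h3.clm_apply (hasDerivWithinAt_const t _ v)
    rw [map_zero, add_zero] at h4
    exact h4
  have hM : ∀ t ∈ Set.Icc (0 : ℝ) 1, ‖F'' (c t) v v‖ ≤ M * ‖E‖ ^ 2 := fun t ht => by
    refine ((F'' (c t)).le_opNorm₂ v v).trans ?_
    rw [hvn, mul_assoc, ← sq]
    gcongr
    exact (h _ (hcs t) (hcd t ht)).2.2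
  -- The sign of `M` is not known, only that of this product.
  have hM0 : 0 ≤ M * ‖E‖ ^ 2 := (norm_nonneg _).trans (hM 0 (by simp))
  -- `F'` is not unique, but its value along the ray is: a function on `[0, 1]` has one derivative
  -- at `0`.
  have h0 : F' (c 0) v = E := by
    have h4 := hφ 0 (by simp)
    exact (uniqueDiffOn_Icc_zero_one 0 (by simp)).eq_deriv _ h4 (hR.deriv X hX E hE).hasDerivWithinAt
  have hψb : ∀ t ∈ Set.Icc (0 : ℝ) 1, ‖F' (c t) v - E‖ ≤ M * ‖E‖ ^ 2 := fun t ht => by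
    have h5 := norm_image_sub_le_of_norm_deriv_le_segment' hψ
      (fun s hs => hM s ⟨hs.1, hs.2.le⟩) t ht
    rw [h0, sub_zero] at h5
    exact h5.trans (mul_le_of_le_one_right hM0 ht.2)
  have h6 := norm_image_sub_le_of_norm_deriv_le_segment_01' (f := fun t => R X (t • E) - t • E)
    (f' := fun t => F' (c t) v - E) (C := M * ‖E‖ ^ 2)
    (fun t ht => (hφ t ht).sub (by simpa using ((hasDerivAt_id t).smul_const E).hasDerivWithinAt))
    (fun t ht => hψb t ⟨ht.1, ht.2.le⟩)
  simp only [one_smul, zero_smul, sub_zero, hR.zero X hX] at h6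
  rwa [sub_right_comm]

/-- The property passes to subsets and finite unions, so compactness of the Stiefel manifold makes
the local bounds uniform. -/
theorem IsRetraction.exists_uniform_bound {d r : ℕ} {ρ : ℝ} {R : Mat d r → Mat d r → Mat d r}
    (hR : IsRetraction ρ R) :
    ∃ δ M : ℝ, 0 < δ ∧ 0 ≤ M ∧ ∀ X ∈ St d r, ∀ E ∈ Tan ρ X, ‖E‖ < δ →
      ‖R X E - X - E‖ ≤ M * ‖E‖ ^ 2 := by
  refine (isCompact_St d r).induction_on (p := fun s => ∃ δ M : ℝ, 0 < δ ∧ 0 ≤ M ∧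
    ∀ X ∈ s, ∀ E ∈ Tan ρ X, ‖E‖ < δ → ‖R X E - X - E‖ ≤ M * ‖E‖ ^ 2) ?_ ?_ ?_ ?_
  · exact ⟨1, 0, one_pos, le_rfl, by simp⟩
  · rintro s t hst ⟨δ, M, hδ, hM, h⟩
    exact ⟨δ, M, hδ, hM, fun X hX => h X (hst hX)⟩
  · rintro s t ⟨δ, M, hδ, hM, h⟩ ⟨δ', M', hδ', hM', h'⟩
    refine ⟨min δ δ', max M M', lt_min hδ hδ', le_max_of_le_left hM, ?_⟩
    rintro X (hX | hX) E hE hEδ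
    · exact (h X hX E hE (hEδ.trans_le (min_le_left _ _))).trans (by gcongr; exact le_max_left _ _)
    · exact (h' X hX E hE (hEδ.trans_le (min_le_right _ _))).trans
        (by gcongr; exact le_max_right _ _)
  · intro X₀ hX₀
    obtain ⟨ε, M, hε, h⟩ := hR.exists_local_bound hX₀
    refine ⟨Metric.ball X₀ ε ∩ St d r, Filter.inter_mem
      (mem_nhdsWithin_of_mem_nhds (Metric.ball_mem_nhds X₀ hε)) self_mem_nhdsWithin,
      ε, max M 0, hε, le_max_right _ _, ?_⟩
    rintro X ⟨hXb, hX⟩ E hE hEε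
    exact (h X hX hXb E hE hEε).trans (by gcongr; exact le_max_left _ _)

/-- Short tangent vectors are covered by the uniform expansion. For `‖E‖ ≥ δ` the bounds are crude:
two points of the manifold are at distance at most `2 √r`, which is at most a constant times `‖E‖`
or `‖E‖²`. -/
theorem IsRetraction.exists_constants {d r : ℕ} {ρ : ℝ} {R : Mat d r → Mat d r → Mat d r}
    (hR : IsRetraction ρ R) : ∃ L₁ L₂ : ℝ, RetractionConstants ρ R L₁ L₂ := by
  obtain ⟨δ, M, hδ, hM, h⟩ := hR.exists_uniform_bound
  set D := 2 * √(r : ℝ) with hD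
  have hD0 : 0 ≤ D := by positivity
  have key1 : ∀ X ∈ St d r, ∀ E ∈ Tan ρ X, ‖R X E - X‖ ≤ (1 + M * δ + D / δ) * ‖E‖ := by
    intro X hX E hE
    have hn := norm_nonneg E
    rcases lt_or_ge ‖E‖ δ with hlt | hge
    · have h1 := h X hX E hE hlt
      have h2 : ‖R X E - X‖ ≤ ‖R X E - X - E‖ + ‖E‖ := by
        simpa using norm_add_le (R X E - X - E) E
      have h3 : M * ‖E‖ ^ 2 ≤ M * δ * ‖E‖ := by
        rw [sq, ← mul_assoc]; gcongr
      have h4 : 0 ≤ D / δ * ‖E‖ := by positivity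
      linarith
    · have h1 := norm_sub_le_of_mem_St (hR.mem X hX E hE) hX
      have h3 : D ≤ D / δ * ‖E‖ := by
        rw [div_mul_eq_mul_div, le_div_iff₀ hδ]; gcongr
      have h4 : 0 ≤ (1 + M * δ) * ‖E‖ := by positivity
      linarith
  have key2 : ∀ X ∈ St d r, ∀ E ∈ Tan ρ X,
      ‖R X E - X - E‖ ≤ (1 + M + D / δ ^ 2 + 1 / δ) * ‖E‖ ^ 2 := by
    intro X hX E hE
    have hn := norm_nonneg E
    rcases lt_or_ge ‖E‖ δ with hlt | hge
    · have h1 := h X hX E hE hlt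
      have h4 : 0 ≤ (1 + D / δ ^ 2 + 1 / δ) * ‖E‖ ^ 2 := by positivity
      linarith
    · have h1 := norm_sub_le_of_mem_St (hR.mem X hX E hE) hX
      have h2 := norm_sub_le (R X E - X) E
      have h3 : D ≤ D / δ ^ 2 * ‖E‖ ^ 2 := by
        rw [div_mul_eq_mul_div, le_div_iff₀ (by positivity)]; gcongr
      have h5 : ‖E‖ ≤ 1 / δ * ‖E‖ ^ 2 := by
        rw [div_mul_eq_mul_div, le_div_iff₀ (by positivity), one_mul, sq]; gcongr
      have h4 : 0 ≤ (1 + M) * ‖E‖ ^ 2 := by positivity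
      linarith
  refine ⟨1 + M * δ + D / δ, 1 + M + D / δ ^ 2 + 1 / δ, ?_, by positivity, ?_, ?_⟩
  · have : 0 ≤ M * δ + D / δ := by positivity
    linarith
  · intro X hX E hE t ht
    have := key1 X hX _ (smul_mem_Tan hE t)
    rwa [norm_smul, Real.norm_of_nonneg ht, ← mul_assoc] at this
  · intro X hX E hE t ht
    have := key2 X hX _ (smul_mem_Tan hE t)
    rwa [norm_smul, Real.norm_of_nonneg ht, mul_pow, ← mul_assoc] at this

/-! ### Curves on the Stiefel manifold -/

/-- `⟨D, B D⟩ = 0` for skew `B`; thus `1 - B` is injective. -/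
theorem eq_zero_of_skew_mul {d r : ℕ} {B : Mat d d} (hB : Bᵀ = -B) {D : Mat d r}
    (h : B * D = D) : D = 0 := by
  have h1 : inn D (B * D) = -inn D (B * D) := by
    conv_lhs => rw [inn_comm, inn, Matrix.transpose_mul, hB, Matrix.mul_assoc]
    simp [inn]
  rw [h, inn_self] at h1
  have : ‖D‖ ^ 2 = 0 := by linarith
  simpa using this

theorem exists_orthogonal_diagonalization {d : ℕ} (A : Mat d d) (hA : Aᵀ = A) :
    ∃ (V : Mat d d) (t : Fin d → ℝ), Vᵀ * V = 1 ∧ V * Vᵀ = 1 ∧ Vᵀ * A * V = Matrix.diagonal t := by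
  have hH : A.IsHermitian := by
    rw [Matrix.IsHermitian, Matrix.conjTranspose_eq_transpose_of_trivial, hA]
  set V : Mat d d := (hH.eigenvectorUnitary : Matrix (Fin d) (Fin d) ℝ) with hV
  have h1 : Vᵀ * V = 1 := by
    have := Unitary.coe_star_mul_self hH.eigenvectorUnitary
    rwa [Matrix.star_eq_conjTranspose, Matrix.conjTranspose_eq_transpose_of_trivial] at this
  refine ⟨V, hH.eigenvalues, h1, mul_eq_one_comm.1 h1, ?_⟩
  have h2 := hH.spectral_theorem
  rw [Unitary.conjStarAlgAut_apply] at h2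
  rw [Matrix.star_eq_conjTranspose,
    Matrix.conjTranspose_eq_transpose_of_trivial, ← hV] at h2
  have h3 : Matrix.diagonal (RCLike.ofReal ∘ hH.eigenvalues) = Matrix.diagonal hH.eigenvalues := rfl
  rw [h3] at h2
  calc Vᵀ * A * V = (Vᵀ * V) * Matrix.diagonal hH.eigenvalues * (Vᵀ * V) := by
        conv_lhs => rw [h2]
        simp only [Matrix.mul_assoc]
    _ = _ := by rw [h1, Matrix.one_mul, Matrix.mul_one]

/-- A skew matrix whose square is diagonal commutes with functions of its square. -/
theorem diagonal_mul_skew {d : ℕ} {B : Mat d d} (hB : Bᵀ = -B) {t : Fin d → ℝ}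
    (ht : Bᵀ * B = Matrix.diagonal t) (a : ℝ → ℝ) :
    Matrix.diagonal (a ∘ t) * B = B * Matrix.diagonal (a ∘ t) := by
  have h1 : Matrix.diagonal t * B = B * Matrix.diagonal t := by
    rw [← ht, hB]; simp [Matrix.mul_assoc]
  ext i j
  have h2 := congrFun (congrFun h1 i) j
  rw [Matrix.diagonal_mul, Matrix.mul_diagonal] at h2 ⊢
  by_cases h3 : B i j = 0
  · simp [h3]
  · have h4 : t i = t j := by
      rw [mul_comm] at h2
      exact mul_left_cancel₀ h3 h2
    simp [h4, mul_comm]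

/-- The two cross terms cancel because `B` is skew and commutes with functions of `Bᵀ B`, just as
`|a + i b|² = a² + b²`. -/
theorem transpose_mul_self_diagonal_add {d : ℕ} {B : Mat d d} (hB : Bᵀ = -B) {t : Fin d → ℝ}
    (ht : Bᵀ * B = Matrix.diagonal t) (a b : ℝ → ℝ) :
    (Matrix.diagonal (a ∘ t) + B * Matrix.diagonal (b ∘ t))ᵀ *
      (Matrix.diagonal (a ∘ t) + B * Matrix.diagonal (b ∘ t)) =
      Matrix.diagonal ((fun x => a x ^ 2 + b x ^ 2 * x) ∘ t) := by
  have hcomm : ∀ e : ℝ → ℝ, Matrix.diagonal (e ∘ t) * B = B * Matrix.diagonal (e ∘ t) :=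
    diagonal_mul_skew hB ht
  have h1 : Matrix.diagonal (a ∘ t) * (B * Matrix.diagonal (b ∘ t))
      = B * (Matrix.diagonal (a ∘ t) * Matrix.diagonal (b ∘ t)) := by
    rw [← Matrix.mul_assoc, hcomm, Matrix.mul_assoc]
  have h2 : Matrix.diagonal (b ∘ t) * Bᵀ * Matrix.diagonal (a ∘ t)
      = -(B * (Matrix.diagonal (a ∘ t) * Matrix.diagonal (b ∘ t))) := by
    rw [hB, Matrix.mul_neg, hcomm, Matrix.neg_mul, Matrix.mul_assoc, Matrix.diagonal_mul_diagonal,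
      Matrix.diagonal_mul_diagonal]
    simp only [mul_comm]
  have h3 : Matrix.diagonal (b ∘ t) * Bᵀ * (B * Matrix.diagonal (b ∘ t))
      = Matrix.diagonal (fun i => b (t i) ^ 2 * t i) := by
    rw [Matrix.mul_assoc, ← Matrix.mul_assoc Bᵀ, ht]
    simp only [Matrix.diagonal_mul_diagonal, Function.comp]
    congr 1; ext i; ring
  rw [Matrix.transpose_add, Matrix.transpose_mul, Matrix.diagonal_transpose,
    Matrix.diagonal_transpose, Matrix.add_mul, Matrix.mul_add, Matrix.mul_add, h1, h2, h3]
  simp only [Matrix.diagonal_mul_diagonal]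
  ext i j
  by_cases hij : i = j
  · subst hij; simp; ring
  · simp [Matrix.diagonal_apply_ne _ hij]

/-- `(a, b) ↦ V (diag a + B diag b) Z` as a linear map. -/
def diagonalPathMap {d r : ℕ} (V B : Mat d d) (Z : Mat d r) :
    ((Fin d → ℝ) × (Fin d → ℝ)) →ₗ[ℝ] Mat d r where
  toFun q := V * ((Matrix.diagonal q.1 + B * Matrix.diagonal q.2) * Z)
  map_add' p q := by
    have h : ∀ a b : Fin d → ℝ, Matrix.diagonal (a + b) = Matrix.diagonal a + Matrix.diagonal b :=
      fun a b => (Matrix.diagonal_add a b).symm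
    simp only [Prod.fst_add, Prod.snd_add, h, Matrix.mul_add, Matrix.add_mul]
    abel
  map_smul' c q := by
    simp only [Prod.smul_fst, Prod.smul_snd, Matrix.diagonal_smul, Matrix.mul_smul, ← smul_add,
      Matrix.smul_mul, RingHom.id_apply]

theorem hasDerivAt_diagonal_path {d r : ℕ} (V B : Mat d d) (Z : Mat d r)
    {a b : ℝ → Fin d → ℝ} {a' b' : Fin d → ℝ} {s : ℝ}
    (ha : ∀ i, HasDerivAt (fun s => a s i) (a' i) s) (hb : ∀ i, HasDerivAt (fun s => b s i) (b' i) s) :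
    HasDerivAt (fun s => V * ((Matrix.diagonal (a s) + B * Matrix.diagonal (b s)) * Z))
      (V * ((Matrix.diagonal a' + B * Matrix.diagonal b') * Z)) s := by
  have h1 : HasDerivAt (fun s => (a s, b s)) (a', b') s :=
    (hasDerivAt_pi.2 ha).prodMk (hasDerivAt_pi.2 hb)
  have h2 : HasFDerivAt (diagonalPathMap V B Z) (diagonalPathMap V B Z).toContinuousLinearMap
    (a s, b s) := (diagonalPathMap V B Z).toContinuousLinearMap.hasFDerivAt
  exact h2.comp_hasDerivAt s h1

theorem continuous_diagonal_path {d r : ℕ} (V B : Mat d d) (Z : Mat d r)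
    {a b : ℝ → Fin d → ℝ} (ha : Continuous a) (hb : Continuous b) :
    Continuous (fun s => V * ((Matrix.diagonal (a s) + B * Matrix.diagonal (b s)) * Z)) := by
  fun_prop

/-- If `Y = (1 - B)⁻¹ (1 + B) X` with `B` skew, then `X` and `Y` are joined by a curve on the Stiefel
manifold whose distance to `X` grows linearly and whose speed is controlled. -/
theorem exists_curve_of_skew {d r : ℕ} {X Y : Mat d r} (hX : X ∈ St d r) {B : Mat d d}
    (hB : Bᵀ = -B) (hBP : B * (X + Y) = Y - X) :
    ∃ η η' : ℝ → Mat d r, Continuous η ∧ η 0 = X ∧ η 1 = Y ∧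
      (∀ s ∈ Set.Icc (0 : ℝ) 1, η s ∈ St d r ∧ ‖η s - X‖ = s * ‖Y - X‖) ∧
      ∀ s ∈ Set.Ioo (0 : ℝ) 1, HasDerivAt η (η' s) s ∧ ‖η' s‖ ≤ ‖Y - X‖ / √(1 - s ^ 2) := by
  -- The real spectral theorem applies to `Bᵀ B`, not to `B`. In the new basis `B₁` need not be
  -- diagonal, but its square is, and that suffices.
  obtain ⟨V, t, hV, hV', hd⟩ := exists_orthogonal_diagonalization (Bᵀ * B) (by simp)
  set B₁ : Mat d d := Vᵀ * B * V with hB₁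
  have hskew : B₁ᵀ = -B₁ := by
    simp [hB₁, Matrix.transpose_mul, hB, Matrix.mul_assoc]
  have hsq : B₁ᵀ * B₁ = Matrix.diagonal t := by
    rw [← hd, hB₁]
    simp only [Matrix.transpose_mul, Matrix.transpose_transpose, Matrix.mul_assoc]
    rw [← Matrix.mul_assoc V Vᵀ, hV', Matrix.one_mul]
  have ht : ∀ i, 0 ≤ t i := fun i => by
    have h1 := congrFun (congrFun hsq i) i
    rw [Matrix.diagonal_apply_eq, Matrix.mul_apply] at h1
    rw [← h1]
    exact Finset.sum_nonneg fun j _ => by rw [Matrix.transpose_apply]; exact mul_self_nonneg _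
  set Z : Mat d r := Vᵀ * X with hZ
  -- With `t = tan² (θ/2)`, where `θ` is a rotation angle of the Cayley transform, `σ` and `w` are
  -- `sin² (θ/2)` and `cos² (θ/2)`.
  set σ : ℝ → ℝ := fun x => x / (1 + x) with hσ
  set w : ℝ → ℝ := fun x => 1 / (1 + x) with hw
  have hwx : ∀ x, w x * x = σ x := fun x => by simp only [hw, hσ]; ring
  have hσ0 : ∀ x, 0 ≤ x → 0 ≤ σ x := fun x hx => by simp only [hσ]; positivity
  have hw0 : ∀ x, 0 ≤ x → 0 < w x := fun x hx => by simp only [hw]; positivity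
  have hσw : ∀ x, 0 ≤ x → σ x = 1 - w x := fun x hx => by
    simp only [hσ, hw]; field_simp; ring
  have hσ1 : ∀ x, 0 ≤ x → σ x ≤ 1 := fun x hx => by rw [hσw x hx]; linarith [hw0 x hx]
  -- Let `φ` be the angle with `sin (φ/2) = s sin (θ/2)`. Then `a = cos φ` and `b √t = sin φ`. The
  -- chord `2 sin (φ/2)` is linear in `s`, and `(dφ/ds)² = 4σ / (1 - s² σ)`. `a'` and `b'` are the
  -- derivatives in `s`.
  set a : ℝ → ℝ → ℝ := fun s x => 1 - 2 * s ^ 2 * σ x with ha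
  set b : ℝ → ℝ → ℝ := fun s x => 2 * s * √(w x) * √(1 - s ^ 2 * σ x) with hb
  set a' : ℝ → ℝ → ℝ := fun s x => -(4 * s * σ x) with ha'
  set b' : ℝ → ℝ → ℝ := fun s x => 2 * √(w x) * ((1 - 2 * s ^ 2 * σ x) / √(1 - s ^ 2 * σ x)) with hb'
  set Q : (ℝ → ℝ) → (ℝ → ℝ) → Mat d d := fun p q =>
    Matrix.diagonal (p ∘ t) + B₁ * Matrix.diagonal (q ∘ t) with hQ
  have hQQ : ∀ (p q e : ℝ → ℝ), (∀ x, 0 ≤ x → p x ^ 2 + q x ^ 2 * x = e x) →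
      (Q p q)ᵀ * Q p q = Matrix.diagonal (e ∘ t) := fun p q e he => by
    rw [hQ, transpose_mul_self_diagonal_add hskew hsq]
    congr 1
    ext i
    exact he _ (ht i)
  have hpos : ∀ s ∈ Set.Icc (0 : ℝ) 1, ∀ x, 0 ≤ x → 0 ≤ 1 - s ^ 2 * σ x := fun s hs x hx => by
    have h1 : s ^ 2 ≤ 1 := pow_le_one₀ hs.1 hs.2
    have := mul_le_mul h1 (hσ1 x hx) (hσ0 x hx) zero_le_one
    linarith
  have hb2 : ∀ s ∈ Set.Icc (0 : ℝ) 1, ∀ x, 0 ≤ x →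
      b s x ^ 2 * x = 4 * s ^ 2 * σ x * (1 - s ^ 2 * σ x) := fun s hs x hx => by
    simp only [hb, mul_pow, Real.sq_sqrt (hpos s hs x hx), Real.sq_sqrt (hw0 x hx).le]
    rw [← hwx x]; ring
  have hpos' : ∀ s ∈ Set.Ioo (0 : ℝ) 1, ∀ x, 0 ≤ x → 1 - s ^ 2 ≤ 1 - s ^ 2 * σ x := fun s hs x hx =>
    sub_le_sub_left (mul_le_of_le_one_right (sq_nonneg s) (hσ1 x hx)) 1
  have hs1 : ∀ s ∈ Set.Ioo (0 : ℝ) 1, 0 < 1 - s ^ 2 := fun s hs =>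
    sub_pos.2 (pow_lt_one₀ hs.1.le hs.2 two_ne_zero)
  set η : ℝ → Mat d r := fun s => V * (Q (a s) (b s) * Z) with hη
  have hsub : ∀ s, η s - X = V * (Q (fun x => a s x - 1) (b s) * Z) := fun s => by
    have h1 : Q (fun x => a s x - 1) (b s) = Q (a s) (b s) - 1 := by
      simp only [hQ]
      rw [← Matrix.diagonal_one, add_sub_right_comm, Matrix.diagonal_sub]
      rfl
    rw [h1, Matrix.sub_mul, Matrix.one_mul, Matrix.mul_sub, hZ, ← Matrix.mul_assoc V Vᵀ, hV',
      Matrix.one_mul]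
  have hdist : ∀ s ∈ Set.Icc (0 : ℝ) 1,
      ‖η s - X‖ ^ 2 = s ^ 2 * ∑ i, 4 * σ (t i) * ∑ j, Z i j ^ 2 := fun s hs => by
    rw [hsub, norm_mul_of_orthonormal hV, norm_sq_mul_of_diagonal _ _ _
      (hQQ _ _ (fun x => s ^ 2 * (4 * σ x)) fun x hx => ?_), Finset.mul_sum]
    · exact Finset.sum_congr rfl fun i _ => by simp [mul_assoc]
    · rw [hb2 s hs x hx]; simp only [ha]; ring
  have hη1 : η 1 = Y := by
    -- At `s = 1` the curve reaches the Cayley transform `(1 - B₁)⁻¹ (1 + B₁)`; both `η 1` and `Y`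
    -- solve the same equation for `1 - B`, which is injective.
    have h1 : (1 - B₁) * Q (a 1) (b 1) = 1 + B₁ := by
      have hb1 : Matrix.diagonal (b 1 ∘ t) = Matrix.diagonal ((fun x => 2 * w x) ∘ t) := by
        congr 1
        ext i
        have h2 : 1 - (1 : ℝ) ^ 2 * σ (t i) = w (t i) := by rw [hσw _ (ht i)]; ring
        simp only [hb, Function.comp, h2]
        rw [mul_assoc, Real.mul_self_sqrt (hw0 _ (ht i)).le]; ring
      have ha1 : Matrix.diagonal (a 1 ∘ t) = Matrix.diagonal ((fun x => 2 * w x) ∘ t) - 1 := by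
        rw [← Matrix.diagonal_one, Matrix.diagonal_sub]
        congr 1
        ext i
        simp only [ha, Function.comp, hσw _ (ht i)]; ring
      have hBB : B₁ * (B₁ * Matrix.diagonal ((fun x => 2 * w x) ∘ t))
          = Matrix.diagonal ((fun x => 2 * w x) ∘ t) - 2 • 1 := by
        have h3 : B₁ * B₁ = -Matrix.diagonal t := by rw [← hsq, hskew]; simp
        rw [← Matrix.mul_assoc, h3, Matrix.neg_mul, Matrix.diagonal_mul_diagonal,
          ← Matrix.diagonal_one, ← Matrix.diagonal_smul, Matrix.diagonal_sub, Matrix.diagonal_neg]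
        congr 1
        ext i
        have h4 := hwx (t i)
        rw [hσw _ (ht i)] at h4
        simp only [Function.comp, Pi.smul_apply, nsmul_eq_mul]
        push_cast
        linarith
      simp only [hQ]
      rw [ha1, hb1, Matrix.sub_mul, Matrix.one_mul, Matrix.mul_add, hBB, Matrix.mul_sub,
        Matrix.mul_one]
      module
    have h2 : B * V = V * B₁ := by
      rw [hB₁, Matrix.mul_assoc Vᵀ, ← Matrix.mul_assoc V Vᵀ, hV', Matrix.one_mul]
    have h3 : η 1 - B * η 1 = X + B * X := by
      have h4 : η 1 - B * η 1 = V * ((1 - B₁) * Q (a 1) (b 1) * Z) := by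
        simp only [hη]
        rw [← Matrix.mul_assoc B V, h2, Matrix.sub_mul, Matrix.sub_mul, Matrix.mul_sub,
          Matrix.one_mul]
        simp only [Matrix.mul_assoc]
      rw [h4, h1, Matrix.add_mul, Matrix.mul_add, Matrix.one_mul, ← Matrix.mul_assoc V B₁, ← h2,
        Matrix.mul_assoc B V, hZ, ← Matrix.mul_assoc V Vᵀ, hV', Matrix.one_mul]
    have h5 : B * (η 1 - Y) = η 1 - Y := by
      rw [Matrix.mul_sub, Matrix.mul_add] at *
      have h6 : B * Y = Y - X - B * X := by rw [← hBP]; abel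
      have h7 : B * η 1 = η 1 - (X + B * X) := by rw [← h3]; abel
      rw [h6, h7]; abel
    exact sub_eq_zero.1 (eq_zero_of_skew_mul hB h5)
  have hh : ‖Y - X‖ ^ 2 = ∑ i, 4 * σ (t i) * ∑ j, Z i j ^ 2 := by
    rw [← hη1, hdist 1 (by simp)]; ring
  refine ⟨η, fun s => V * (Q (a' s) (b' s) * Z), ?_, ?_, hη1, fun s hs => ⟨?_, ?_⟩,
    fun s hs => ⟨?_, ?_⟩⟩
  · refine continuous_diagonal_path V B₁ Z (continuous_pi fun i => ?_) (continuous_pi fun i => ?_)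
    · simp only [ha, Function.comp]; fun_prop
    · simp only [hb, Function.comp]; fun_prop
  · have := hdist 0 (by simp)
    rw [zero_pow two_ne_zero, zero_mul] at this
    exact sub_eq_zero.1 (by simpa using this)
  · have h1 : (Q (a s) (b s))ᵀ * Q (a s) (b s) = 1 := by
      rw [hQQ _ _ (fun _ => 1) fun x hx => ?_, ← Matrix.diagonal_one]
      · rfl
      · rw [hb2 s hs x hx]; simp only [ha]; ring
    show (V * (Q (a s) (b s) * Z))ᵀ * (V * (Q (a s) (b s) * Z)) = 1
    calc _ = Zᵀ * ((Q (a s) (b s))ᵀ * ((Vᵀ * V) * Q (a s) (b s))) * Z := by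
          simp only [Matrix.transpose_mul, Matrix.mul_assoc]
      _ = Xᵀ * (V * Vᵀ) * X := by
          rw [hV, Matrix.one_mul, h1, hZ]
          simp only [Matrix.transpose_mul, Matrix.transpose_transpose, Matrix.mul_assoc,
            Matrix.one_mul]
      _ = 1 := by rw [hV', Matrix.mul_one]; exact hX
  · rw [← pow_left_inj₀ (norm_nonneg _) (mul_nonneg hs.1 (norm_nonneg _)) two_ne_zero, mul_pow, hh,
      hdist s hs]
  · have hs' : s ∈ Set.Icc (0 : ℝ) 1 := ⟨hs.1.le, hs.2.le⟩
    refine hasDerivAt_diagonal_path V B₁ Z (fun i => ?_) (fun i => ?_)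
    · have h1 := (((hasDerivAt_pow 2 s).const_mul 2).mul_const (σ (t i))).const_sub 1
      refine h1.congr_deriv ?_
      simp only [ha', Function.comp]; push_cast; ring
    · have hu : 0 < 1 - s ^ 2 * σ (t i) := (hs1 s hs).trans_le (hpos' s hs _ (ht i))
      have h1 := ((((hasDerivAt_pow 2 s).mul_const (σ (t i))).const_sub 1).sqrt hu.ne')
      have h2 := (((hasDerivAt_id s).const_mul 2).mul_const (√(w (t i)))).mul h1
      refine h2.congr_deriv ?_
      have h3 : √(1 - s ^ 2 * σ (t i)) ≠ 0 := (Real.sqrt_pos.2 hu).ne'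
      simp only [hb', Function.comp, id]
      field_simp
      rw [Real.sq_sqrt hu.le]
      ring
  · have hbound : ‖V * (Q (a' s) (b' s) * Z)‖ ^ 2 ≤ (‖Y - X‖ / √(1 - s ^ 2)) ^ 2 := by
      rw [norm_mul_of_orthonormal hV, div_pow, Real.sq_sqrt (hs1 s hs).le, hh,
        norm_sq_mul_of_diagonal _ _ _ (hQQ _ _ (fun x => 4 * σ x / (1 - s ^ 2 * σ x))
          fun x hx => ?_), Finset.sum_div]
      · refine Finset.sum_le_sum fun i _ => ?_
        rw [mul_div_right_comm]
        have := hs1 s hs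
        have := hpos' s hs _ (ht i)
        have := hσ0 _ (ht i)
        simp only [Function.comp]
        gcongr
      · have hu : 0 < 1 - s ^ 2 * σ x := (hs1 s hs).trans_le (hpos' s hs _ hx)
        simp only [ha', hb', mul_pow, div_pow, Real.sq_sqrt hu.le, Real.sq_sqrt (hw0 x hx).le]
        have h1 : 2 ^ 2 * w x * ((1 - 2 * s ^ 2 * σ x) ^ 2 / (1 - s ^ 2 * σ x)) * x
            = 4 * σ x * ((1 - 2 * s ^ 2 * σ x) ^ 2 / (1 - s ^ 2 * σ x)) := by
          rw [← hwx x]; ring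
        rw [h1]
        field_simp
        ring
    exact (pow_le_pow_iff_left₀ (norm_nonneg _) (by positivity) two_ne_zero).1 hbound

/-- With `P = X + Y` and `N = Y - X`, the matrix `S = Pᵀ N` is skew because `Xᵀ X = Yᵀ Y`. In the
witness, `N G⁻¹ Pᵀ` maps `P` to `N`, the second term makes it skew, and the third, skew because `S`
is, cancels what the second does to `P`. -/
theorem exists_skew_of_injective {d r : ℕ} {X Y : Mat d r} (hX : X ∈ St d r) (hY : Y ∈ St d r)
    (hinj : ∀ z : Fin r → ℝ, (X + Y) *ᵥ z = 0 → z = 0) :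
    ∃ B : Mat d d, Bᵀ = -B ∧ B * (X + Y) = Y - X := by
  have hX' : Xᵀ * X = 1 := hX
  have hY' : Yᵀ * Y = 1 := hY
  set P := X + Y with hP
  set N := Y - X with hN
  set G : Mat r r := Pᵀ * P with hG
  have hdet : IsUnit G.det := by
    rw [isUnit_iff_ne_zero]
    intro h0
    obtain ⟨v, hv, hv0⟩ := Matrix.exists_mulVec_eq_zero_iff.2 h0
    refine hv (hinj v ?_)
    have h1 := (Matrix.conjTranspose_mul_self_mulVec_eq_zero P v).1
    rw [Matrix.conjTranspose_eq_transpose_of_trivial] at h1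
    exact h1 hv0
  have hGt : Gᵀ = G := by simp [hG]
  have hGit : (G⁻¹)ᵀ = G⁻¹ := by rw [Matrix.transpose_nonsing_inv, hGt]
  set S : Mat r r := Pᵀ * N with hS
  have hSt : Sᵀ = -S := by
    simp only [hS, hP, hN, Matrix.transpose_mul, Matrix.transpose_sub, Matrix.transpose_add,
      Matrix.transpose_transpose, Matrix.add_mul, Matrix.mul_sub, hX', hY']
    abel
  have hNP : Nᵀ * P = -S := by rw [← hSt, hS]; simp
  refine ⟨N * G⁻¹ * Pᵀ - P * G⁻¹ * Nᵀ - P * G⁻¹ * S * G⁻¹ * Pᵀ, ?_, ?_⟩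
  · simp only [Matrix.transpose_sub, Matrix.transpose_mul, Matrix.transpose_transpose, hGit, hSt,
      Matrix.mul_assoc, Matrix.neg_mul, Matrix.mul_neg]
    abel
  · have h1 : G⁻¹ * G = 1 := Matrix.nonsing_inv_mul G hdet
    simp only [Matrix.sub_mul, Matrix.mul_assoc, ← hG, h1, hNP, Matrix.mul_one, Matrix.mul_neg]
    abel

/-- A quadratic upper bound for functions with Lipschitz gradient over the Stiefel manifold. -/
theorem le_quadratic_of_injective {d r : ℕ} {f : Mat d r → ℝ} {L : ℝ}
    (hdiff : ∀ X ∈ St d r, DifferentiableAt ℝ f X) (hL : 0 ≤ L)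
    (hlip : ∀ X ∈ St d r, ∀ Y ∈ St d r, ‖euclGrad f X - euclGrad f Y‖ ≤ L * ‖X - Y‖)
    {X Y : Mat d r} (hX : X ∈ St d r) (hY : Y ∈ St d r)
    (hinj : ∀ z : Fin r → ℝ, (X + Y) *ᵥ z = 0 → z = 0) :
    f Y ≤ f X + inn (euclGrad f X) (Y - X) + L * ‖Y - X‖ ^ 2 := by
  obtain ⟨B, hB, hBP⟩ := exists_skew_of_injective hX hY hinj
  obtain ⟨η, η', hcont, h0, h1, hmem, hder⟩ := exists_curve_of_skew hX hB hBP
  set h := ‖Y - X‖ with hh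
  set g := euclGrad f X with hg
  -- The last term is a primitive of `-L h² s / √(1 - s²)`, which offsets the bound `L (s h) (h /
  -- √(1 - s²))` for the derivative of the rest. It is `L h²` at `0` and vanishes at `1`. The
  -- derivative is used on the open interval only, since it may blow up at `1`.
  set φ : ℝ → ℝ := fun s => f (η s) - inn g (η s) + L * h ^ 2 * √(1 - s ^ 2) with hφ
  have hinn : ∀ A : Mat d r, inn g A = fderiv ℝ f X A := fun A => (fderiv_apply_eq_inn f X A).symm
  have hφc : ContinuousOn φ (Set.Icc 0 1) := by
    intro s hs
    have h2 : ContinuousWithinAt (fun s => f (η s)) (Set.Icc 0 1) s :=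
      ((hdiff _ (hmem s hs).1).continuousAt.comp hcont.continuousAt).continuousWithinAt
    have h3 : Continuous fun s => inn g (η s) := by
      simp only [hinn]
      exact (fderiv ℝ f X).continuous.comp hcont
    have h4 : Continuous fun s : ℝ => L * h ^ 2 * √(1 - s ^ 2) := by fun_prop
    exact (h2.sub h3.continuousWithinAt).add h4.continuousWithinAt
  have hφd : ∀ s ∈ Set.Ioo (0 : ℝ) 1, ∃ e, HasDerivAt φ e s ∧ e ≤ 0 := by
    intro s hs
    have hs' : s ∈ Set.Icc (0 : ℝ) 1 := ⟨hs.1.le, hs.2.le⟩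
    obtain ⟨hd, hb⟩ := hder s hs
    have hu : 0 < 1 - s ^ 2 := sub_pos.2 (pow_lt_one₀ hs.1.le hs.2 two_ne_zero)
    have h2 : HasDerivAt (fun s => f (η s)) (inn (euclGrad f (η s)) (η' s)) s := by
      rw [← fderiv_apply_eq_inn]
      exact (hdiff _ (hmem s hs').1).hasFDerivAt.comp_hasDerivAt s hd
    have h3 : HasDerivAt (fun s => inn g (η s)) (inn g (η' s)) s := by
      simp only [hinn]
      exact (fderiv ℝ f X).hasFDerivAt.comp_hasDerivAt s hd
    have h4 := (((hasDerivAt_pow 2 s).const_sub 1).sqrt hu.ne').const_mul (L * h ^ 2)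
    have h5 := (h2.sub h3).add h4
    refine ⟨_, h5, ?_⟩
    · rw [← inn_sub_left]
      have h6 := inn_le_norm (euclGrad f (η s) - g) (η' s)
      have h7 : ‖euclGrad f (η s) - g‖ ≤ L * (s * h) := by
        rw [← (hmem s hs').2]; exact hlip _ (hmem s hs').1 _ hX
      have h8 := mul_le_mul h7 hb (norm_nonneg _) (mul_nonneg hL (mul_nonneg hs.1.le (norm_nonneg _)))
      have h9 : L * (s * h) * (h / √(1 - s ^ 2))
          + L * h ^ 2 * (-(↑2 * s ^ (2 - 1)) / (2 * √(1 - s ^ 2))) = 0 := by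
        have : √(1 - s ^ 2) ≠ 0 := (Real.sqrt_pos.2 hu).ne'
        field_simp
        simp
      push_cast at h9 ⊢
      linarith
  have hanti : AntitoneOn φ (Set.Icc 0 1) := by
    refine antitoneOn_of_deriv_nonpos (convex_Icc 0 1) hφc (fun s hs => ?_) (fun s hs => ?_)
    · rw [interior_Icc] at hs
      obtain ⟨e, he, -⟩ := hφd s hs
      exact he.differentiableAt.differentiableWithinAt
    · rw [interior_Icc] at hs
      obtain ⟨e, he, h2⟩ := hφd s hs
      rwa [he.deriv]
  have h2 := hanti (by simp : (0 : ℝ) ∈ Set.Icc (0 : ℝ) 1) (by simp : (1 : ℝ) ∈ Set.Icc (0 : ℝ) 1)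
    zero_le_one
  simp only [hφ, h0, h1] at h2
  norm_num at h2
  rw [inn_sub_right]
  linarith

/-! ### Density of the points `Y` for which `X + Y` is injective -/

/-- Take determinants in `Mᵀ (1 + M) = (1 + M)ᵀ` and cancel `det (1 + M)`. -/
theorem det_eq_one_of_orthogonal {m : ℕ} {M : Mat m m} (hM : Mᵀ * M = 1)
    (h : (1 + M).det ≠ 0) : M.det = 1 := by
  have h1 : Mᵀ * (1 + M) = (1 + M)ᵀ := by
    rw [Matrix.mul_add, hM, Matrix.mul_one, Matrix.transpose_add, Matrix.transpose_one, add_comm]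
  have h2 := congrArg Matrix.det h1
  rw [Matrix.det_mul, Matrix.det_transpose, Matrix.det_transpose] at h2
  exact mul_right_cancel₀ h (h2.trans (one_mul _).symm)

theorem mulVec_dotProduct_mulVec_of_mem_St {d r : ℕ} {X : Mat d r} (hX : X ∈ St d r)
    (u z : Fin r → ℝ) : (X *ᵥ u) ⬝ᵥ (X *ᵥ z) = u ⬝ᵥ z := by
  rw [Matrix.dotProduct_mulVec, ← Matrix.mulVec_transpose, Matrix.mulVec_mulVec,
    show Xᵀ * X = 1 from hX, Matrix.one_mulVec]

/-- For square orthogonal `X`, `Y` in the same component, the kernel of `X + Y` is not a line. -/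
theorem det_nonpos_of_ker_eq_span {r : ℕ} {X Y : Mat r r} (hX : X ∈ St r r) (hY : Y ∈ St r r)
    {u : Fin r → ℝ} (hu : u ≠ 0) (hker : ∀ z, (X + Y) *ᵥ z = 0 ↔ ∃ a : ℝ, z = a • u) :
    (Xᵀ * Y).det ≤ 0 := by
  have hX' : Xᵀ * X = 1 := hX
  have hY' : Yᵀ * Y = 1 := hY
  have hXX : X * Xᵀ = 1 := mul_eq_one_comm.1 hX'
  have huu : u ⬝ᵥ u ≠ 0 := by simpa using hu
  set A : Mat r r := Xᵀ * Y with hA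
  have hAA : Aᵀ * A = 1 := by
    rw [hA, Matrix.transpose_mul, Matrix.transpose_transpose, Matrix.mul_assoc,
      ← Matrix.mul_assoc X, hXX, Matrix.one_mul, hY']
  have hXA : X * A = Y := by rw [hA, ← Matrix.mul_assoc, hXX, Matrix.one_mul]
  have hYu : Y *ᵥ u = -(X *ᵥ u) := by
    have := (hker u).2 ⟨1, by simp⟩
    rw [Matrix.add_mulVec] at this
    exact eq_neg_of_add_eq_zero_right this
  have hAu : A *ᵥ u = -u := by
    rw [hA, ← Matrix.mulVec_mulVec, hYu, Matrix.mulVec_neg, Matrix.mulVec_mulVec, hX',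
      Matrix.one_mulVec]
  have hAtu : Aᵀ *ᵥ u = -u := by
    have h1 : Aᵀ *ᵥ (A *ᵥ u) = u := by rw [Matrix.mulVec_mulVec, hAA, Matrix.one_mulVec]
    rw [hAu, Matrix.mulVec_neg] at h1
    exact neg_eq_iff_eq_neg.1 h1
  -- The reflection in the hyperplane orthogonal to `u`. It removes the eigenvalue `-1` of `A`,
  -- whose eigenspace is spanned by `u`; so `A S` has determinant 1 while `S` has determinant -1.
  set S : Mat r r := 1 - Matrix.vecMulVec ((2 / (u ⬝ᵥ u)) • u) u with hS
  have hSt : Sᵀ = S := by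
    rw [hS, Matrix.transpose_sub, Matrix.transpose_one, Matrix.transpose_vecMulVec]
    congr 1
    ext i j
    simp [Matrix.vecMulVec_apply]; ring
  have hSz : ∀ z, S *ᵥ z = z - (2 / (u ⬝ᵥ u) * (u ⬝ᵥ z)) • u := fun z => by
    rw [hS, Matrix.sub_mulVec, Matrix.one_mulVec, Matrix.vecMulVec_mulVec]
    ext i; simp; ring
  have hSS : S * S = 1 := by
    refine Matrix.toLin'.injective (LinearMap.ext fun z => ?_)
    rw [Matrix.toLin'_mul, Matrix.toLin'_one]
    simp only [LinearMap.comp_apply, Matrix.toLin'_apply, LinearMap.id_apply, hSz]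
    rw [dotProduct_sub, dotProduct_smul]
    ext i
    simp only [Pi.sub_apply, Pi.smul_apply, smul_eq_mul]
    field_simp
    ring
  have hdetS : S.det = -1 := by
    rw [hS, sub_eq_add_neg, ← Matrix.neg_vecMulVec, Matrix.vecMulVec_eq Unit,
      Matrix.det_one_add_replicateCol_mul_replicateRow, dotProduct_neg, dotProduct_smul, smul_eq_mul, div_mul_cancel₀ _ huu]
    norm_num
  have hdet : (1 + A * S).det ≠ 0 := by
    intro h0
    obtain ⟨z, hz, hz0⟩ := Matrix.exists_mulVec_eq_zero_iff.2 h0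
    rw [Matrix.add_mulVec, Matrix.one_mulVec, ← Matrix.mulVec_mulVec, hSz, Matrix.mulVec_sub,
      Matrix.mulVec_smul, hAu] at hz0
    have h1 : u ⬝ᵥ (A *ᵥ z) = -(u ⬝ᵥ z) := by
      rw [Matrix.dotProduct_mulVec, ← Matrix.mulVec_transpose, hAtu, neg_dotProduct]
    have h2 := congrArg (u ⬝ᵥ ·) hz0
    simp only [dotProduct_add, dotProduct_sub, dotProduct_smul, dotProduct_neg, smul_eq_mul, h1,
      dotProduct_zero] at h2
    have h3 : u ⬝ᵥ z = 0 := by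
      field_simp at h2
      linarith
    rw [h3, mul_zero, zero_smul, sub_zero] at hz0
    have h4 : (X + Y) *ᵥ z = 0 := by
      rw [← hXA, Matrix.add_mulVec, ← Matrix.mulVec_mulVec, ← Matrix.mulVec_add, hz0,
        Matrix.mulVec_zero]
    obtain ⟨a, rfl⟩ := (hker z).1 h4
    rw [dotProduct_smul, smul_eq_mul] at h3
    rcases mul_eq_zero.1 h3 with h5 | h5
    · exact hz (by rw [h5, zero_smul])
    · exact huu h5
  have h1 : (A * S).det = 1 := by
    refine det_eq_one_of_orthogonal ?_ hdet
    rw [Matrix.transpose_mul, Matrix.mul_assoc, ← Matrix.mul_assoc Aᵀ, hAA, Matrix.one_mul, hSt, hSS]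
  rw [Matrix.det_mul, hdetS] at h1
  linarith

/-- The Cayley transform `(1 - t B)⁻¹ (1 + t B)` of a skew matrix with `B ^ 3 = -β B`. -/
noncomputable def cayley {d : ℕ} (B : Mat d d) (β t : ℝ) : Mat d d :=
  1 + (2 * t / (1 + β * t ^ 2)) • B + (t * (2 * t / (1 + β * t ^ 2))) • (B * B)

/-- The relation for `B³` reduces the inverse of `1 - t B` to a polynomial in `B`, so no
invertibility has to be carried along. -/
theorem one_sub_mul_cayley {d : ℕ} {B : Mat d d} {β : ℝ} (hβ : 0 ≤ β)
    (h3 : B * (B * B) = -(β • B)) (t : ℝ) : (1 - t • B) * cayley B β t = 1 + t • B := by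
  have hp : 1 + β * t ^ 2 ≠ 0 := by positivity
  simp only [cayley, Matrix.sub_mul, Matrix.mul_add, Matrix.one_mul, Matrix.mul_one,
    Matrix.mul_smul, Matrix.smul_mul, h3]
  set a := 2 * t / (1 + β * t ^ 2) with ha
  have h1 : a * (1 + β * t ^ 2) = 2 * t := div_mul_cancel₀ _ hp
  have h4 : a - t + t * (t * a) * β = t := by linarith
  have h2 : (a - t + t * (t * a) * β) • B = t • B := by rw [h4]
  calc _ = 1 + (a - t + t * (t * a) * β) • B := by module
    _ = _ := by rw [h2]

theorem cayley_orthogonal {d : ℕ} {B : Mat d d} (hB : Bᵀ = -B) {β : ℝ} (hβ : 0 ≤ β)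
    (h3 : B * (B * B) = -(β • B)) (t : ℝ) : (cayley B β t)ᵀ * cayley B β t = 1 := by
  have hp : 1 + β * t ^ 2 ≠ 0 := by positivity
  simp only [cayley, Matrix.transpose_add, Matrix.transpose_smul, Matrix.transpose_mul,
    Matrix.transpose_one, hB, Matrix.add_mul, Matrix.mul_add, Matrix.one_mul, Matrix.mul_one,
    Matrix.mul_smul, Matrix.smul_mul, Matrix.neg_mul, Matrix.mul_neg, neg_neg, Matrix.mul_assoc,
    h3]
  set a := 2 * t / (1 + β * t ^ 2) with ha
  have h1 : a * (1 + β * t ^ 2) = 2 * t := div_mul_cancel₀ _ hp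
  have h5 : 2 * (t * a) - a * a - t * a * (t * a) * β = 0 := by
    linear_combination (-a) * h1
  calc _ = 1 + (2 * (t * a) - a * a - t * a * (t * a) * β) • (B * B) := by module
    _ = _ := by rw [h5]; simp

theorem continuous_cayley {d : ℕ} (B : Mat d d) {β : ℝ} (hβ : 0 ≤ β) :
    Continuous (cayley B β) := by
  have hp : ∀ t : ℝ, 1 + β * t ^ 2 ≠ 0 := fun t => by positivity
  unfold cayley
  have h : Continuous fun t : ℝ => 2 * t / (1 + β * t ^ 2) :=
    Continuous.div (by fun_prop) (by fun_prop) hp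
  fun_prop

theorem cayley_zero {d : ℕ} (B : Mat d d) (β : ℝ) : cayley B β 0 = 1 := by
  simp [cayley]

/-- The elementary skew matrix `w vᵀ - v wᵀ`. -/
def skewPair {d : ℕ} (v w : Fin d → ℝ) : Mat d d := Matrix.vecMulVec w v - Matrix.vecMulVec v w

theorem skewPair_transpose {d : ℕ} (v w : Fin d → ℝ) : (skewPair v w)ᵀ = -skewPair v w := by
  simp [skewPair, Matrix.transpose_vecMulVec]

theorem skewPair_mulVec {d : ℕ} (v w n : Fin d → ℝ) :
    skewPair v w *ᵥ n = (v ⬝ᵥ n) • w - (w ⬝ᵥ n) • v := by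
  rw [skewPair, Matrix.sub_mulVec, Matrix.vecMulVec_mulVec, Matrix.vecMulVec_mulVec]
  ext i; simp

theorem skewPair_cube {d : ℕ} {v w : Fin d → ℝ} (h : v ⬝ᵥ w = 0) :
    skewPair v w * (skewPair v w * skewPair v w)
      = -(((v ⬝ᵥ v) * (w ⬝ᵥ w)) • skewPair v w) := by
  have h' : w ⬝ᵥ v = 0 := by rw [dotProduct_comm, h]
  refine Matrix.toLin'.injective (LinearMap.ext fun z => ?_)
  rw [Matrix.toLin'_mul, Matrix.toLin'_mul]
  simp only [LinearMap.comp_apply, Matrix.toLin'_apply, skewPair_mulVec, dotProduct_sub,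
    dotProduct_smul, h, h', Matrix.neg_mulVec, Matrix.smul_mulVec, smul_eq_mul]
  module

/-- Multiplying by `1 - t B` gives `(X + Y) z + t B (Y - X) z = 0`. Here `v = X u` and `w` are
orthogonal to each other and to the range of `X + Y`, so pairing with each of them kills the term
with `B`. What remains is `(X + Y) z = 0`, whence `(Y - X) z = -2 X z`, and its product with `v`
gives `⟨u, z⟩ = 0`. -/
theorem ker_cayley {d r : ℕ} {X Y : Mat d r} (hX : X ∈ St d r) (hY : Y ∈ St d r)
    {u : Fin r → ℝ} (hu : (X + Y) *ᵥ u = 0) {w : Fin d → ℝ} (hw : w ≠ 0)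
    (hwv : (X *ᵥ u) ⬝ᵥ w = 0) (hwP : ∀ z, w ⬝ᵥ ((X + Y) *ᵥ z) = 0) (hu0 : u ≠ 0)
    {t β : ℝ} (ht : t ≠ 0) (hβ : β = ((X *ᵥ u) ⬝ᵥ (X *ᵥ u)) * (w ⬝ᵥ w)) (z : Fin r → ℝ)
    (hz : (X + cayley (skewPair (X *ᵥ u) w) β t * Y) *ᵥ z = 0) :
    (X + Y) *ᵥ z = 0 ∧ u ⬝ᵥ z = 0 := by
  set v := X *ᵥ u with hv
  set B := skewPair v w with hB
  have hYu : Y *ᵥ u = -v := by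
    rw [Matrix.add_mulVec] at hu
    exact eq_neg_of_add_eq_zero_right hu
  have hww : w ⬝ᵥ w ≠ 0 := by simpa using hw
  have hvv : v ⬝ᵥ v ≠ 0 := by
    rw [hv, mulVec_dotProduct_mulVec_of_mem_St hX]; simpa using hu0
  have hβ0 : 0 ≤ β := by
    rw [hβ]
    exact mul_nonneg (Finset.sum_nonneg fun i _ => mul_self_nonneg _)
      (Finset.sum_nonneg fun i _ => mul_self_nonneg _)
  have h1 : (1 - t • B) * (X + cayley B β t * Y) = (X + Y) + t • (B * (Y - X)) := by
    rw [Matrix.mul_add, ← Matrix.mul_assoc,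
      one_sub_mul_cayley hβ0 (by rw [hβ]; exact skewPair_cube hwv)]
    simp only [Matrix.sub_mul, Matrix.add_mul, Matrix.one_mul, Matrix.smul_mul, Matrix.mul_sub]
    module
  have h2 : (X + Y) *ᵥ z + t • (B *ᵥ ((Y - X) *ᵥ z)) = 0 := by
    have := congrArg ((1 - t • B) *ᵥ ·) hz
    simp only [Matrix.mulVec_mulVec, h1, Matrix.mulVec_zero] at this
    rwa [Matrix.add_mulVec (X + Y), Matrix.smul_mulVec, ← Matrix.mulVec_mulVec] at this
  set n := (Y - X) *ᵥ z with hn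
  have hvP : v ⬝ᵥ ((X + Y) *ᵥ z) = 0 := by
    rw [Matrix.add_mulVec, dotProduct_add]
    have h3 : v ⬝ᵥ (Y *ᵥ z) = -(u ⬝ᵥ z) := by
      rw [← mulVec_dotProduct_mulVec_of_mem_St hY, hYu, neg_dotProduct, neg_neg]
    rw [h3, hv, mulVec_dotProduct_mulVec_of_mem_St hX, add_neg_cancel]
  rw [hB, skewPair_mulVec] at h2
  have hwv' : w ⬝ᵥ v = 0 := by rw [dotProduct_comm, hwv]
  have h4 : v ⬝ᵥ n = 0 := by
    have h3 := congrArg (w ⬝ᵥ ·) h2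
    simp only [dotProduct_add, dotProduct_sub, dotProduct_smul, smul_eq_mul, hwP, hwv',
      dotProduct_zero, mul_zero, sub_zero, zero_add] at h3
    simpa [ht, hww] using h3
  have h5 : w ⬝ᵥ n = 0 := by
    have h3 := congrArg (v ⬝ᵥ ·) h2
    simp only [dotProduct_add, dotProduct_sub, dotProduct_smul, smul_eq_mul, hvP, hwv,
      dotProduct_zero, mul_zero, zero_sub, zero_add] at h3
    simpa [ht, hvv] using h3
  rw [h4, h5, zero_smul, zero_smul, sub_zero, smul_zero, add_zero] at h2
  refine ⟨h2, ?_⟩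
  have h6 : Y *ᵥ z = -(X *ᵥ z) := by
    rw [Matrix.add_mulVec] at h2
    exact eq_neg_of_add_eq_zero_right h2
  rw [hn, Matrix.sub_mulVec, h6, dotProduct_sub, dotProduct_neg, hv,
    mulVec_dotProduct_mulVec_of_mem_St hX] at h4
  linarith

theorem le_of_mem_St {d r : ℕ} {X : Mat d r} (hX : X ∈ St d r) : r ≤ d := by
  have h1 := Matrix.rank_mul_le_right Xᵀ X
  rw [show Xᵀ * X = 1 from hX, Matrix.rank_one, Fintype.card_fin] at h1
  exact h1.trans (by simpa using Matrix.rank_le_card_height X)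

theorem exists_ne_zero_orthogonal {d : ℕ} {U : Submodule ℝ (Fin d → ℝ)} (hU : U < ⊤) :
    ∃ w : Fin d → ℝ, w ≠ 0 ∧ ∀ x ∈ U, w ⬝ᵥ x = 0 := by
  obtain ⟨φ, hφ, hU'⟩ := Submodule.exists_dual_map_eq_bot_of_lt_top hU inferInstance
  have hrep : ∀ x, φ x = (fun i => φ (Pi.single i 1)) ⬝ᵥ x := fun x => by
    conv_lhs => rw [pi_eq_sum_univ' x, map_sum]
    simp [dotProduct, mul_comm]
  refine ⟨fun i => φ (Pi.single i 1), fun h => hφ (LinearMap.ext fun x => ?_), fun x hx => ?_⟩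
  · rw [hrep, h]; simp
  · rw [← hrep]
    have : φ x ∈ U.map φ := Submodule.mem_map_of_mem hx
    rwa [hU', Submodule.mem_bot] at this

/-- The dimension is at most `1 + r - dim ker (X + Y)`, hence at most `r`. It can reach `d` only if
`r = d` and the kernel is a line, which `det_nonpos_of_ker_eq_span` excludes in the same component.
-/
theorem span_sup_range_lt_top {d r : ℕ} {X Y : Mat d r} (hX : X ∈ St d r) (hY : Y ∈ St d r)
    (hcomp : r < d ∨ 0 < (Xᵀ * Y).det) {u : Fin r → ℝ} (hu0 : u ≠ 0) (hu : (X + Y) *ᵥ u = 0)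
    (v : Fin d → ℝ) : Submodule.span ℝ {v} ⊔ LinearMap.range (X + Y).mulVecLin < ⊤ := by
  refine lt_top_iff_ne_top.2 fun htop => ?_
  have h1 := Submodule.finrank_add_le_finrank_add_finrank (Submodule.span ℝ {v})
    (LinearMap.range (X + Y).mulVecLin)
  rw [htop, finrank_top, Module.finrank_fin_fun] at h1
  have h2 : Module.finrank ℝ (Submodule.span ℝ {v}) ≤ 1 :=
    (finrank_span_le_card (R := ℝ) ({v} : Set (Fin d → ℝ))).trans (by simp)
  have h3 := LinearMap.finrank_range_add_finrank_ker (X + Y).mulVecLin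
  rw [Module.finrank_fin_fun] at h3
  have huk : u ∈ LinearMap.ker (X + Y).mulVecLin := LinearMap.mem_ker.2 hu
  have h4 : 0 < Module.finrank ℝ (LinearMap.ker (X + Y).mulVecLin) :=
    Module.finrank_pos_iff_exists_ne_zero.2 ⟨⟨u, huk⟩, by simpa using hu0⟩
  have h5 := le_of_mem_St hX
  rcases hcomp with h | h
  · omega
  · obtain rfl : r = d := by omega
    have h6 : Module.finrank ℝ (LinearMap.ker (X + Y).mulVecLin) = 1 := by omega
    refine absurd h (not_lt.2 (det_nonpos_of_ker_eq_span hX hY hu0 fun z => ⟨fun hz => ?_, ?_⟩))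
    · have hzk : z ∈ LinearMap.ker (X + Y).mulVecLin := LinearMap.mem_ker.2 hz
      obtain ⟨a, ha⟩ := (finrank_eq_one_iff_of_nonzero' (⟨u, huk⟩ : LinearMap.ker (X + Y).mulVecLin)
        (by simpa using hu0)).1 h6 ⟨z, hzk⟩
      exact ⟨a, (congrArg Subtype.val ha).symm⟩
    · rintro ⟨a, rfl⟩
      rw [Matrix.mulVec_smul, hu, smul_zero]

/-- Induction on the dimension of the kernel of `X + Y`. A small rotation of `Y` in the plane of `X
u` and `w` keeps the new kernel inside the old one and removes `u`; the sign of the determinant, an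
open condition, survives. -/
theorem exists_near_injective {d r : ℕ} {X : Mat d r} (hX : X ∈ St d r) (m : ℕ) :
    ∀ {Y : Mat d r}, Y ∈ St d r → (r < d ∨ 0 < (Xᵀ * Y).det) →
      Module.finrank ℝ (LinearMap.ker (X + Y).mulVecLin) = m → ∀ {ε : ℝ}, 0 < ε →
      ∃ Y' ∈ St d r, ‖Y' - Y‖ < ε ∧ ∀ z : Fin r → ℝ, (X + Y') *ᵥ z = 0 → z = 0 := by
  induction m using Nat.strong_induction_on with
  | _ m ih =>
    intro Y hY hcomp hm ε hε
    by_cases hinj : ∀ z : Fin r → ℝ, (X + Y) *ᵥ z = 0 → z = 0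
    · exact ⟨Y, hY, by simpa using hε, hinj⟩
    · push Not at hinj
      obtain ⟨u, hu, hu0⟩ := hinj
      obtain ⟨w, hw, hwU⟩ := exists_ne_zero_orthogonal
        (span_sup_range_lt_top hX hY hcomp hu0 hu (X *ᵥ u))
      have hwv : (X *ᵥ u) ⬝ᵥ w = 0 := by
        rw [dotProduct_comm]
        exact hwU _ (Submodule.mem_sup_left (Submodule.mem_span_singleton_self _))
      have hwP : ∀ z, w ⬝ᵥ ((X + Y) *ᵥ z) = 0 := fun z =>
        hwU _ (Submodule.mem_sup_right ⟨z, rfl⟩)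
      set β := ((X *ᵥ u) ⬝ᵥ (X *ᵥ u)) * (w ⬝ᵥ w) with hβ
      have hβ0 : 0 ≤ β := mul_nonneg (Finset.sum_nonneg fun i _ => mul_self_nonneg _)
        (Finset.sum_nonneg fun i _ => mul_self_nonneg _)
      set Q : ℝ → Mat d d := cayley (skewPair (X *ᵥ u) w) β with hQ
      have hQc : Continuous fun t => Q t * Y :=
        (continuous_cayley _ hβ0).matrix_mul continuous_const
      have hQ0 : Q 0 * Y = Y := by rw [hQ, cayley_zero, Matrix.one_mul]
      have hQmem : ∀ t, Q t * Y ∈ St d r := fun t => by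
        show (Q t * Y)ᵀ * (Q t * Y) = 1
        rw [Matrix.transpose_mul, Matrix.mul_assoc, ← Matrix.mul_assoc (Q t)ᵀ, hQ,
          cayley_orthogonal (skewPair_transpose _ _) hβ0 (skewPair_cube hwv), Matrix.one_mul]
        exact hY
      have hev1 : ∀ᶠ t in nhds (0 : ℝ), ‖Q t * Y - Y‖ < ε / 2 := by
        have : Filter.Tendsto (fun t => ‖Q t * Y - Y‖) (nhds 0) (nhds ‖Q 0 * Y - Y‖) :=
          ((hQc.sub continuous_const).norm).tendsto 0
        rw [hQ0, sub_self, norm_zero] at this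
        exact this.eventually_lt_const (half_pos hε)
      have hev2 : ∀ᶠ t in nhds (0 : ℝ), r < d ∨ 0 < (Xᵀ * (Q t * Y)).det := by
        rcases hcomp with h | h
        · exact Filter.Eventually.of_forall fun _ => Or.inl h
        · have : Filter.Tendsto (fun t => (Xᵀ * (Q t * Y)).det) (nhds 0)
              (nhds (Xᵀ * (Q 0 * Y)).det) :=
            ((continuous_const.matrix_mul hQc).matrix_det).tendsto 0
          rw [hQ0] at this
          exact (this.eventually_const_lt h).mono fun _ => Or.inr
      obtain ⟨t, ⟨ht1, ht2⟩, ht0⟩ := (((hev1.and hev2).filter_mono nhdsWithin_le_nhds).and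
        (self_mem_nhdsWithin : Set.Ioi (0 : ℝ) ∈ nhdsWithin 0 (Set.Ioi 0))).exists
      have hker : ∀ z, (X + Q t * Y) *ᵥ z = 0 → (X + Y) *ᵥ z = 0 ∧ u ⬝ᵥ z = 0 :=
        ker_cayley hX hY hu hw hwv hwP hu0 (ne_of_gt ht0) hβ
      have hlt : LinearMap.ker (X + Q t * Y).mulVecLin < LinearMap.ker (X + Y).mulVecLin := by
        refine lt_of_le_of_ne (fun z hz => ?_) fun heq => ?_
        · exact (hker z hz).1
        · have hu' : u ∈ LinearMap.ker (X + Q t * Y).mulVecLin := by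
            rw [heq]; exact LinearMap.mem_ker.2 hu
          exact hu0 (by simpa using (hker u hu').2)
      obtain ⟨Y', hY', hd, hinj⟩ := ih _ (hm ▸ Submodule.finrank_lt_finrank_of_lt hlt) (hQmem t) ht2
        rfl (half_pos hε)
      refine ⟨Y', hY', ?_, hinj⟩
      calc ‖Y' - Y‖ ≤ ‖Y' - Q t * Y‖ + ‖Q t * Y - Y‖ := norm_sub_le_norm_sub_add_norm_sub _ _ _
        _ < ε / 2 + ε / 2 := add_lt_add hd ht1
        _ = ε := add_halves ε

/-- Both sides are continuous at `Y`, so density removes the injectivity assumption. -/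
theorem le_quadratic {d r : ℕ} {f : Mat d r → ℝ} {L : ℝ}
    (hdiff : ∀ X ∈ St d r, DifferentiableAt ℝ f X) (hL : 0 ≤ L)
    (hlip : ∀ X ∈ St d r, ∀ Y ∈ St d r, ‖euclGrad f X - euclGrad f Y‖ ≤ L * ‖X - Y‖)
    {X Y : Mat d r} (hX : X ∈ St d r) (hY : Y ∈ St d r) (hcomp : r < d ∨ 0 < (Xᵀ * Y).det) :
    f Y ≤ f X + inn (euclGrad f X) (Y - X) + L * ‖Y - X‖ ^ 2 := by
  set s : Set (Mat d r) := {Y' | Y' ∈ St d r ∧ ∀ z : Fin r → ℝ, (X + Y') *ᵥ z = 0 → z = 0} with hs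
  have hcl : Y ∈ closure s := Metric.mem_closure_iff.2 fun ε hε => by
    obtain ⟨Y', hY', hd, hinj⟩ := exists_near_injective hX _ hY hcomp rfl hε
    exact ⟨Y', ⟨hY', hinj⟩, by rwa [dist_eq_norm, norm_sub_rev]⟩
  have hne := mem_closure_iff_nhdsWithin_neBot.1 hcl
  have h1 : Filter.Tendsto f (nhdsWithin Y s) (nhds (f Y)) :=
    (hdiff Y hY).continuousAt.continuousWithinAt
  have h2 : Filter.Tendsto (fun Y => f X + inn (euclGrad f X) (Y - X) + L * ‖Y - X‖ ^ 2)
      (nhdsWithin Y s) (nhds (f X + inn (euclGrad f X) (Y - X) + L * ‖Y - X‖ ^ 2)) := by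
    refine (Continuous.tendsto ?_ Y).mono_left nhdsWithin_le_nhds
    unfold inn
    fun_prop
  refine le_of_tendsto_of_tendsto h1 h2 ?_
  filter_upwards [self_mem_nhdsWithin] with Y' hY'
  exact le_quadratic_of_injective hdiff hL hlip hX hY'.1 hY'.2

/-! ### Descent along a retraction -/

/-- Only square matrices matter. Along `t ↦ R X (t • E)` the determinant is continuous, never zero,
and equal to 1 at `t = 0`. -/
theorem IsRetraction.same_component {d r : ℕ} {ρ : ℝ} {R : Mat d r → Mat d r → Mat d r}
    (hR : IsRetraction ρ R) {X E : Mat d r} (hX : X ∈ St d r) (hE : E ∈ Tan ρ X) :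
    r < d ∨ 0 < (Xᵀ * R X E).det := by
  refine or_iff_not_imp_left.2 fun hlt => ?_
  obtain rfl : r = d := le_antisymm (le_of_mem_St hX) (not_lt.1 hlt)
  have hc : Continuous fun t : ℝ => (Xᵀ * R X (t • E)).det := by
    have h1 : Continuous fun t : ℝ => R X (t • E) :=
      hR.smooth.continuousOn.comp_continuous (f := fun t : ℝ => (X, t • E)) (by fun_prop)
        fun t => ⟨hX, smul_mem_Tan hE t⟩
    exact (continuous_const.matrix_mul h1).matrix_det
  have hne : ∀ t : ℝ, (Xᵀ * R X (t • E)).det ≠ 0 := fun t => by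
    have h1 : IsUnit (R X (t • E)).det :=
      Matrix.isUnit_det_of_left_inverse (hR.mem X hX _ (smul_mem_Tan hE t))
    have h2 : IsUnit X.det := Matrix.isUnit_det_of_left_inverse hX
    rw [Matrix.det_mul, Matrix.det_transpose]
    exact mul_ne_zero h2.ne_zero h1.ne_zero
  have h0 : (Xᵀ * R X ((0 : ℝ) • E)).det = 1 := by
    rw [zero_smul, hR.zero X hX, show Xᵀ * X = 1 from hX, Matrix.det_one]
  by_contra hneg
  have h1 : (Xᵀ * R X ((1 : ℝ) • E)).det ≤ 0 := by rw [one_smul]; exact not_lt.1 hneg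
  obtain ⟨t, -, ht⟩ := intermediate_value_Icc' zero_le_one hc.continuousOn
    (show (0 : ℝ) ∈ Set.Icc _ _ from ⟨h1, by rw [h0]; exact zero_le_one⟩)
  exact hne t ht

theorem descent_retraction {d r : ℕ} {ρ : ℝ} {R : Mat d r → Mat d r → Mat d r}
    (hR : IsRetraction ρ R) {L₁ L₂ : ℝ} (hRc : RetractionConstants ρ R L₁ L₂)
    {f : Mat d r → ℝ} {L C : ℝ}
    (hdiff : ∀ X ∈ St d r, DifferentiableAt ℝ f X) (hL : 0 ≤ L)
    (hlip : ∀ X ∈ St d r, ∀ Y ∈ St d r, ‖euclGrad f X - euclGrad f Y‖ ≤ L * ‖X - Y‖)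
    (hC : ∀ X ∈ St d r, ‖euclGrad f X‖ ≤ C)
    {X E : Mat d r} (hX : X ∈ St d r) (hE : E ∈ Tan ρ X) :
    f (R X E) ≤ f X + inn (euclGrad f X) E + (L₂ * C + L₁ ^ 2 * L) * ‖E‖ ^ 2 := by
  have h1 := le_quadratic hdiff hL hlip hX (hR.mem X hX E hE) (hR.same_component hX hE)
  have h2 := hRc.first X hX E hE 1 zero_le_one
  have h3 := hRc.second X hX E hE 1 zero_le_one
  rw [one_smul, mul_one] at h2
  rw [one_smul, one_pow, mul_one] at h3
  have h4 : L * ‖R X E - X‖ ^ 2 ≤ L * (L₁ * ‖E‖) ^ 2 := by gcongr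
  have h5 : inn (euclGrad f X) (R X E - X - E) ≤ C * (L₂ * ‖E‖ ^ 2) :=
    (inn_le_norm _ _).trans (mul_le_mul (hC X hX) h3 (norm_nonneg _)
      ((norm_nonneg _).trans (hC X hX)))
  rw [inn_sub_right] at h5
  linarith

/-! ### Moments of mini-batch sums -/

theorem sum_fin_succ_pi {n b : ℕ} {M : Type*} [AddCommMonoid M] (g : (Fin (b + 1) → Fin n) → M) :
    ∑ B, g B = ∑ i : Fin n, ∑ B : Fin b → Fin n, g (Fin.cons i B) := by
  rw [← Fintype.sum_prod_type']
  exact (Fintype.sum_equiv (Fin.consEquiv fun _ => Fin n) _ _ fun _ => rfl).symm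

theorem sum_batch_eq_zero {d r n : ℕ} {a : Fin n → Mat d r} (ha : ∑ i, a i = 0) (b : ℕ) :
    ∑ B : Fin b → Fin n, ∑ j, a (B j) = 0 := by
  induction b with
  | zero => simp
  | succ b ih =>
    rw [sum_fin_succ_pi]
    simp only [Fin.sum_univ_succ, Fin.cons_zero, Fin.cons_succ, Finset.sum_add_distrib, ih,
      Finset.sum_const, Finset.card_univ, smul_zero, add_zero, ← Finset.smul_sum, ha]

/-- Independent centred draws are uncorrelated, so squared norms add. The factor `n` on the left
avoids the exponent `b - 1`. -/
theorem sum_norm_sq_batch {d r n : ℕ} {a : Fin n → Mat d r} (ha : ∑ i, a i = 0) (b : ℕ) :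
    n * ∑ B : Fin b → Fin n, ‖∑ j, a (B j)‖ ^ 2 = b * (n : ℝ) ^ b * ∑ i, ‖a i‖ ^ 2 := by
  induction b with
  | zero => simp
  | succ b ih =>
    rw [sum_fin_succ_pi]
    have h1 : ∀ i : Fin n, ∑ B : Fin b → Fin n,
        ‖∑ j, a ((Fin.cons i B : Fin (b + 1) → Fin n) j)‖ ^ 2
        = (n : ℝ) ^ b * ‖a i‖ ^ 2 + ∑ B : Fin b → Fin n, ‖∑ j, a (B j)‖ ^ 2 := fun i => by
      simp only [Fin.sum_univ_succ, Fin.cons_zero, Fin.cons_succ, norm_add_sq_mat,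
        Finset.sum_add_distrib, ← Finset.mul_sum, ← inn_sum_right, sum_batch_eq_zero ha]
      simp [inn]
    simp only [h1, Finset.sum_add_distrib, ← Finset.mul_sum, Finset.sum_const, Finset.card_univ,
      Fintype.card_fin, nsmul_eq_mul]
    rw [mul_add, ih]
    push_cast
    ring

theorem sum_norm_sq_sub_mean_le {d r n : ℕ} (a : Fin n → Mat d r) (m : Mat d r)
    (hm : ∑ i, a i = (n : ℝ) • m) : ∑ i, ‖a i - m‖ ^ 2 ≤ ∑ i, ‖a i‖ ^ 2 := by
  have h1 : ∀ i, ‖a i - m‖ ^ 2 = ‖a i‖ ^ 2 - 2 * inn m (a i) + ‖m‖ ^ 2 := fun i => by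
    rw [sub_eq_add_neg, norm_add_sq_mat, norm_neg, inn_neg_right, inn_comm]; ring
  simp only [h1, Finset.sum_add_distrib, Finset.sum_sub_distrib, ← Finset.mul_sum, ← inn_sum_right,
    hm, inn_smul_right, inn_self, Finset.sum_const, Finset.card_univ, Fintype.card_fin,
    nsmul_eq_mul]
  have : 0 ≤ (n : ℝ) * ‖m‖ ^ 2 := by positivity
  linarith

/-! ### The stochastic direction -/

/-- `D_ρ(X, ·)` is linear, so the direction is the Riemannian gradient plus a batch mean of the
images of the centred gradient differences. Centring does not increase the second moment, and `ν
‖D_ρ(X, Y)‖ ≤ ‖Y‖` bounds the images. -/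
theorem exists_centered_direction {d r n b : ℕ} [NeZero n] (hb : 0 < b) {ρ L : ℝ} (hρ : 0 ≤ ρ)
    {f : Fin n → Mat d r → ℝ} (hf : LipschitzGradients f L) {X X₀ : Mat d r}
    (hX : X ∈ St d r) (hX₀ : X₀ ∈ St d r) :
    ∃ a : Fin n → Mat d r, ∑ i, a i = 0 ∧
      nu ρ ^ 2 * ∑ i, ‖a i‖ ^ 2 ≤ n * (L ^ 2 * ‖X - X₀‖ ^ 2) ∧
      ∀ B : Fin b → Fin n, Dop ρ X (stochGrad f X₀ (euclGrad (avg f) X₀) X B)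
        = riemGrad ρ (avg f) X + (1 / (b : ℝ)) • ∑ j, a (B j) := by
  have hn : (n : ℝ) ≠ 0 := Nat.cast_ne_zero.2 (NeZero.ne n)
  have hb' : (b : ℝ) ≠ 0 := Nat.cast_ne_zero.2 hb.ne'
  set e : Fin n → Mat d r := fun i => euclGrad (f i) X - euclGrad (f i) X₀ with he
  set m : Mat d r := euclGrad (avg f) X - euclGrad (avg f) X₀ with hm
  have hsum : ∑ i, e i = (n : ℝ) • m := by
    rw [hm, euclGrad_avg fun i => (hf i).1 X hX, euclGrad_avg fun i => (hf i).1 X₀ hX₀, ← smul_sub,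
      smul_smul, mul_one_div_cancel hn, one_smul, ← Finset.sum_sub_distrib]
  refine ⟨fun i => Dop ρ X (e i - m), ?_, ?_, fun B => ?_⟩
  · rw [← Dop_sum, Finset.sum_sub_distrib, hsum]
    rw [Finset.sum_const, Finset.card_univ, Fintype.card_fin, ← Nat.cast_smul_eq_nsmul ℝ, sub_self]
    simp [Dop]
  · rw [Finset.mul_sum]
    calc ∑ i, nu ρ ^ 2 * ‖Dop ρ X (e i - m)‖ ^ 2 ≤ ∑ i, ‖e i - m‖ ^ 2 := by
          refine Finset.sum_le_sum fun i _ => ?_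
          rw [← mul_pow]
          have := nu_pos hρ
          have := norm_Dop_le hρ hX (e i - m)
          gcongr
      _ ≤ ∑ i, ‖e i‖ ^ 2 := sum_norm_sq_sub_mean_le e m hsum
      _ ≤ ∑ _i : Fin n, (L * ‖X - X₀‖) ^ 2 := by
          refine Finset.sum_le_sum fun i _ => ?_
          have := (hf i).2 X hX X₀ hX₀
          gcongr
      _ = _ := by simp [mul_pow]
  · have h1 : stochGrad f X₀ (euclGrad (avg f) X₀) X B
        = euclGrad (avg f) X + (1 / (b : ℝ)) • ∑ j, (e (B j) - m) := by
      rw [Finset.sum_sub_distrib (fun j => e (B j)), Finset.sum_const, Finset.card_univ, Fintype.card_fin,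
        smul_sub, ← Nat.cast_smul_eq_nsmul ℝ, smul_smul, one_div_mul_cancel hb', one_smul, hm,
        stochGrad]
      abel
    rw [h1, Dop_add, Dop_smul, Dop_sum, riemGrad]

theorem sum_direction {d r n b : ℕ} {a : Fin n → Mat d r} (ha : ∑ i, a i = 0) (g : Mat d r) :
    ∑ B : Fin b → Fin n, (g + (1 / (b : ℝ)) • ∑ j, a (B j)) = ((n : ℝ) ^ b) • g := by
  rw [Finset.sum_add_distrib, ← Finset.smul_sum, sum_batch_eq_zero ha]
  simp [← Nat.cast_smul_eq_nsmul ℝ]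

theorem sum_norm_sq_direction {d r n b : ℕ} [NeZero n] (hb : 0 < b) {a : Fin n → Mat d r}
    (ha : ∑ i, a i = 0) (g : Mat d r) {V : ℝ} (hV : ∑ i, ‖a i‖ ^ 2 ≤ n * V) :
    ∑ B : Fin b → Fin n, ‖g + (1 / (b : ℝ)) • ∑ j, a (B j)‖ ^ 2
      ≤ (n : ℝ) ^ b * (‖g‖ ^ 2 + V / b) := by
  have hn : (0 : ℝ) < n := Nat.cast_pos.2 (NeZero.pos n)
  have hb' : (0 : ℝ) < b := Nat.cast_pos.2 hb
  have h1 : ∀ B : Fin b → Fin n, ‖g + (1 / (b : ℝ)) • ∑ j, a (B j)‖ ^ 2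
      = ‖g‖ ^ 2 + 2 / b * inn g (∑ j, a (B j)) + 1 / (b : ℝ) ^ 2 * ‖∑ j, a (B j)‖ ^ 2 := fun B => by
    rw [norm_add_sq_mat, inn_smul_right, norm_smul, Real.norm_of_nonneg (by positivity)]
    ring
  simp only [h1, Finset.sum_add_distrib, ← Finset.mul_sum, ← inn_sum_right, sum_batch_eq_zero ha]
  have h2 := sum_norm_sq_batch ha b
  have h3 : ∑ B : Fin b → Fin n, ‖∑ j, a (B j)‖ ^ 2 ≤ b * (n : ℝ) ^ b * V := by
    refine le_of_mul_le_mul_left ?_ hn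
    rw [h2]
    calc b * (n : ℝ) ^ b * ∑ i, ‖a i‖ ^ 2 ≤ b * (n : ℝ) ^ b * (n * V) := by gcongr
      _ = _ := by ring
  have h4 : 1 / (b : ℝ) ^ 2 * ∑ B : Fin b → Fin n, ‖∑ j, a (B j)‖ ^ 2
      ≤ 1 / (b : ℝ) ^ 2 * (b * (n : ℝ) ^ b * V) := by gcongr
  have h5 : 1 / (b : ℝ) ^ 2 * (b * (n : ℝ) ^ b * V) = (n : ℝ) ^ b * (V / b) := by
    field_simp
  simp only [Finset.sum_const, Finset.card_univ, Fintype.card_fun, Fintype.card_fin, nsmul_eq_mul,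
    inn, Matrix.mul_zero, Matrix.trace_zero, mul_zero, add_zero]
  push_cast
  linarith

/-! ### One inner iteration -/

/-- The second-order error of the retraction is paired with `X - X₀`, of norm at most `2 √r`;
doubled, this is the term `4 L₂ √r` of `L̃`. -/
theorem norm_sq_retraction_sub_le {d r : ℕ} {ρ : ℝ} {R : Mat d r → Mat d r → Mat d r}
    {L₁ L₂ : ℝ} (hRc : RetractionConstants ρ R L₁ L₂) {X X₀ E : Mat d r} (hX : X ∈ St d r)
    (hX₀ : X₀ ∈ St d r) (hE : E ∈ Tan ρ X) :
    ‖R X E - X₀‖ ^ 2 ≤ ‖X - X₀‖ ^ 2 + 2 * inn (X - X₀) E + Ltil r L₁ L₂ * ‖E‖ ^ 2 := by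
  have h2 := hRc.first X hX E hE 1 zero_le_one
  have h3 := hRc.second X hX E hE 1 zero_le_one
  rw [one_smul, mul_one] at h2
  rw [one_smul, one_pow, mul_one] at h3
  have h1 : R X E - X₀ = (X - X₀) + (R X E - X) := by abel
  have h4 : ‖R X E - X‖ ^ 2 ≤ (L₁ * ‖E‖) ^ 2 := by gcongr
  have h5 : inn (X - X₀) (R X E - X - E) ≤ (2 * √(r : ℝ)) * (L₂ * ‖E‖ ^ 2) :=
    (inn_le_norm _ _).trans (mul_le_mul (norm_sub_le_of_mem_St hX hX₀) h3 (norm_nonneg _)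
      (by positivity))
  rw [inn_sub_right] at h5
  rw [h1, norm_add_sq_mat, Ltil]
  linarith

/-- One inner iteration, averaged over the mini-batches: `f + lam ‖· - X₀‖²` decreases by a multiple
of the squared norm of the gradient, up to a multiple of `‖X - X₀‖²`. -/
theorem sum_innerStep_le {d r n b : ℕ} [NeZero n] (hb : 0 < b) {ρ : ℝ} (hρ : 0 ≤ ρ)
    {R : Mat d r → Mat d r → Mat d r} (hR : IsRetraction ρ R) {L₁ L₂ : ℝ}
    (hRc : RetractionConstants ρ R L₁ L₂) {f : Fin n → Mat d r → ℝ} {L C : ℝ} (hL : 0 ≤ L)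
    (hf : LipschitzGradients f L) (hC : ∀ X ∈ St d r, ‖euclGrad (avg f) X‖ ≤ C)
    {X X₀ : Mat d r} (hX : X ∈ St d r) (hX₀ : X₀ ∈ St d r) {lam β τ Lam q : ℝ} (hlam : 0 ≤ lam)
    (hβ : 0 < β) (hτ : 0 ≤ τ) (hLam : Lam = L₂ * C + L₁ ^ 2 * L)
    (hq : q = Ltil r L₁ L₂ * L ^ 2 * τ ^ 2 / (nu ρ ^ 2 * b)) :
    ∑ B : Fin b → Fin n,
      (avg f (R X (-(τ • Dop ρ X (stochGrad f X₀ (euclGrad (avg f) X₀) X B)))) + lam *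
        ‖R X (-(τ • Dop ρ X (stochGrad f X₀ (euclGrad (avg f) X₀) X B))) - X₀‖ ^ 2)
      ≤ (n : ℝ) ^ b * (avg f X
          + (lam * (1 + 2 * β * τ + q) + Lam * τ ^ 2 * L ^ 2 / (nu ρ ^ 2 * b)) * ‖X - X₀‖ ^ 2
          - (τ * nu ρ - Lam * τ ^ 2 - lam * (Ltil r L₁ L₂ * τ ^ 2 + τ / (2 * β)))
            * ‖riemGrad ρ (avg f) X‖ ^ 2) := by
  have hν := nu_pos hρ
  have hb' : (0 : ℝ) < b := Nat.cast_pos.2 hb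
  have hC0 : 0 ≤ C := (norm_nonneg _).trans (hC X hX)
  have hLt : 0 ≤ Ltil r L₁ L₂ := by
    have := hRc.pos
    unfold Ltil; positivity
  have hLam0 : 0 ≤ Lam := by
    have := hRc.pos
    rw [hLam]; positivity
  obtain ⟨a, ha, haV, hE⟩ := exists_centered_direction hb hρ hf hX hX₀
  set g := euclGrad (avg f) X with hg
  set G := riemGrad ρ (avg f) X with hG
  set D := X - X₀ with hD
  set E : (Fin b → Fin n) → Mat d r := fun B =>
    Dop ρ X (stochGrad f X₀ (euclGrad (avg f) X₀) X B) with hEdef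
  have hdiff : ∀ X ∈ St d r, DifferentiableAt ℝ (avg f) X := fun X hX =>
    differentiableAt_avg fun i => (hf i).1 X hX
  have hpt : ∀ B : Fin b → Fin n,
      avg f (R X (-(τ • E B))) + lam * ‖R X (-(τ • E B)) - X₀‖ ^ 2
      ≤ (avg f X + lam * ‖D‖ ^ 2) - τ * inn (g + (2 * lam) • D) (E B)
        + (Lam + lam * Ltil r L₁ L₂) * τ ^ 2 * ‖E B‖ ^ 2 := fun B => by
    have hT : -(τ • E B) ∈ Tan ρ X := by
      rw [← neg_smul]; exact smul_mem_Tan (Dop_mem hX _) _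
    have h1 := descent_retraction hR hRc hdiff hL
      (fun X hX Y hY => norm_euclGrad_avg_sub_le hL hf hX hY) hC hX hT
    have h2 := mul_le_mul_of_nonneg_left (norm_sq_retraction_sub_le hRc hX hX₀ hT) hlam
    rw [norm_neg, norm_smul, mul_pow, Real.norm_eq_abs, sq_abs, inn_neg_right, inn_smul_right]
      at h1 h2
    rw [← hLam] at h1
    rw [inn_add_left, inn_smul_left]
    linarith
  refine (Finset.sum_le_sum fun B _ => hpt B).trans ?_
  have hV : ∑ i, ‖a i‖ ^ 2 ≤ n * (L ^ 2 * ‖D‖ ^ 2 / nu ρ ^ 2) := by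
    rw [← mul_div_assoc, le_div_iff₀ (by positivity), mul_comm]; exact haV
  have hsumE : ∑ B, E B = ((n : ℝ) ^ b) • G := by
    rw [← sum_direction ha G]; exact Finset.sum_congr rfl fun B _ => hE B
  have hsqE : ∑ B, ‖E B‖ ^ 2 ≤ (n : ℝ) ^ b * (‖G‖ ^ 2 + L ^ 2 * ‖D‖ ^ 2 / nu ρ ^ 2 / b) := by
    refine le_trans (le_of_eq (Finset.sum_congr rfl fun B _ => ?_))
      (sum_norm_sq_direction hb ha G hV)
    rw [← hE B]
  simp only [Finset.sum_add_distrib, Finset.sum_sub_distrib, ← Finset.mul_sum, ← inn_sum_right,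
    hsumE, inn_smul_right]
  simp only [Finset.sum_const, Finset.card_univ, Fintype.card_fun, Fintype.card_fin, nsmul_eq_mul]
  push_cast
  have hN : (0 : ℝ) ≤ (n : ℝ) ^ b := by positivity
  have hinn : τ * (nu ρ * ‖G‖ ^ 2 - lam * (2 * β * ‖D‖ ^ 2 + ‖G‖ ^ 2 / (2 * β)))
      ≤ τ * inn (g + (2 * lam) • D) G := by
    refine mul_le_mul_of_nonneg_left ?_ hτ
    rw [inn_add_left, inn_smul_left]
    have h1 : nu ρ * ‖G‖ ^ 2 ≤ inn g G := nu_mul_norm_Dop_sq_le hρ hX g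
    have h2 := (abs_le.1 (abs_inn_le_norm D G)).1
    -- Young's inequality with weight `2β`: it produces the growth factor `1 + 2βτ` of the weights
    -- and the loss `τ / (2β)` in the gain.
    have h3 : 2 * (‖D‖ * ‖G‖) ≤ 2 * β * ‖D‖ ^ 2 + ‖G‖ ^ 2 / (2 * β) := by
      have : 2 * β * ‖D‖ ^ 2 + ‖G‖ ^ 2 / (2 * β) - 2 * (‖D‖ * ‖G‖)
          = (2 * β * ‖D‖ - ‖G‖) ^ 2 / (2 * β) := by field_simp; ring
      have h4 : 0 ≤ (2 * β * ‖D‖ - ‖G‖) ^ 2 / (2 * β) := by positivity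
      linarith
    have h5 : lam * (-(2 * inn D G)) ≤ lam * (2 * β * ‖D‖ ^ 2 + ‖G‖ ^ 2 / (2 * β)) := by
      gcongr; linarith
    linarith
  have h6 : (Lam + lam * Ltil r L₁ L₂) * τ ^ 2 * ∑ B, ‖E B‖ ^ 2
      ≤ (Lam + lam * Ltil r L₁ L₂) * τ ^ 2 *
        ((n : ℝ) ^ b * (‖G‖ ^ 2 + L ^ 2 * ‖D‖ ^ 2 / nu ρ ^ 2 / b)) := by gcongr
  have h7 := mul_le_mul_of_nonneg_left hinn hN
  have h8 : (lam * (1 + 2 * β * τ + q) + Lam * τ ^ 2 * L ^ 2 / (nu ρ ^ 2 * b)) * ‖D‖ ^ 2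
      = lam * ‖D‖ ^ 2 + τ * (lam * (2 * β * ‖D‖ ^ 2)) +
        (Lam + lam * Ltil r L₁ L₂) * τ ^ 2 * (L ^ 2 * ‖D‖ ^ 2 / nu ρ ^ 2 / b) := by
    rw [hq]; field_simp; ring
  rw [h8]
  have h9 : τ / (2 * β) * ‖G‖ ^ 2 = τ * (‖G‖ ^ 2 / (2 * β)) := by ring
  have h10 : (n : ℝ) ^ b * (lam * (τ / (2 * β)) * ‖G‖ ^ 2)
      = (n : ℝ) ^ b * (τ * (lam * (‖G‖ ^ 2 / (2 * β)))) := by ring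
  linarith

/-! ### Estimates for the parameters -/

theorem one_le_Ltil {r : ℕ} {L₁ L₂ : ℝ} (h₁ : 1 ≤ L₁) (h₂ : 0 < L₂) : 1 ≤ Ltil r L₁ L₂ := by
  have h1 : 1 ≤ L₁ ^ 2 := one_le_pow₀ h₁
  have h2 : 0 ≤ 4 * L₂ * √(r : ℝ) := by positivity
  unfold Ltil; linarith

theorem Kpar_pos {μ κ : ℝ} (hκ : 0 < κ) (n : ℕ) [NeZero n] : 0 < Kpar μ κ n := by
  have : (0 : ℝ) < n := Nat.cast_pos.2 (NeZero.pos n)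
  exact Nat.ceil_pos.2 (by positivity)

theorem Bpar_pos {μ : ℝ} {K : ℕ} (hK : 0 < K) : 0 < Bpar μ K := by
  have : (0 : ℝ) < K := Nat.cast_pos.2 hK
  exact Nat.ceil_pos.2 (by positivity)

theorem betaPar_pos {r : ℕ} {ρ L L₁ L₂ μ : ℝ} (hρ : 0 ≤ ρ) (hL : 0 < L) (h₁ : 1 ≤ L₁) (h₂ : 0 < L₂)
    {K : ℕ} (hK : 0 < K) : 0 < betaPar r ρ L L₁ L₂ μ K := by
  have : (0 : ℝ) < K := Nat.cast_pos.2 hK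
  have := nu_pos hρ
  have : 0 < Ltil r L₁ L₂ := one_pos.trans_le (one_le_Ltil h₁ h₂)
  unfold betaPar; positivity

theorem tauPar_pos {r : ℕ} {ρ L L₁ L₂ μ c : ℝ} (hρ : 0 ≤ ρ) (hL : 0 < L) (h₁ : 1 ≤ L₁) (h₂ : 0 < L₂)
    (hc : 0 < c) {K : ℕ} (hK : 0 < K) : 0 < tauPar r ρ L L₁ L₂ μ c K := by
  have : (0 : ℝ) < K := Nat.cast_pos.2 hK
  have := nu_pos hρ
  have : 0 < Ltil r L₁ L₂ := one_pos.trans_le (one_le_Ltil h₁ h₂)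
  unfold tauPar; positivity

theorem betaPar_mul_tauPar {r : ℕ} {ρ L L₁ L₂ μ c : ℝ} (hρ : 0 ≤ ρ) (hL : 0 < L) (h₁ : 1 ≤ L₁)
    (h₂ : 0 < L₂) {K : ℕ} (hK : 0 < K) :
    betaPar r ρ L L₁ L₂ μ K * tauPar r ρ L L₁ L₂ μ c K = c / K := by
  have hK' : (0 : ℝ) < K := Nat.cast_pos.2 hK
  have := nu_pos hρ
  have : 0 < Ltil r L₁ L₂ := one_pos.trans_le (one_le_Ltil h₁ h₂)
  have : 0 < √(Ltil r L₁ L₂) := Real.sqrt_pos.2 this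
  unfold betaPar tauPar
  rw [Real.rpow_sub_one hK'.ne', Real.rpow_neg hK'.le]
  have : (0 : ℝ) < (K : ℝ) ^ μ := by positivity
  field_simp

/-- The quantity `q = L̃ L² τ² / (ν² |B|)` for the chosen parameters. -/
theorem variance_ratio_le {r : ℕ} {ρ L L₁ L₂ μ c : ℝ} (hρ : 0 ≤ ρ) (hL : 0 < L) (h₁ : 1 ≤ L₁)
    (h₂ : 0 < L₂) {K : ℕ} (hK : 0 < K) :
    Ltil r L₁ L₂ * L ^ 2 * tauPar r ρ L L₁ L₂ μ c K ^ 2 / (nu ρ ^ 2 * Bpar μ K)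
      ≤ c ^ 2 * (K : ℝ) ^ μ / (K : ℝ) ^ 2 := by
  have hK' : (0 : ℝ) < K := Nat.cast_pos.2 hK
  have hν := nu_pos hρ
  have hLt : 0 < Ltil r L₁ L₂ := one_pos.trans_le (one_le_Ltil h₁ h₂)
  have hs : 0 < √(Ltil r L₁ L₂) := Real.sqrt_pos.2 hLt
  have hm : (0 : ℝ) < (K : ℝ) ^ μ := by positivity
  have hb : (K : ℝ) ^ 2 / ((K : ℝ) ^ μ) ^ 3 ≤ Bpar μ K := by
    have h1 : (K : ℝ) ^ (2 - 3 * μ) ≤ Bpar μ K := Nat.le_ceil _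
    rw [Real.rpow_sub hK', mul_comm 3 μ, Real.rpow_mul hK'.le] at h1
    exact_mod_cast h1
  have hb0 : (0 : ℝ) < Bpar μ K := Nat.cast_pos.2 (Bpar_pos hK)
  have h2 : Ltil r L₁ L₂ * L ^ 2 * tauPar r ρ L L₁ L₂ μ c K ^ 2 / (nu ρ ^ 2 * Bpar μ K)
      = c ^ 2 / ((K : ℝ) ^ μ) ^ 2 / Bpar μ K := by
    unfold tauPar
    rw [Real.rpow_neg hK'.le, mul_pow, div_pow, mul_pow, mul_pow, Real.sq_sqrt hLt.le, inv_pow]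
    field_simp
  rw [h2, div_le_iff₀ hb0]
  calc c ^ 2 / ((K : ℝ) ^ μ) ^ 2
      = c ^ 2 * (K : ℝ) ^ μ / (K : ℝ) ^ 2 * ((K : ℝ) ^ 2 / ((K : ℝ) ^ μ) ^ 3) := by field_simp
    _ ≤ _ := by gcongr

theorem Gam_nonneg {z : ℝ} (hz : 0 ≤ z) (i : ℕ) : 0 ≤ Gam z i :=
  div_nonneg (sub_nonneg.2 (one_le_pow₀ (by linarith))) hz

/-- Growth of the weights: `q Γ(2c/K + q, i) ≤ (c m / (2K)) (exp(c² + 2c) - 1)` for `i ≤ K`, when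
`q ≤ c² m / K²` with `m ≤ K`. -/
theorem mul_Gam_le {c q m : ℝ} (hc : 0 < c) (hq : 0 ≤ q) {K i : ℕ} (hK : 0 < K) (hi : i ≤ K)
    (hm : m ≤ K) (hqm : q ≤ c ^ 2 * m / (K : ℝ) ^ 2) :
    q * Gam (2 * (c / K) + q) i ≤ c * m / (2 * K) * (Real.exp (c ^ 2 + 2 * c) - 1) := by
  have hK' : (0 : ℝ) < K := Nat.cast_pos.2 hK
  set z := 2 * (c / K) + q with hz
  have hz1 : 0 < 2 * (c / K) := by positivity
  have hz0 : 0 < z := by linarith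
  have hqK : q ≤ c ^ 2 / K := by
    refine hqm.trans ?_
    calc c ^ 2 * m / (K : ℝ) ^ 2 ≤ c ^ 2 * K / (K : ℝ) ^ 2 := by gcongr
      _ = _ := by field_simp
  have hzK : (K : ℝ) * z ≤ c ^ 2 + 2 * c := by
    have h1 : (K : ℝ) * q ≤ K * (c ^ 2 / K) := by gcongr
    have h2 : (K : ℝ) * (c ^ 2 / K) = c ^ 2 := by field_simp
    have h3 : (K : ℝ) * (2 * (c / K)) = 2 * c := by field_simp
    rw [hz, mul_add]; linarith
  have hpow : (1 + z) ^ (i - 1) ≤ Real.exp (c ^ 2 + 2 * c) := by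
    calc (1 + z) ^ (i - 1) ≤ (1 + z) ^ K := pow_le_pow_right₀ (by linarith) (by omega)
      _ ≤ Real.exp z ^ K := by
          have := Real.add_one_le_exp z
          gcongr; linarith
      _ = Real.exp (K * z) := (Real.exp_nat_mul z K).symm
      _ ≤ _ := Real.exp_le_exp.2 hzK
  -- Dropping `q` from `z` keeps the factor `m / K`, which cancels later against the `1 / m` in the
  -- step size.
  have hratio : q / z ≤ c * m / (2 * K) := by
    calc q / z ≤ q / (2 * (c / K)) := by gcongr; linarith
      _ ≤ (c ^ 2 * m / (K : ℝ) ^ 2) / (2 * (c / K)) := by gcongr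
      _ = _ := by field_simp
  have h1 : 1 ≤ (1 + z) ^ (i - 1) := one_le_pow₀ (by linarith)
  calc q * Gam z i = q / z * ((1 + z) ^ (i - 1) - 1) := by unfold Gam; ring
    _ ≤ c * m / (2 * K) * (Real.exp (c ^ 2 + 2 * c) - 1) := by
        refine mul_le_mul hratio (by linarith) (by linarith) ?_
        exact (div_nonneg hq hz0.le).trans hratio

/-- The common form of the estimates of the weights. -/
theorem weight_bracket_le {ν T c q m A Lt Lh : ℝ} {K i : ℕ} (hν : 0 ≤ ν) (hc : 0 < c) (hc1 : c ≤ 1)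
    (hA : 0 ≤ A)
    (hLt : 1 ≤ Lt) (hq : 0 ≤ q) (hK : 0 < K) (hi : i ≤ K) (hm1 : 1 ≤ m) (hm : m ≤ K)
    (hqm : q ≤ c ^ 2 * m / (K : ℝ) ^ 2)
    (hT : Lh * T ≤ ν * Real.exp (-(c ^ 2 + 2 * c)) / m) :
    Lh * T * (1 + (1 + A / (Lt * (c / K))) * q * Gam (2 * (c / K) + q) i)
      ≤ ν * (Real.exp (-(c ^ 2 + 2 * c)) + (1 + A) / 2 * (1 - Real.exp (-(c ^ 2 + 2 * c)))) := by
  have hK' : (0 : ℝ) < K := Nat.cast_pos.2 hK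
  have hK1 : (1 : ℝ) ≤ K := by exact_mod_cast hK
  have hG := mul_Gam_le hc hq hK hi hm hqm
  set x := c ^ 2 + 2 * c with hx
  have hx0 : 0 ≤ x := by positivity
  have he1 : 0 ≤ Real.exp x - 1 := by linarith [Real.one_le_exp hx0]
  have hmul : Real.exp (-x) * (Real.exp x - 1) = 1 - Real.exp (-x) := by
    rw [mul_sub, ← Real.exp_add]; simp
  have h1 : (1 + A / (Lt * (c / K))) * q * Gam (2 * (c / K) + q) i
      ≤ m * ((1 + A) / 2) * (Real.exp x - 1) := by
    calc (1 + A / (Lt * (c / K))) * q * Gam (2 * (c / K) + q) i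
        = (1 + A / (Lt * (c / K))) * (q * Gam (2 * (c / K) + q) i) := by ring
      _ ≤ (1 + A / (1 * (c / K))) * (c * m / (2 * K) * (Real.exp x - 1)) := by
          gcongr
          exact mul_nonneg hq (Gam_nonneg (by positivity) i)
      _ = (c / K + A) / 2 * m * (Real.exp x - 1) := by field_simp
      _ ≤ (1 + A) / 2 * m * (Real.exp x - 1) := by
          gcongr
          rw [div_le_one hK']; linarith
      _ = _ := by ring
  calc Lh * T * (1 + (1 + A / (Lt * (c / K))) * q * Gam (2 * (c / K) + q) i)
      -- The assumption on `Lh * T` supplies `exp (-x) / m`, which compensates both the factor `m`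
      -- and the exponential growth of the weights.
      ≤ ν * Real.exp (-x) / m * (1 + m * ((1 + A) / 2) * (Real.exp x - 1)) := by
        refine mul_le_mul hT (by linarith) ?_ (by positivity)
        have := mul_nonneg hq (Gam_nonneg (by positivity : 0 ≤ 2 * (c / K) + q) i)
        have : 0 ≤ (1 + A / (Lt * (c / K))) * (q * Gam (2 * (c / K) + q) i) := by positivity
        rw [mul_assoc (1 + A / (Lt * (c / K)))]
        linarith
    _ = ν * (Real.exp (-x) / m + (1 + A) / 2 * (Real.exp (-x) * (Real.exp x - 1))) := by
        field_simp
    _ ≤ _ := by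
        rw [hmul]
        gcongr
        exact div_le_self (Real.exp_nonneg _) hm1

theorem Lhat_mul_tauPar_le {r : ℕ} {ρ L L₁ L₂ C μ c : ℝ} (hρ : 0 ≤ ρ)
    {K : ℕ} (hK : 0 < K)
    (hcond : Lhat L L₁ L₂ C / (√(Ltil r L₁ L₂) * L) * Real.exp (c ^ 2 + 2 * c) * c ≤ 1) :
    Lhat L L₁ L₂ C * tauPar r ρ L L₁ L₂ μ c K
      ≤ nu ρ * Real.exp (-(c ^ 2 + 2 * c)) / (K : ℝ) ^ μ := by
  have hK' : (0 : ℝ) < K := Nat.cast_pos.2 hK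
  have hν := nu_pos hρ
  have he := Real.exp_pos (c ^ 2 + 2 * c)
  have hm : (0 : ℝ) < (K : ℝ) ^ μ := by positivity
  have h1 : Lhat L L₁ L₂ C / (√(Ltil r L₁ L₂) * L) * c ≤ Real.exp (-(c ^ 2 + 2 * c)) := by
    rw [Real.exp_neg, ← one_div, le_div_iff₀ he]; linarith
  unfold tauPar
  rw [Real.rpow_neg hK'.le]
  calc Lhat L L₁ L₂ C * (c * nu ρ / (√(Ltil r L₁ L₂) * L) * ((K : ℝ) ^ μ)⁻¹)
      = nu ρ * (Lhat L L₁ L₂ C / (√(Ltil r L₁ L₂) * L) * c) / (K : ℝ) ^ μ := by ring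
    _ ≤ _ := by gcongr

/-- The range of the parameters. -/
structure Admissible (r : ℕ) (ρ L L₁ L₂ C μ κ c : ℝ) : Prop where
  ρ_nonneg : 0 ≤ ρ
  L_pos : 0 < L
  one_le_L₁ : 1 ≤ L₁
  L₂_pos : 0 < L₂
  C_pos : 0 < C
  μ_nonneg : 0 ≤ μ
  μ_le : μ ≤ 2 / 3
  κ_pos : 0 < κ
  c_pos : 0 < c
  c_lt_one : c < 1
  cond : Lhat L L₁ L₂ C / (√(Ltil r L₁ L₂) * L) * Real.exp (c ^ 2 + 2 * c) * c ≤ 1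

section

variable {r : ℕ} {ρ L L₁ L₂ C μ κ c : ℝ}

theorem Admissible.rpow_bounds (h : Admissible r ρ L L₁ L₂ C μ κ c) {K : ℕ} (hK : 0 < K) :
    1 ≤ (K : ℝ) ^ μ ∧ (K : ℝ) ^ μ ≤ K := by
  have hK1 : (1 : ℝ) ≤ K := by exact_mod_cast hK
  refine ⟨Real.one_le_rpow hK1 h.μ_nonneg, ?_⟩
  conv_rhs => rw [← Real.rpow_one (K : ℝ)]
  exact Real.rpow_le_rpow_of_exponent_le hK1 (by linarith [h.μ_le])

/-- Used twice: `A = 2` is the expression in `Δ_k`, and `A = 1/2` is the loss in the analysis of the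
potential. -/
theorem Admissible.bracket_le (h : Admissible r ρ L L₁ L₂ C μ κ c) {K i : ℕ} (hK : 0 < K)
    (hi : i ≤ K) {A Lh : ℝ} (hA : 0 ≤ A) (hLh : Lh ≤ Lhat L L₁ L₂ C) :
    Lh * tauPar r ρ L L₁ L₂ μ c K *
      (1 + (1 + A / (Ltil r L₁ L₂ * (betaPar r ρ L L₁ L₂ μ K * tauPar r ρ L L₁ L₂ μ c K))) *
        (Ltil r L₁ L₂ * L ^ 2 * tauPar r ρ L L₁ L₂ μ c K ^ 2 / (nu ρ ^ 2 * Bpar μ K)) *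
        Gam (2 * (betaPar r ρ L L₁ L₂ μ K * tauPar r ρ L L₁ L₂ μ c K) +
          Ltil r L₁ L₂ * L ^ 2 * tauPar r ρ L L₁ L₂ μ c K ^ 2 / (nu ρ ^ 2 * Bpar μ K)) i)
      ≤ nu ρ * (Real.exp (-(c ^ 2 + 2 * c)) + (1 + A) / 2 * (1 - Real.exp (-(c ^ 2 + 2 * c)))) := by
  have hτ := tauPar_pos (r := r) (μ := μ) h.ρ_nonneg h.L_pos h.one_le_L₁ h.L₂_pos h.c_pos hK
  have hLt := one_le_Ltil (r := r) h.one_le_L₁ h.L₂_pos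
  have hν := nu_pos h.ρ_nonneg
  rw [betaPar_mul_tauPar h.ρ_nonneg h.L_pos h.one_le_L₁ h.L₂_pos hK]
  refine weight_bracket_le hν.le h.c_pos h.c_lt_one.le hA hLt ?_ hK hi (h.rpow_bounds hK).1
    (h.rpow_bounds hK).2 (variance_ratio_le h.ρ_nonneg h.L_pos h.one_le_L₁ h.L₂_pos hK)
    ?_
  · have := h.L_pos
    positivity
  · exact (mul_le_mul_of_nonneg_right hLh hτ.le).trans (Lhat_mul_tauPar_le h.ρ_nonneg hK h.cond)

theorem Admissible.Lhat_nonneg (h : Admissible r ρ L L₁ L₂ C μ κ c) : 0 ≤ Lhat L L₁ L₂ C := by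
  have := h.L_pos
  have := h.L₂_pos
  have := h.C_pos
  unfold Lhat; positivity

/-- For `A = 2` the bracket is at most `3ν/2`, and `Δ_k` subtracts half of it. Only this
comparability of the `Δ_k` is needed; the descent comes from `stepGain`. -/
theorem Admissible.DeltaPar_bounds (h : Admissible r ρ L L₁ L₂ C μ κ c) (n : ℕ) [NeZero n] (k : ℕ) :
    tauPar r ρ L L₁ L₂ μ c (Kpar μ κ n) * nu ρ / 4 ≤ DeltaPar r ρ L L₁ L₂ C μ κ c n k ∧
      DeltaPar r ρ L L₁ L₂ C μ κ c n k ≤ tauPar r ρ L L₁ L₂ μ c (Kpar μ κ n) * nu ρ := by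
  have hK : 0 < Kpar μ κ n := Kpar_pos h.κ_pos n
  set K := Kpar μ κ n with hKdef
  have hτ := tauPar_pos (r := r) (μ := μ) h.ρ_nonneg h.L_pos h.one_le_L₁ h.L₂_pos h.c_pos hK
  have hβ := betaPar_pos (r := r) (μ := μ) h.ρ_nonneg h.L_pos h.one_le_L₁ h.L₂_pos hK
  have hLt := one_le_Ltil (r := r) h.one_le_L₁ h.L₂_pos
  have hν := nu_pos h.ρ_nonneg
  have hLpos := h.L_pos
  have hb := h.bracket_le hK (Nat.sub_le K k) (A := 2) (by norm_num) le_rfl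
  have hLh := h.Lhat_nonneg
  unfold DeltaPar Delta
  rw [← hKdef]
  set τ := tauPar r ρ L L₁ L₂ μ c K
  set β := betaPar r ρ L L₁ L₂ μ K
  set q := Ltil r L₁ L₂ * L ^ 2 * τ ^ 2 / (nu ρ ^ 2 * Bpar μ K) with hq
  have hq0 : 0 ≤ q := by positivity
  have hG : 0 ≤ Gam (2 * β * τ + q) (K - k) := Gam_nonneg (by positivity) _
  have he0 := Real.exp_pos (-(c ^ 2 + 2 * c))
  have he1 : Real.exp (-(c ^ 2 + 2 * c)) ≤ 1 := Real.exp_le_one_iff.2 (by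
    have := h.c_pos
    have : 0 ≤ c ^ 2 + 2 * c := by positivity
    linarith)
  rw [← mul_assoc, ← mul_assoc] at hb
  set T := 1 + (1 + 2 / (Ltil r L₁ L₂ * β * τ)) * q * Gam (2 * β * τ + q) (K - k) with hT
  have hT0 : 0 ≤ T := by positivity
  have h1 : Lhat L L₁ L₂ C * τ * T ≤ nu ρ * (3 / 2) := by
    refine hb.trans ?_
    gcongr
    linarith
  constructor
  · rw [mul_div_assoc]
    refine mul_le_mul_of_nonneg_left ?_ hτ.le
    linarith
  · refine mul_le_mul_of_nonneg_left ?_ hτ.le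
    have : 0 ≤ Lhat L L₁ L₂ C * τ / 2 * T := by positivity
    linarith

/-- The decrease per inner iteration that the analysis yields. -/
noncomputable def stepGain (ρ c τ : ℝ) : ℝ := τ * nu ρ * ((1 - Real.exp (-(c ^ 2 + 2 * c))) / 4)

/-- Factoring `τ` out of the loss leaves the bracket with `A = 1/2`, at most `ν (e + 3/4 (1 - e))`
for `e = exp (-(c² + 2c))`. The remainder is `ν (1 - e) / 4`. -/
theorem Admissible.stepGain_le (h : Admissible r ρ L L₁ L₂ C μ κ c) {K i : ℕ} (hK : 0 < K)
    (hi : i ≤ K) {Lam τ β q z : ℝ} (hLam : Lam = L₂ * C + L₁ ^ 2 * L)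
    (hτ : τ = tauPar r ρ L L₁ L₂ μ c K) (hβ : β = betaPar r ρ L L₁ L₂ μ K)
    (hq : q = Ltil r L₁ L₂ * L ^ 2 * τ ^ 2 / (nu ρ ^ 2 * Bpar μ K)) (hz : z = 2 * β * τ + q) :
    stepGain ρ c τ ≤ τ * nu ρ - Lam * τ ^ 2 -
      (Lam * τ ^ 2 * L ^ 2 / (nu ρ ^ 2 * Bpar μ K)) * Gam z i *
        (Ltil r L₁ L₂ * τ ^ 2 + τ / (2 * β)) := by
  have hτ0 := tauPar_pos (r := r) (μ := μ) h.ρ_nonneg h.L_pos h.one_le_L₁ h.L₂_pos h.c_pos hK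
  have hβ0 := betaPar_pos (r := r) (μ := μ) h.ρ_nonneg h.L_pos h.one_le_L₁ h.L₂_pos hK
  have hLt := one_le_Ltil (r := r) h.one_le_L₁ h.L₂_pos
  have hν := nu_pos h.ρ_nonneg
  have hLpos := h.L_pos
  have := h.L₂_pos
  have := h.C_pos
  have hLamle : Lam ≤ Lhat L L₁ L₂ C := by
    have : 0 < L₂ * C := by positivity
    rw [hLam, Lhat]; linarith
  have hb := h.bracket_le hK hi (A := 1 / 2) (by norm_num) hLamle
  rw [← hτ] at hb hτ0
  rw [← hβ] at hb hβ0
  rw [← hq, ← mul_assoc 2 β τ, ← hz] at hb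
  have hB : (0 : ℝ) < Bpar μ K := Nat.cast_pos.2 (Bpar_pos hK)
  have h1 : (Lam * τ ^ 2 * L ^ 2 / (nu ρ ^ 2 * Bpar μ K)) * Gam z i *
        (Ltil r L₁ L₂ * τ ^ 2 + τ / (2 * β))
      = τ * (Lam * τ * ((1 + 1 / 2 / (Ltil r L₁ L₂ * (β * τ))) * q * Gam z i)) := by
    have : Ltil r L₁ L₂ ≠ 0 := by linarith
    rw [hq]; field_simp
  have h2 := mul_le_mul_of_nonneg_left hb hτ0.le
  rw [h1, stepGain]
  linarith

theorem stepGain_pos (hρ : 0 ≤ ρ) (hc : 0 < c) {τ : ℝ} (hτ : 0 < τ) : 0 < stepGain ρ c τ := by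
  have := nu_pos hρ
  have h1 : Real.exp (-(c ^ 2 + 2 * c)) < 1 := Real.exp_lt_one_iff.2 (by
    have : 0 < c ^ 2 + 2 * c := by positivity
    linarith)
  have : 0 < 1 - Real.exp (-(c ^ 2 + 2 * c)) := by linarith
  unfold stepGain; positivity

end

/-! ### Expectations -/

theorem expect_pure {α : Type} (a : α) (g : α → ℝ≥0∞) : expect (PMF.pure a) g = g a := by
  classical
  rw [expect, tsum_eq_single a fun b hb => by rw [PMF.pure_apply, if_neg hb, zero_mul]]
  simp

theorem expect_bind {α γ : Type} (P : PMF α) (Q : α → PMF γ) (g : γ → ℝ≥0∞) :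
    expect (P.bind Q) g = expect P fun a => expect (Q a) g := by
  simp only [expect, PMF.bind_apply, ← ENNReal.tsum_mul_right, ← ENNReal.tsum_mul_left]
  rw [ENNReal.tsum_comm]
  simp only [mul_assoc]

theorem expect_mono {α : Type} (P : PMF α) {g h : α → ℝ≥0∞} (hgh : ∀ a ∈ P.support, g a ≤ h a) :
    expect P g ≤ expect P h := by
  refine ENNReal.tsum_le_tsum fun a => ?_
  by_cases ha : a ∈ P.support
  · gcongr; exact hgh a ha
  · rw [PMF.mem_support_iff, not_not] at ha
    simp [ha]

theorem expect_const_add {α : Type} (P : PMF α) (g : α → ℝ≥0∞) (C : ℝ≥0∞) :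
    expect P (fun a => C + g a) = C + expect P g := by
  simp only [expect, mul_add, ENNReal.tsum_add, ENNReal.tsum_mul_right, P.tsum_coe, one_mul]

theorem expect_const_mul {α : Type} (P : PMF α) (g : α → ℝ≥0∞) (C : ℝ≥0∞) :
    expect P (fun a => C * g a) = C * expect P g := by
  simp only [expect, ← ENNReal.tsum_mul_left]
  exact tsum_congr fun a => by ring

theorem expect_uniform {α : Type} [Fintype α] [Nonempty α] (g : α → ℝ) (hg : ∀ a, 0 ≤ g a) :
    expect (PMF.uniformOfFintype α) (fun a => ENNReal.ofReal (g a))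
      = ENNReal.ofReal (1 / (Fintype.card α : ℝ) * ∑ a, g a) := by
  have hcard : (0 : ℝ) < Fintype.card α := Nat.cast_pos.2 Fintype.card_pos
  rw [expect, tsum_fintype, ENNReal.ofReal_mul (by positivity),
    ENNReal.ofReal_sum_of_nonneg fun a _ => hg a, Finset.mul_sum, one_div,
    ENNReal.ofReal_inv_of_pos hcard, ENNReal.ofReal_natCast]
  simp [PMF.uniformOfFintype_apply]

/-! ### Runs of the algorithm -/

/-- The point that follows `X` in an epoch started at `X₀`, for the mini-batch `B`. -/
noncomputable def nextPoint {d r n : ℕ} (A : Input d r n) (s : ℕ) (X₀ X : Mat d r) (B : Fin A.b → Fin n) :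
    Mat d r :=
  A.R X (-(A.τ s • Dop A.ρ X (stochGrad A.f X₀ (euclGrad (avg A.f) X₀) X B)))

section

variable {d r n : ℕ} [NeZero n] {A : Input d r n}

theorem mem_support_innerStep {s k : ℕ} {g₀ : Mat d r} {σ e : EpochState d r}
    (he : e ∈ (innerStep A s g₀ k σ).support) : ∃ B : Fin A.b → Fin n, e =
      { iter := Function.update σ.iter (k + 1)
          (A.R (σ.iter k)
            (-(A.τ s • Dop A.ρ (σ.iter k) (stochGrad A.f (σ.iter 0) g₀ (σ.iter k) B))))
        ifo := σ.ifo + 2 * A.b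
        ro := σ.ro + 1 } := by
  rw [innerStep, PMF.mem_support_bind_iff] at he
  obtain ⟨B, -, hB⟩ := he
  exact ⟨B, (PMF.mem_support_pure_iff _ _).1 hB⟩

theorem innerLoop_support {s : ℕ}
    (hmem : ∀ X ∈ St d r, ∀ X₀ ∈ St d r, ∀ B, nextPoint A s X₀ X B ∈ St d r)
    {σ : EpochState d r} (hσ : ∀ j, σ.iter j ∈ St d r) (k : ℕ) :
    ∀ e ∈ (innerLoop A s (euclGrad (avg A.f) (σ.iter 0)) k σ).support,
      e.iter 0 = σ.iter 0 ∧ (∀ j, e.iter j ∈ St d r) ∧ e.ifo = σ.ifo + k * (2 * A.b) ∧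
        e.ro = σ.ro + k := by
  induction k with
  | zero =>
    intro e he
    rw [innerLoop, PMF.mem_support_pure_iff] at he
    subst he
    exact ⟨rfl, hσ, by simp, rfl⟩
  | succ k ih =>
    intro e he
    rw [innerLoop, PMF.mem_support_bind_iff] at he
    obtain ⟨e', he', hstep⟩ := he
    obtain ⟨h0, hSt, hifo, hro⟩ := ih e' he'
    obtain ⟨B, rfl⟩ := mem_support_innerStep hstep
    refine ⟨?_, fun j => ?_, ?_, ?_⟩
    · simp only [Function.update_of_ne (Nat.succ_ne_zero k).symm, h0]
    · simp only [Function.update_apply]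
      split_ifs
      · rw [← h0]; exact hmem _ (hSt k) _ (hSt 0) B
      · exact hSt j
    · simp only [hifo]; ring
    · simp only [hro]; ring

/-- Potentials `V k X X₀`, `k ≤ K`, that decrease in expectation along the inner iterations of epoch
`s`, by at least `a ‖grad f‖²`. -/
structure IsPotential (A : Input d r n) (s : ℕ) (a : ℝ) (V : ℕ → Mat d r → Mat d r → ℝ) : Prop where
  mem : ∀ X ∈ St d r, ∀ X₀ ∈ St d r, ∀ B, nextPoint A s X₀ X B ∈ St d r
  gain_nonneg : 0 ≤ a
  nonneg : ∀ k ≤ A.K, ∀ X ∈ St d r, ∀ X₀ ∈ St d r, 0 ≤ V k X X₀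
  step : ∀ k < A.K, ∀ X ∈ St d r, ∀ X₀ ∈ St d r,
    1 / ((n : ℝ) ^ A.b) * ∑ B, V (k + 1) (nextPoint A s X₀ X B) X₀
      + a * ‖riemGrad A.ρ (avg A.f) X‖ ^ 2 ≤ V k X X₀

/-- The potential of an epoch together with the gradients collected so far. -/
noncomputable def epochPotential (A : Input d r n) (a : ℝ) (V : ℕ → Mat d r → Mat d r → ℝ) (k : ℕ)
    (σ : EpochState d r) : ℝ :=
  a * ∑ j ∈ Finset.range k, ‖riemGrad A.ρ (avg A.f) (σ.iter j)‖ ^ 2 + V k (σ.iter k) (σ.iter 0)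

theorem IsPotential.expect_innerStep_le {s : ℕ} {a : ℝ} {V : ℕ → Mat d r → Mat d r → ℝ}
    (hV : IsPotential A s a V) {k : ℕ} (hk : k < A.K) {σ : EpochState d r}
    (hσ : ∀ j, σ.iter j ∈ St d r) :
    expect (innerStep A s (euclGrad (avg A.f) (σ.iter 0)) k σ)
        (fun e => ENNReal.ofReal (epochPotential A a V (k + 1) e))
      ≤ ENNReal.ofReal (epochPotential A a V k σ) := by
  have ha := hV.gain_nonneg
  obtain ⟨G, hG⟩ : ∃ G, G = ∑ j ∈ Finset.range (k + 1), ‖riemGrad A.ρ (avg A.f) (σ.iter j)‖ ^ 2 :=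
    ⟨_, rfl⟩
  have hG0 : 0 ≤ G := hG ▸ Finset.sum_nonneg fun _ _ => sq_nonneg _
  have h1 : ∀ B : Fin A.b → Fin n, epochPotential A a V (k + 1)
      { iter := Function.update σ.iter (k + 1) (nextPoint A s (σ.iter 0) (σ.iter k) B)
        ifo := σ.ifo + 2 * A.b
        ro := σ.ro + 1 } = a * G + V (k + 1) (nextPoint A s (σ.iter 0) (σ.iter k) B) (σ.iter 0) := by
    intro B
    -- The step writes entry `k + 1` only, so the gradients collected up to index `k` do not depend
    -- on the mini-batch.
    have hupd : ∀ j ∈ Finset.range (k + 1), Function.update σ.iter (k + 1)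
        (nextPoint A s (σ.iter 0) (σ.iter k) B) j = σ.iter j := fun j hj =>
      Function.update_of_ne (Finset.mem_range.1 hj).ne _ _
    have h2 : ∑ j ∈ Finset.range (k + 1), ‖riemGrad A.ρ (avg A.f) (Function.update σ.iter (k + 1)
        (nextPoint A s (σ.iter 0) (σ.iter k) B) j)‖ ^ 2 = G := by
      rw [hG]
      exact Finset.sum_congr rfl fun j hj => by rw [hupd j hj]
    rw [epochPotential, h2]
    simp only [Function.update_self, Function.update_of_ne (Nat.succ_ne_zero k).symm]
  have hn : (0 : ℝ) < (n : ℝ) ^ A.b := by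
    have : (0 : ℝ) < n := Nat.cast_pos.2 (NeZero.pos n)
    positivity
  rw [innerStep, expect_bind]
  simp only [expect_pure]
  have h2 : ∀ B : Fin A.b → Fin n, 0 ≤ a * G + V (k + 1) (nextPoint A s (σ.iter 0) (σ.iter k) B) (σ.iter 0) :=
    fun B => add_nonneg (by positivity) (hV.nonneg _ hk _ (hV.mem _ (hσ k) _ (hσ 0) B) _ (hσ 0))
  have h3 := expect_uniform _ h2
  simp only [← h1] at h3
  refine h3.trans_le (ENNReal.ofReal_le_ofReal ?_)
  simp only [h1, Finset.sum_add_distrib, Finset.sum_const, Finset.card_univ, Fintype.card_fun,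
    Fintype.card_fin, nsmul_eq_mul]
  have h4 := hV.step k hk _ (hσ k) _ (hσ 0)
  push_cast
  rw [mul_add, ← mul_assoc, one_div_mul_cancel hn.ne', one_mul, hG, Finset.sum_range_succ,
    epochPotential, mul_add]
  linarith

theorem IsPotential.expect_innerLoop_le {s : ℕ} {a : ℝ} {V : ℕ → Mat d r → Mat d r → ℝ}
    (hV : IsPotential A s a V) {σ : EpochState d r} (hσ : ∀ j, σ.iter j ∈ St d r) {k : ℕ}
    (hk : k ≤ A.K) :
    expect (innerLoop A s (euclGrad (avg A.f) (σ.iter 0)) k σ)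
        (fun e => ENNReal.ofReal (epochPotential A a V k e))
      ≤ ENNReal.ofReal (V 0 (σ.iter 0) (σ.iter 0)) := by
  induction k with
  | zero => rw [innerLoop, expect_pure]; simp [epochPotential]
  | succ k ih =>
    rw [innerLoop, expect_bind]
    refine le_trans (expect_mono _ fun e he => ?_) (ih (Nat.le_of_succ_le hk))
    obtain ⟨h0, hSt, -, -⟩ := innerLoop_support hV.mem hσ k e he
    rw [← h0]
    exact hV.expect_innerStep_le hk hSt

/-- The value `h` at the current point together with the gradients at the selected points. -/
noncomputable def runPotential (A : Input d r n) (a : ℝ) (h : Mat d r → ℝ) (s : ℕ)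
    (σ : OuterState d r) : ℝ :=
  a * ∑ j ∈ Finset.range s, ‖riemGrad A.ρ (avg A.f) (σ.sel j)‖ ^ 2 + h σ.X

/-- The zero mass at `K` matters: the potential controls the gradients at the iterates `0, …, K - 1`
only. -/
theorem expect_selection_le {K : ℕ} {p : PMF (Fin (K + 1))} {w : ℝ} (hw : 0 ≤ w)
    (hp : ∀ k : Fin K, p k.castSucc ≤ ENNReal.ofReal w) (hpK : p (Fin.last K) = 0) (g : ℕ → ℝ)
    (hg : ∀ k, 0 ≤ g k) :
    expect p (fun k => ENNReal.ofReal (g k)) ≤ ENNReal.ofReal (w * ∑ k ∈ Finset.range K, g k) := by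
  rw [expect, tsum_fintype, Fin.sum_univ_castSucc, hpK, zero_mul, add_zero, Finset.mul_sum,
    ← Fin.sum_univ_eq_sum_range (fun k => w * g k) K,
    ENNReal.ofReal_sum_of_nonneg fun (k : Fin K) _ => mul_nonneg hw (hg k)]
  refine Finset.sum_le_sum fun k _ => ?_
  rw [ENNReal.ofReal_mul hw, Fin.val_castSucc]
  gcongr
  exact hp k

/-- An inner step gains `w a ‖grad f‖²`, and each iterate is selected with probability at most `w`;
the gains of the epoch thus pay for `a ‖grad f(X_r^s)‖²`. Since the potential is `h` at both ends,
the bound chains over epochs. -/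
theorem IsPotential.expect_epoch_le {s : ℕ} {a w : ℝ} {V : ℕ → Mat d r → Mat d r → ℝ}
    (hV : IsPotential A s (w * a) V) (ha : 0 ≤ a) (hw : 0 ≤ w) {h : Mat d r → ℝ}
    (hV0 : ∀ X, V 0 X X = h X) (hVK : ∀ X X₀, V A.K X X₀ = h X) (hh : ∀ X ∈ St d r, 0 ≤ h X)
    (hp : ∀ k : Fin A.K, A.p s k.castSucc ≤ ENNReal.ofReal w) (hpK : A.p s (Fin.last A.K) = 0)
    {σ : OuterState d r} (hσ : σ.X ∈ St d r) :
    expect (epoch A s σ) (fun σ' => ENNReal.ofReal (runPotential A a h (s + 1) σ'))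
      ≤ ENNReal.ofReal (runPotential A a h s σ) := by
  set γ : Mat d r → ℝ := fun X => ‖riemGrad A.ρ (avg A.f) X‖ ^ 2 with hγ
  set Q := a * ∑ j ∈ Finset.range s, γ (σ.sel j) with hQ
  have hQ0 : 0 ≤ Q := by positivity
  set σ₀ : EpochState d r := { iter := fun _ => σ.X, ifo := σ.ifo + n, ro := σ.ro } with hσ₀
  have hσ₀m : ∀ j, σ₀.iter j ∈ St d r := fun _ => hσ
  have h1 : ∀ (e : EpochState d r) (k : Fin (A.K + 1)), runPotential A a h (s + 1)
      { X := e.iter A.K, sel := Function.update σ.sel s (e.iter k), ifo := e.ifo, ro := e.ro }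
      = Q + h (e.iter A.K) + a * γ (e.iter k) := fun e k => by
    have h2 : ∑ j ∈ Finset.range s, ‖riemGrad A.ρ (avg A.f)
        (Function.update σ.sel s (e.iter k) j)‖ ^ 2 = ∑ j ∈ Finset.range s, γ (σ.sel j) :=
      Finset.sum_congr rfl fun j hj => by
        rw [Function.update_of_ne (Finset.mem_range.1 hj).ne]
    simp only [runPotential, Finset.sum_range_succ, Function.update_self, h2]
    ring
  rw [epoch, expect_bind]
  simp only [expect_bind, expect_pure, h1]
  have hloop := hV.expect_innerLoop_le hσ₀m le_rfl
  have hsupp := innerLoop_support hV.mem hσ₀m A.K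
  calc _ ≤ expect (innerLoop A s (euclGrad (avg A.f) σ.X) A.K σ₀) (fun e => ENNReal.ofReal Q +
        ENNReal.ofReal (epochPotential A (w * a) V A.K e)) := by
        refine expect_mono _ fun e he => ?_
        obtain ⟨-, hSt, -, -⟩ := hsupp e he
        have hQh : 0 ≤ Q + h (e.iter A.K) := add_nonneg hQ0 (hh _ (hSt _))
        have h3 : ∀ k : Fin (A.K + 1), ENNReal.ofReal (Q + h (e.iter A.K) + a * γ (e.iter k))
            = ENNReal.ofReal (Q + h (e.iter A.K)) + ENNReal.ofReal (a * γ (e.iter k)) := fun k =>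
          ENNReal.ofReal_add hQh (by positivity)
        simp only [h3]
        rw [expect_const_add]
        refine (add_le_add_right (expect_selection_le hw hp hpK (fun k => a * γ (e.iter k))
          fun k => by positivity) _).trans (le_of_eq ?_)
        have h4 : 0 ≤ w * ∑ k ∈ Finset.range A.K, a * γ (e.iter k) :=
          mul_nonneg hw (Finset.sum_nonneg fun k _ => by positivity)
        have h5 : epochPotential A (w * a) V A.K e
            = h (e.iter A.K) + w * ∑ k ∈ Finset.range A.K, a * γ (e.iter k) := by
          rw [epochPotential, hVK, ← Finset.mul_sum]; ring
        rw [h5, ← ENNReal.ofReal_add hQh h4, ← ENNReal.ofReal_add hQ0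
          (add_nonneg (hh _ (hSt _)) h4), add_assoc]
    _ = ENNReal.ofReal Q + expect (innerLoop A s (euclGrad (avg A.f) σ.X) A.K σ₀)
        (fun e => ENNReal.ofReal (epochPotential A (w * a) V A.K e)) := expect_const_add _ _ _
    _ ≤ ENNReal.ofReal Q + ENNReal.ofReal (h σ.X) := by
        gcongr
        rw [← hV0]; exact hloop
    _ = _ := by rw [← ENNReal.ofReal_add hQ0 (hh _ hσ)]; rfl

theorem outerLoop_support
    (hmem : ∀ s, ∀ X ∈ St d r, ∀ X₀ ∈ St d r, ∀ B, nextPoint A s X₀ X B ∈ St d r)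
    {X₀ : Mat d r} (hX₀ : X₀ ∈ St d r) (S : ℕ) :
    ∀ σ ∈ (outerLoop A X₀ S).support, σ.X ∈ St d r ∧ (∀ j, σ.sel j ∈ St d r) ∧
      σ.ifo = S * (n + A.K * (2 * A.b)) ∧ σ.ro = S * A.K := by
  induction S with
  | zero =>
    intro σ hσ
    rw [outerLoop, PMF.mem_support_pure_iff] at hσ
    subst hσ
    exact ⟨hX₀, fun _ => hX₀, by simp, by simp⟩
  | succ S ih =>
    intro σ hσ
    rw [outerLoop, PMF.mem_support_bind_iff] at hσ
    obtain ⟨σ', hσ', hstep⟩ := hσ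
    obtain ⟨hX, hsel, hifo, hro⟩ := ih σ' hσ'
    rw [epoch, PMF.mem_support_bind_iff] at hstep
    obtain ⟨e, he, hstep⟩ := hstep
    obtain ⟨-, hSt, hifo', hro'⟩ := innerLoop_support (hmem S)
      (σ := { iter := fun _ => σ'.X, ifo := σ'.ifo + n, ro := σ'.ro }) (fun _ => hX) A.K e he
    rw [PMF.mem_support_bind_iff] at hstep
    obtain ⟨k, -, hk⟩ := hstep
    rw [PMF.mem_support_pure_iff] at hk
    subst hk
    refine ⟨hSt _, fun j => ?_, ?_, ?_⟩
    · simp only [Function.update_apply]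
      split_ifs
      · exact hSt _
      · exact hsel j
    · simp only [hifo', hifo]; ring
    · simp only [hro', hro]; ring

theorem expect_outerLoop_le {a w : ℝ} {V : ℕ → Mat d r → Mat d r → ℝ}
    (hV : ∀ s, IsPotential A s (w * a) V) (ha : 0 ≤ a) (hw : 0 ≤ w) {h : Mat d r → ℝ}
    (hV0 : ∀ X, V 0 X X = h X) (hVK : ∀ X X₀, V A.K X X₀ = h X) (hh : ∀ X ∈ St d r, 0 ≤ h X)
    (hp : ∀ s, ∀ k : Fin A.K, A.p s k.castSucc ≤ ENNReal.ofReal w)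
    (hpK : ∀ s, A.p s (Fin.last A.K) = 0) {X₀ : Mat d r} (hX₀ : X₀ ∈ St d r) (S : ℕ) :
    expect (outerLoop A X₀ S) (fun σ => ENNReal.ofReal (runPotential A a h S σ))
      ≤ ENNReal.ofReal (h X₀) := by
  induction S with
  | zero => rw [outerLoop, expect_pure]; simp [runPotential]
  | succ S ih =>
    rw [outerLoop, expect_bind]
    refine le_trans (expect_mono _ fun σ hσ => ?_) ih
    exact (hV S).expect_epoch_le ha hw hV0 hVK hh (hp S) (hpK S)
      (outerLoop_support (fun s => (hV s).mem) hX₀ S σ hσ).1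

theorem run_support (hmem : ∀ s, ∀ X ∈ St d r, ∀ X₀ ∈ St d r, ∀ B, nextPoint A s X₀ X B ∈ St d r)
    {X₀ : Mat d r} (hX₀ : X₀ ∈ St d r) (S : ℕ) [NeZero S] :
    ∀ o ∈ (run A X₀ S).support, o.X ∈ St d r ∧ o.ifo = S * (n + A.K * (2 * A.b)) ∧
      o.ro = S * A.K := by
  intro o ho
  rw [run, PMF.mem_support_bind_iff] at ho
  obtain ⟨σ, hσ, ho⟩ := ho
  obtain ⟨-, hsel, hifo, hro⟩ := outerLoop_support hmem hX₀ S σ hσ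
  rw [PMF.mem_support_bind_iff] at ho
  obtain ⟨s, -, hs⟩ := ho
  rw [PMF.mem_support_pure_iff] at hs
  subst hs
  exact ⟨hsel _, hifo, hro⟩

theorem expect_run_le {a w : ℝ} {V : ℕ → Mat d r → Mat d r → ℝ}
    (hV : ∀ s, IsPotential A s (w * a) V) (ha : 0 < a) (hw : 0 ≤ w) {h : Mat d r → ℝ}
    (hV0 : ∀ X, V 0 X X = h X) (hVK : ∀ X X₀, V A.K X X₀ = h X) (hh : ∀ X ∈ St d r, 0 ≤ h X)
    (hp : ∀ s, ∀ k : Fin A.K, A.p s k.castSucc ≤ ENNReal.ofReal w)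
    (hpK : ∀ s, A.p s (Fin.last A.K) = 0) {X₀ : Mat d r} (hX₀ : X₀ ∈ St d r) (S : ℕ) [NeZero S] :
    expect (run A X₀ S) (fun o => ENNReal.ofReal (‖riemGrad A.ρ (avg A.f) o.X‖ ^ 2))
      ≤ ENNReal.ofReal (h X₀ / (S * a)) := by
  have hS : (0 : ℝ) < S := Nat.cast_pos.2 (NeZero.pos S)
  have hC : (0 : ℝ) ≤ 1 / (S * a) := by positivity
  rw [run, expect_bind]
  simp only [expect_bind, expect_pure]
  calc _ ≤ expect (outerLoop A X₀ S) (fun σ => ENNReal.ofReal (1 / (S * a)) *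
        ENNReal.ofReal (runPotential A a h S σ)) := by
        refine expect_mono _ fun σ hσ => ?_
        rw [expect_uniform (fun s : Fin S => ‖riemGrad A.ρ (avg A.f) (σ.sel s)‖ ^ 2)
          fun s => by positivity, ← ENNReal.ofReal_mul hC]
        refine ENNReal.ofReal_le_ofReal ?_
        have h1 := hh _ (outerLoop_support (fun s => (hV s).mem) hX₀ S σ hσ).1
        have h2 : 0 ≤ 1 / (S * a) * h σ.X := mul_nonneg hC h1
        rw [Fintype.card_fin, Fin.sum_univ_eq_sum_range
          (fun s => ‖riemGrad A.ρ (avg A.f) (σ.sel s)‖ ^ 2) S, runPotential, mul_add]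
        have h3 : 1 / ((S : ℝ) * a) * (a * ∑ j ∈ Finset.range S,
            ‖riemGrad A.ρ (avg A.f) (σ.sel j)‖ ^ 2) = 1 / (S : ℝ) * ∑ j ∈ Finset.range S,
            ‖riemGrad A.ρ (avg A.f) (σ.sel j)‖ ^ 2 := by field_simp
        linarith
    _ = ENNReal.ofReal (1 / (S * a)) * expect (outerLoop A X₀ S)
        (fun σ => ENNReal.ofReal (runPotential A a h S σ)) := expect_const_mul _ _ _
    _ ≤ ENNReal.ofReal (1 / (S * a)) * ENNReal.ofReal (h X₀) := by
        gcongr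
        exact expect_outerLoop_le hV ha.le hw hV0 hVK hh hp hpK hX₀ S
    _ = _ := by rw [← ENNReal.ofReal_mul hC]; congr 1; ring

end

/-! ### The potential for the chosen parameters -/

theorem Gam_one (z : ℝ) : Gam z 1 = 0 := by simp [Gam]

theorem Gam_succ {z : ℝ} (hz : z ≠ 0) {i : ℕ} (hi : 0 < i) :
    Gam z (i + 1) = (1 + z) * Gam z i + 1 := by
  obtain ⟨j, rfl⟩ := Nat.exists_eq_succ_of_ne_zero hi.ne'
  simp only [Gam, Nat.succ_eq_add_one, Nat.add_sub_cancel, pow_succ]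
  field_simp
  ring

section

variable {d r n : ℕ} [NeZero n] {ρ L L₁ L₂ C μ κ c : ℝ}

/-- The weights of `‖X - X₀‖²` in the potential of an epoch. -/
noncomputable def potentialWeight (r : ℕ) (ρ L L₁ L₂ C μ c : ℝ) (K k : ℕ) : ℝ :=
  (L₂ * C + L₁ ^ 2 * L) * tauPar r ρ L L₁ L₂ μ c K ^ 2 * L ^ 2 / (nu ρ ^ 2 * Bpar μ K) *
    Gam (2 * betaPar r ρ L L₁ L₂ μ K * tauPar r ρ L L₁ L₂ μ c K +
      Ltil r L₁ L₂ * L ^ 2 * tauPar r ρ L L₁ L₂ μ c K ^ 2 / (nu ρ ^ 2 * Bpar μ K)) (K + 1 - k)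

/-- By `Gam_succ` the weights satisfy exactly the recursion that `sum_innerStep_le` asks for, so the
terms in `‖X - X₀‖²` match and `stepGain` is left. -/
theorem isPotential_inputPar (h : Admissible r ρ L L₁ L₂ C μ κ c) {f : Fin n → Mat d r → ℝ}
    {R : Mat d r → Mat d r → Mat d r} (hf : LipschitzGradients f L) (hR : IsRetraction ρ R)
    (hRc : RetractionConstants ρ R L₁ L₂) (hC : ∀ X ∈ St d r, ‖euclGrad (avg f) X‖ ≤ C) {m : ℝ}
    (hm : ∀ X ∈ St d r, m ≤ avg f X) (p : PMF (Fin (Kpar μ κ n + 1))) (s : ℕ) :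
    IsPotential (inputPar f R ρ L L₁ L₂ μ κ c p) s
      (stepGain ρ c (tauPar r ρ L L₁ L₂ μ c (Kpar μ κ n)))
      (fun k X X₀ => avg f X - m +
        potentialWeight r ρ L L₁ L₂ C μ c (Kpar μ κ n) k * ‖X - X₀‖ ^ 2) := by
  have hK : 0 < Kpar μ κ n := Kpar_pos h.κ_pos n
  have hτ := tauPar_pos (r := r) (μ := μ) h.ρ_nonneg h.L_pos h.one_le_L₁ h.L₂_pos h.c_pos hK
  have hβ := betaPar_pos (r := r) (μ := μ) h.ρ_nonneg h.L_pos h.one_le_L₁ h.L₂_pos hK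
  have hLt := one_le_Ltil (r := r) h.one_le_L₁ h.L₂_pos
  have hν := nu_pos h.ρ_nonneg
  have hLpos := h.L_pos
  have hL₂ := h.L₂_pos
  have hCpos := h.C_pos
  have hB : 0 < Bpar μ (Kpar μ κ n) := Bpar_pos hK
  have hB' : (0 : ℝ) < Bpar μ (Kpar μ κ n) := Nat.cast_pos.2 hB
  have hw0 : ∀ k, 0 ≤ potentialWeight r ρ L L₁ L₂ C μ c (Kpar μ κ n) k := fun k =>
    mul_nonneg (by positivity) (Gam_nonneg (by positivity) _)
  have hnext : ∀ X ∈ St d r, ∀ X₀ ∈ St d r, ∀ B,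
      nextPoint (inputPar f R ρ L L₁ L₂ μ κ c p) s X₀ X B ∈ St d r := by
    intro X hX X₀ _ B
    refine hR.mem X hX _ ?_
    rw [← neg_smul]
    exact smul_mem_Tan (Dop_mem hX _) _
  refine ⟨hnext, (stepGain_pos h.ρ_nonneg h.c_pos hτ).le, fun k _ X hX X₀ _ => ?_,
    fun k hk X hX X₀ hX₀ => ?_⟩
  · have := hm X hX
    have := mul_nonneg (hw0 k) (sq_nonneg ‖X - X₀‖)
    linarith
  · have hk' : k < (Kpar μ κ n) := hk
    have hn : (0 : ℝ) < (n : ℝ) ^ Bpar μ (Kpar μ κ n) := by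
      have : (0 : ℝ) < n := Nat.cast_pos.2 (NeZero.pos n)
      positivity
    have h1 := sum_innerStep_le hB h.ρ_nonneg hR hRc hLpos.le hf hC hX hX₀ (hw0 (k + 1)) hβ hτ.le
      rfl rfl
    have h2 := h.stepGain_le hK (Nat.sub_le (Kpar μ κ n) k) rfl rfl rfl rfl rfl
    set τ := tauPar r ρ L L₁ L₂ μ c (Kpar μ κ n) with hτdef
    set β := betaPar r ρ L L₁ L₂ μ (Kpar μ κ n) with hβdef
    set q := Ltil r L₁ L₂ * L ^ 2 * τ ^ 2 / (nu ρ ^ 2 * Bpar μ (Kpar μ κ n)) with hq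
    set om := (L₂ * C + L₁ ^ 2 * L) * τ ^ 2 * L ^ 2 / (nu ρ ^ 2 * Bpar μ (Kpar μ κ n)) with hom
    have hq0 : 0 ≤ q := by positivity
    have hz : 2 * β * τ + q ≠ 0 := by positivity
    have hwk : potentialWeight r ρ L L₁ L₂ C μ c (Kpar μ κ n) (k + 1) = om * Gam (2 * β * τ + q) ((Kpar μ κ n) - k) := by
      rw [potentialWeight, Nat.add_sub_add_right]
    have hwk' : potentialWeight r ρ L L₁ L₂ C μ c (Kpar μ κ n) k
        = potentialWeight r ρ L L₁ L₂ C μ c (Kpar μ κ n) (k + 1) * (1 + 2 * β * τ + q) + om := by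
      rw [hwk, potentialWeight, Nat.sub_add_comm hk'.le, Gam_succ hz (Nat.sub_pos_of_lt hk')]
      ring
    rw [← hwk] at h2
    have h3 := mul_le_mul_of_nonneg_right h2 (sq_nonneg ‖riemGrad ρ (avg f) X‖)
    have h4 := mul_le_mul_of_nonneg_left h1 (one_div_pos.2 hn).le
    rw [← mul_assoc (1 / (n : ℝ) ^ Bpar μ (Kpar μ κ n)), one_div_mul_cancel hn.ne', one_mul, ← hwk'] at h4
    have h5 : ∀ F : (Fin (Bpar μ (Kpar μ κ n)) → Fin n) → ℝ,
        1 / (n : ℝ) ^ Bpar μ (Kpar μ κ n) * ∑ B, (F B - m) = 1 / (n : ℝ) ^ Bpar μ (Kpar μ κ n) * ∑ B, F B - m := by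
      intro F
      rw [Finset.sum_sub_distrib, Finset.sum_const, Finset.card_univ, Fintype.card_fun,
        Fintype.card_fin, Fintype.card_fin, nsmul_eq_mul, mul_sub]
      push_cast
      rw [← mul_assoc, one_div_mul_cancel hn.ne', one_mul]
    have h6 : 1 / (n : ℝ) ^ Bpar μ (Kpar μ κ n) * ∑ B : Fin (Bpar μ (Kpar μ κ n)) → Fin n,
        (avg f (R X (-(τ • Dop ρ X (stochGrad f X₀ (euclGrad (avg f) X₀) X B)))) - m
          + potentialWeight r ρ L L₁ L₂ C μ c (Kpar μ κ n) (k + 1) *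
          ‖R X (-(τ • Dop ρ X (stochGrad f X₀ (euclGrad (avg f) X₀) X B))) - X₀‖ ^ 2)
        + stepGain ρ c τ * ‖riemGrad ρ (avg f) X‖ ^ 2
        ≤ avg f X - m + potentialWeight r ρ L L₁ L₂ C μ c (Kpar μ κ n) k * ‖X - X₀‖ ^ 2 := by
      simp only [sub_add_eq_add_sub _ m]
      rw [h5]
      linarith
    exact h6

/-! ### The selection law -/

/-- Each `Δ_k` is at most `τν`, and the sum is at least `K τν / 4`; hence the bound `4 / K`. -/
theorem Admissible.exists_selectionLaw (h : Admissible r ρ L L₁ L₂ C μ κ c) :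
    ∃ p : PMF (Fin (Kpar μ κ n + 1)), IsSelectionLaw (DeltaPar r ρ L L₁ L₂ C μ κ c n) p ∧
      ∀ k : Fin (Kpar μ κ n), p k.castSucc ≤ ENNReal.ofReal (4 / Kpar μ κ n) := by
  have hK : 0 < Kpar μ κ n := Kpar_pos h.κ_pos n
  have hb := h.DeltaPar_bounds n
  set K := Kpar μ κ n with hKdef
  set Δ := DeltaPar r ρ L L₁ L₂ C μ κ c n with hΔ
  have hτ := tauPar_pos (r := r) (μ := μ) h.ρ_nonneg h.L_pos h.one_le_L₁ h.L₂_pos h.c_pos hK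
  have hν := nu_pos h.ρ_nonneg
  set T := tauPar r ρ L L₁ L₂ μ c K * nu ρ with hT
  have hT0 : 0 < T := by positivity
  have hΔ0 : ∀ k, 0 < Δ k := fun k => (by positivity : 0 < T / 4).trans_le (hb k).1
  have hK' : (0 : ℝ) < K := Nat.cast_pos.2 hK
  have hsum : (K : ℝ) * (T / 4) ≤ ∑ j ∈ Finset.range K, Δ j := by
    have := Finset.card_nsmul_le_sum (Finset.range K) Δ (T / 4) fun k _ => (hb k).1
    simpa using this
  have hsum0 : 0 < ∑ j ∈ Finset.range K, Δ j := (by positivity : 0 < (K : ℝ) * (T / 4)).trans_le hsum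
  let w : Fin (K + 1) → ℝ≥0∞ := Fin.lastCases 0
    (fun k : Fin K => ENNReal.ofReal (Δ k / ∑ j ∈ Finset.range K, Δ j))
  have hw : ∑ k, w k = 1 := by
    rw [Fin.sum_univ_castSucc]
    simp only [w, Fin.lastCases_castSucc, Fin.lastCases_last, add_zero]
    rw [← ENNReal.ofReal_sum_of_nonneg fun (k : Fin K) _ => (div_pos (hΔ0 k) hsum0).le,
      Fin.sum_univ_eq_sum_range (fun k => Δ k / ∑ j ∈ Finset.range K, Δ j) K, ← Finset.sum_div,
      div_self hsum0.ne', ENNReal.ofReal_one]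
  have hval : ∀ k : Fin K, PMF.ofFintype w hw k.castSucc
      = ENNReal.ofReal (Δ k / ∑ j ∈ Finset.range K, Δ j) := fun k => by
    rw [PMF.ofFintype_apply]; simp only [w, Fin.lastCases_castSucc]
  refine ⟨PMF.ofFintype w hw, ⟨fun k _ => hΔ0 k, hval, ?_⟩, fun k => ?_⟩
  · rw [PMF.ofFintype_apply]; simp only [w, Fin.lastCases_last]
  · rw [hval]
    refine ENNReal.ofReal_le_ofReal ?_
    calc Δ k / ∑ j ∈ Finset.range K, Δ j ≤ T / (K * (T / 4)) := by
          have := (hb k).2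
          gcongr
      _ = 4 / K := by field_simp

/-! ### Stationarity -/

/-- The constant `a` for which `E ‖grad f(X_r)‖² ≤ gap / (S a K^{1-μ})`. -/
noncomputable def rateConst (r : ℕ) (ρ L L₁ L₂ c : ℝ) : ℝ :=
  c * nu ρ ^ 2 * (1 - Real.exp (-(c ^ 2 + 2 * c))) / (16 * (√(Ltil r L₁ L₂) * L))

theorem Admissible.rateConst_pos (h : Admissible r ρ L L₁ L₂ C μ κ c) :
    0 < rateConst r ρ L L₁ L₂ c := by
  have := nu_pos h.ρ_nonneg
  have : 0 < Ltil r L₁ L₂ := one_pos.trans_le (one_le_Ltil h.one_le_L₁ h.L₂_pos)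
  have := h.L_pos
  have hc := h.c_pos
  have h1 : Real.exp (-(c ^ 2 + 2 * c)) < 1 := Real.exp_lt_one_iff.2 (by
    have : 0 < c ^ 2 + 2 * c := by positivity
    linarith)
  have : 0 < 1 - Real.exp (-(c ^ 2 + 2 * c)) := by linarith
  unfold rateConst; positivity

theorem stepGain_mul_eq {K : ℕ} (hK : 0 < K) :
    stepGain ρ c (tauPar r ρ L L₁ L₂ μ c K) * (K / 4)
      = rateConst r ρ L L₁ L₂ c * (K : ℝ) ^ (1 - μ) := by
  have hK' : (0 : ℝ) < K := Nat.cast_pos.2 hK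
  unfold stepGain rateConst tauPar
  rw [Real.rpow_neg hK'.le, Real.rpow_sub hK', Real.rpow_one]
  ring

theorem Admissible.expect_run_inputPar_le (h : Admissible r ρ L L₁ L₂ C μ κ c)
    {f : Fin n → Mat d r → ℝ} {R : Mat d r → Mat d r → Mat d r} (hf : LipschitzGradients f L)
    (hR : IsRetraction ρ R) (hRc : RetractionConstants ρ R L₁ L₂)
    (hC : ∀ X ∈ St d r, ‖euclGrad (avg f) X‖ ≤ C) {X₀ : Mat d r} (hX₀ : X₀ ∈ St d r) {G : ℝ}
    (hG : ∀ Y ∈ St d r, avg f X₀ - avg f Y ≤ G) {p : PMF (Fin (Kpar μ κ n + 1))}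
    (hp : ∀ k : Fin (Kpar μ κ n), p k.castSucc ≤ ENNReal.ofReal (4 / Kpar μ κ n))
    (hpK : p (Fin.last _) = 0) (S : ℕ) [NeZero S] :
    expect (run (inputPar f R ρ L L₁ L₂ μ κ c p) X₀ S)
        (fun o => ENNReal.ofReal (‖riemGrad ρ (avg f) o.X‖ ^ 2))
      ≤ ENNReal.ofReal (G / (S * (rateConst r ρ L L₁ L₂ c * (Kpar μ κ n : ℝ) ^ (1 - μ)))) := by
  have hK : 0 < Kpar μ κ n := Kpar_pos h.κ_pos n
  have hK' : (0 : ℝ) < Kpar μ κ n := Nat.cast_pos.2 hK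
  have hτ := tauPar_pos (r := r) (μ := μ) h.ρ_nonneg h.L_pos h.one_le_L₁ h.L₂_pos h.c_pos hK
  have hg := stepGain_pos h.ρ_nonneg h.c_pos hτ
  -- The lower bound `f(X₀) - G` replaces the minimum, so that the potential at `X₀` is exactly `G`.
  have hm : ∀ X ∈ St d r, avg f X₀ - G ≤ avg f X := fun X hX => by linarith [hG X hX]
  have hpot := isPotential_inputPar h hf hR hRc hC hm p
  have hmul : stepGain ρ c (tauPar r ρ L L₁ L₂ μ c (Kpar μ κ n)) = 4 / (Kpar μ κ n : ℝ) *
      (stepGain ρ c (tauPar r ρ L L₁ L₂ μ c (Kpar μ κ n)) * ((Kpar μ κ n : ℝ) / 4)) := by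
    field_simp
  have h1 := expect_run_le (A := inputPar f R ρ L L₁ L₂ μ κ c p) (w := 4 / (Kpar μ κ n : ℝ))
    (a := stepGain ρ c (tauPar r ρ L L₁ L₂ μ c (Kpar μ κ n)) * ((Kpar μ κ n : ℝ) / 4))
    (h := fun X => avg f X - (avg f X₀ - G)) (fun s => hmul ▸ hpot s) (by positivity)
    (by positivity) (fun X => by simp) (fun X X' => ?_) (fun X hX => sub_nonneg.2 (hm X hX))
    (fun _ => hp) (fun _ => hpK) hX₀ S
  · rw [stepGain_mul_eq hK, sub_sub_cancel] at h1
    exact h1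
  · show avg f X - (avg f X₀ - G) +
      potentialWeight r ρ L L₁ L₂ C μ c (Kpar μ κ n) (Kpar μ κ n) * ‖X - X'‖ ^ 2 = _
    -- At `k = K` the index of `Gam` is 1, where it vanishes.
    rw [potentialWeight, Nat.add_sub_cancel_left, Gam_one]
    ring

/-! ### Complexity -/

theorem Kpar_le {μ κ : ℝ} (hμ : μ ≤ 2 / 3) (hκ : 0 < κ) :
    (Kpar μ κ n : ℝ) ≤ (κ ^ (1 / (3 * (1 - μ))) + 1) * (n : ℝ) ^ (1 / (3 * (1 - μ))) := by
  have hn1 : (1 : ℝ) ≤ n := by exact_mod_cast NeZero.pos n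
  have hp : 0 ≤ 1 / (3 * (1 - μ)) := by
    have : 0 < 1 - μ := by linarith
    positivity
  have h1 : (Kpar μ κ n : ℝ) ≤ (κ * n) ^ (1 / (3 * (1 - μ))) + 1 :=
    (Nat.ceil_lt_add_one (by positivity)).le
  rw [Real.mul_rpow hκ.le (by positivity)] at h1
  have h2 := Real.one_le_rpow hn1 hp
  linarith

/-- The exponent in `K` is chosen so that `K^{1-μ}` dominates `(κ n)^{1/3}` for every `μ`; this
lowers `n / ε` to `n^{2/3} / ε`. -/
theorem le_Kpar_rpow {n : ℕ} {μ κ : ℝ} (hμ : μ ≤ 2 / 3) (hκ : 0 < κ) :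
    κ ^ (1 / 3 : ℝ) * (n : ℝ) ^ (1 / 3 : ℝ) ≤ (Kpar μ κ n : ℝ) ^ (1 - μ) := by
  have h0 : 0 < 1 - μ := by linarith
  have h1 : (κ * n) ^ (1 / (3 * (1 - μ))) ≤ (Kpar μ κ n : ℝ) := Nat.le_ceil _
  have h2 := Real.rpow_le_rpow (by positivity) h1 h0.le
  rw [← Real.rpow_mul (by positivity), Real.mul_rpow hκ.le (by positivity)] at h2
  have h3 : 1 / (3 * (1 - μ)) * (1 - μ) = 1 / 3 := by field_simp
  rwa [h3] at h2

theorem Kpar_rpow_le {μ κ e : ℝ} (hμ : μ ≤ 2 / 3) (hκ : 0 < κ) (he : 0 ≤ e) :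
    (Kpar μ κ n : ℝ) ^ e
      ≤ (κ ^ (1 / (3 * (1 - μ))) + 1) ^ e * (n : ℝ) ^ (e / (3 * (1 - μ))) := by
  have h1 := Real.rpow_le_rpow (by positivity) (Kpar_le (n := n) hμ hκ) he
  rw [Real.mul_rpow (by positivity) (by positivity), ← Real.rpow_mul (by positivity)] at h1
  rwa [one_div_mul_eq_div] at h1

/-- `K |B|` is of order `K^{3(1-μ)}`, hence of order `n`: an epoch costs as much as a full gradient,
up to a constant. -/
theorem epoch_cost_le {μ κ : ℝ} (hμ : μ ≤ 2 / 3) (hκ : 0 < κ) :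
    (n : ℝ) + Kpar μ κ n * (2 * Bpar μ (Kpar μ κ n))
      ≤ (1 + 4 * (κ ^ (1 / (3 * (1 - μ))) + 1) ^ (3 * (1 - μ))) * n := by
  have hK : 0 < Kpar μ κ n := Kpar_pos hκ n
  have hK1 : (1 : ℝ) ≤ Kpar μ κ n := by exact_mod_cast hK
  have hK0 : (0 : ℝ) < Kpar μ κ n := by linarith
  have h0 : 0 < 1 - μ := by linarith
  have h1 := Kpar_rpow_le (n := n) (e := 3 * (1 - μ)) hμ hκ (by positivity)
  rw [div_self (by positivity), Real.rpow_one] at h1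
  have h2 : (Bpar μ (Kpar μ κ n) : ℝ) ≤ 2 * (Kpar μ κ n : ℝ) ^ (2 - 3 * μ) := by
    have h3 : (Bpar μ (Kpar μ κ n) : ℝ) ≤ (Kpar μ κ n : ℝ) ^ (2 - 3 * μ) + 1 :=
      (Nat.ceil_lt_add_one (by positivity)).le
    have h4 := Real.one_le_rpow hK1 (by linarith : 0 ≤ 2 - 3 * μ)
    linarith
  have h5 : (Kpar μ κ n : ℝ) * (Kpar μ κ n : ℝ) ^ (2 - 3 * μ) = (Kpar μ κ n : ℝ) ^ (3 * (1 - μ)) := by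
    rw [← Real.rpow_one_add' hK0.le (by linarith)]
    congr 1; ring
  have h6 : (Kpar μ κ n : ℝ) * (2 * Bpar μ (Kpar μ κ n))
      ≤ Kpar μ κ n * (2 * (2 * (Kpar μ κ n : ℝ) ^ (2 - 3 * μ))) := by gcongr
  linarith

/-- The two oracle counts for `S` epochs, when `S ≤ A / (ε K^{1-μ}) + 2`. -/
theorem oracle_counts_le {μ κ : ℝ} (hμ0 : 0 ≤ μ) (hμ : μ ≤ 2 / 3) (hκ : 0 < κ) {A : ℝ}
    (hA : 0 ≤ A) : ∃ M : ℝ, 0 < M ∧ ∀ (n : ℕ) [NeZero n] (ε : ℝ), 0 < ε → ∀ S : ℕ,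
      (S : ℝ) ≤ A / (ε * (Kpar μ κ n : ℝ) ^ (1 - μ)) + 2 →
      (S : ℝ) * (n + Kpar μ κ n * (2 * Bpar μ (Kpar μ κ n))) ≤ M * ((n : ℝ) ^ (2 / 3 : ℝ) / ε + n) ∧
      (S : ℝ) * Kpar μ κ n
        ≤ M * ((n : ℝ) ^ (μ / (3 * (1 - μ))) / ε + (n : ℝ) ^ (1 / (3 * (1 - μ)))) := by
  set k₀ := κ ^ (1 / (3 * (1 - μ))) + 1 with hk₀
  have hk₀0 : 0 < k₀ := by positivity
  set c₁ := 1 + 4 * k₀ ^ (3 * (1 - μ)) with hc₁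
  have hc₁0 : 0 < c₁ := by positivity
  set κ' := κ ^ (1 / 3 : ℝ) with hκ'
  have hκ'0 : 0 < κ' := by positivity
  -- The sum of the coefficients that occur in the two counts.
  refine ⟨c₁ * (A / κ') + 2 * c₁ + A * k₀ ^ μ + 2 * k₀, by positivity, ?_⟩
  intro n _ ε hε S hS
  have hn : (0 : ℝ) < n := Nat.cast_pos.2 (NeZero.pos n)
  have hK : (0 : ℝ) < Kpar μ κ n := Nat.cast_pos.2 (Kpar_pos hκ n)
  have hlow := le_Kpar_rpow (n := n) hμ hκ
  have hcost := epoch_cost_le (n := n) hμ hκ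
  have hKle := Kpar_le (n := n) hμ hκ
  have hKμ := Kpar_rpow_le (n := n) hμ hκ hμ0
  rw [← hk₀] at hcost hKle hKμ
  rw [← hκ'] at hlow
  rw [← hc₁] at hcost
  constructor
  · have h1 : (S : ℝ) ≤ A / (ε * (κ' * (n : ℝ) ^ (1 / 3 : ℝ))) + 2 := hS.trans (by gcongr)
    have h2 : (n : ℝ) / (n : ℝ) ^ (1 / 3 : ℝ) = (n : ℝ) ^ (2 / 3 : ℝ) := by
      rw [← Real.rpow_one_sub' hn.le (by norm_num)]; norm_num
    calc (S : ℝ) * (n + Kpar μ κ n * (2 * Bpar μ (Kpar μ κ n)))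
        ≤ (A / (ε * (κ' * (n : ℝ) ^ (1 / 3 : ℝ))) + 2) * (c₁ * n) := by gcongr
      _ = c₁ * (A / κ') * ((n : ℝ) / (n : ℝ) ^ (1 / 3 : ℝ) / ε) + 2 * c₁ * n := by
          field_simp
      _ = c₁ * (A / κ') * ((n : ℝ) ^ (2 / 3 : ℝ) / ε) + 2 * c₁ * n := by rw [h2]
      _ ≤ _ := by
          have h3 : 0 ≤ (n : ℝ) ^ (2 / 3 : ℝ) / ε := by positivity
          have h4 : 0 ≤ (2 * c₁ + A * k₀ ^ μ + 2 * k₀) * ((n : ℝ) ^ (2 / 3 : ℝ) / ε) := by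
            positivity
          have h5 : 0 ≤ (c₁ * (A / κ') + A * k₀ ^ μ + 2 * k₀) * (n : ℝ) := by positivity
          linarith
  · have h2 : (Kpar μ κ n : ℝ) / (Kpar μ κ n : ℝ) ^ (1 - μ) = (Kpar μ κ n : ℝ) ^ μ := by
      rw [Real.rpow_sub hK, Real.rpow_one]
      have : (Kpar μ κ n : ℝ) ^ μ ≠ 0 := by positivity
      field_simp
    calc (S : ℝ) * Kpar μ κ n ≤ (A / (ε * (Kpar μ κ n : ℝ) ^ (1 - μ)) + 2) * Kpar μ κ n := by gcongr
      _ = A * ((Kpar μ κ n : ℝ) / (Kpar μ κ n : ℝ) ^ (1 - μ) / ε) + 2 * Kpar μ κ n := by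
          field_simp
      _ = A * ((Kpar μ κ n : ℝ) ^ μ / ε) + 2 * Kpar μ κ n := by rw [h2]
      _ ≤ A * (k₀ ^ μ * (n : ℝ) ^ (μ / (3 * (1 - μ))) / ε)
          + 2 * (k₀ * (n : ℝ) ^ (1 / (3 * (1 - μ)))) := by gcongr
      _ ≤ _ := by
          set x := (n : ℝ) ^ (μ / (3 * (1 - μ))) / ε with hx
          set y := (n : ℝ) ^ (1 / (3 * (1 - μ))) with hy
          have h3 : 0 ≤ x := by positivity
          have h3' : 0 ≤ y := by positivity
          rw [mul_div_assoc, ← hx]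
          have h4 : 0 ≤ (c₁ * (A / κ') + 2 * c₁ + 2 * k₀) * x := by positivity
          have h5 : 0 ≤ (c₁ * (A / κ') + 2 * c₁ + A * k₀ ^ μ) * y := by positivity
          linarith

end

end SSVRG

/-! ### The main theorem -/

open SSVRG in
theorem mainTheorem1 (r : ℕ) (ρ : ℝ) (hρ : 0 ≤ ρ) :
    -- the constants `L₁`, `L₂` and `C` that enter the parameters exist
    (∀ (d : ℕ) (R : Mat d r → Mat d r → Mat d r), IsRetraction ρ R →
      ∃ L₁ L₂ : ℝ, RetractionConstants ρ R L₁ L₂) ∧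
    (∀ (d n : ℕ) [NeZero n] (f : Fin n → Mat d r → ℝ) (L : ℝ), LipschitzGradients f L →
      ∃ C : ℝ, 0 < C ∧ ∀ X ∈ St d r, ‖euclGrad (avg f) X‖ ≤ C) ∧
    -- the complexity bounds; `M` is the constant hidden in the `O`-notation, and `G` is a bound on
    -- the initial gap `f(X^{0,0}) - min f`
    (∀ L L₁ L₂ C μ κ c G : ℝ, 0 < L → 0 < C → 0 ≤ μ → μ ≤ 2 / 3 → 0 < κ → 0 < c → c < 1 →
      Lhat L L₁ L₂ C / (√(Ltil r L₁ L₂) * L) * Real.exp (c ^ 2 + 2 * c) * c ≤ 1 →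
      ∃ M : ℝ, 0 < M ∧
        ∀ (d n : ℕ) [NeZero n] (f : Fin n → Mat d r → ℝ) (R : Mat d r → Mat d r → Mat d r)
          (X₀ : Mat d r),
          LipschitzGradients f L → IsRetraction ρ R → RetractionConstants ρ R L₁ L₂ →
          (∀ X ∈ St d r, ‖euclGrad (avg f) X‖ ≤ C) →
          X₀ ∈ St d r → (∀ Y ∈ St d r, avg f X₀ - avg f Y ≤ G) →
          ∃ p : PMF (Fin (Kpar μ κ n + 1)),
            IsSelectionLaw (DeltaPar r ρ L L₁ L₂ C μ κ c n) p ∧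
            ∀ ε : ℝ, 0 < ε → ∃ (S : ℕ) (_ : NeZero S),
              IsStochStationary ρ (avg f) ε (run (inputPar f R ρ L L₁ L₂ μ κ c p) X₀ S) ∧
              ∀ o ∈ (run (inputPar f R ρ L L₁ L₂ μ κ c p) X₀ S).support,
                (o.ifo : ℝ) ≤ M * ((n : ℝ) ^ (2 / 3 : ℝ) / ε + n) ∧
                (o.ro : ℝ) ≤ M * ((n : ℝ) ^ (μ / (3 * (1 - μ))) / ε
                  + (n : ℝ) ^ (1 / (3 * (1 - μ)))) ∧
                (μ = 0 → (o.ro : ℝ) ≤ M * (1 / ε + (n : ℝ) ^ (1 / 3 : ℝ)))) := by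
  refine ⟨fun d R hR => hR.exists_constants, fun d n _ f L hf => exists_gradient_bound hf, ?_⟩
  intro L L₁ L₂ C μ κ c G hL hC hμ0 hμ hκ hc hc1 hcond
  -- `M` is chosen before the retraction is known. If `L₁`, `L₂` are out of range, no retraction has
  -- these constants and any `M` will do.
  by_cases hadm : 1 ≤ L₁ ∧ 0 < L₂
  swap
  · exact ⟨1, one_pos, fun d n _ f R X₀ _ _ hRc => absurd ⟨hRc.one_le, hRc.pos⟩ hadm⟩
  have h : Admissible r ρ L L₁ L₂ C μ κ c :=
    ⟨hρ, hL, hadm.1, hadm.2, hC, hμ0, hμ, hκ, hc, hc1, hcond⟩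
  have ha := h.rateConst_pos
  set a := rateConst r ρ L L₁ L₂ c with hadef
  -- `G ≥ 0` is known only once a point `X₀` is given, hence the absolute value.
  obtain ⟨M, hM, hcount⟩ := oracle_counts_le hμ0 hμ hκ (A := |G| / a) (by positivity)
  refine ⟨M, hM, ?_⟩
  intro d n _ f R X₀ hf hR hRc hCb hX₀ hG
  obtain ⟨p, hsel, hp⟩ := h.exists_selectionLaw (n := n)
  refine ⟨p, hsel, fun ε hε => ?_⟩
  have hG0 : 0 ≤ G := by simpa using hG X₀ hX₀
  rw [abs_of_nonneg hG0] at hcount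
  have hK : (0 : ℝ) < Kpar μ κ n := Nat.cast_pos.2 (Kpar_pos hκ n)
  have hKp : (0 : ℝ) < (Kpar μ κ n : ℝ) ^ (1 - μ) := by positivity
  -- The real number of epochs that gives accuracy `ε`. The witness `⌈y⌉₊ + 1` is positive even for
  -- `G = 0` and at most `y + 2`.
  set y := G / a / (ε * (Kpar μ κ n : ℝ) ^ (1 - μ)) with hy
  have hy0 : 0 ≤ y := by positivity
  have hmem : ∀ s, ∀ X ∈ St d r, ∀ Y ∈ St d r, ∀ B,
      nextPoint (inputPar f R ρ L L₁ L₂ μ κ c p) s Y X B ∈ St d r := fun s =>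
    (isPotential_inputPar h hf hR hRc hCb (m := avg f X₀ - G)
      (fun X hX => by linarith [hG X hX]) p s).mem
  have hS1 : y ≤ ((⌈y⌉₊ + 1 : ℕ) : ℝ) := by
    push_cast
    linarith [Nat.le_ceil y]
  have hS2 : ((⌈y⌉₊ + 1 : ℕ) : ℝ) ≤ y + 2 := by
    push_cast
    linarith [Nat.ceil_lt_add_one hy0]
  have hS0 : (0 : ℝ) < ((⌈y⌉₊ + 1 : ℕ) : ℝ) := by positivity
  have hsupp := run_support hmem hX₀ (⌈y⌉₊ + 1)
  obtain ⟨hifo, hro⟩ := hcount n ε hε (⌈y⌉₊ + 1) hS2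
  refine ⟨⌈y⌉₊ + 1, inferInstance, ⟨fun o ho => (hsupp o ho).1, ?_⟩, fun o ho => ?_⟩
  · refine (h.expect_run_inputPar_le hf hR hRc hCb hX₀ hG hp hsel.2.2 _).trans
      (ENNReal.ofReal_le_ofReal ?_)
    rw [← hadef, div_le_iff₀ (by positivity)]
    calc G = y * (ε * (a * (Kpar μ κ n : ℝ) ^ (1 - μ))) := by rw [hy]; field_simp
      _ ≤ ((⌈y⌉₊ + 1 : ℕ) : ℝ) * (ε * (a * (Kpar μ κ n : ℝ) ^ (1 - μ))) := by gcongr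
      _ = _ := by ring
  · obtain ⟨-, h1, h2⟩ := hsupp o ho
    have h1' : (o.ifo : ℝ) = ((⌈y⌉₊ + 1 : ℕ) : ℝ) *
        (n + Kpar μ κ n * (2 * Bpar μ (Kpar μ κ n))) := by
      rw [h1]; push_cast; rfl
    have h2' : (o.ro : ℝ) = ((⌈y⌉₊ + 1 : ℕ) : ℝ) * Kpar μ κ n := by
      rw [h2]; push_cast; rfl
    refine ⟨h1' ▸ hifo, h2' ▸ hro, fun hμz => ?_⟩
    have h3 := h2' ▸ hro
    rw [hμz] at h3
    simpa using h3
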